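/- Let $(X,\omega)$ be a smooth symplectic manifold of dimension $2n$ (Hausdorff, second countable, without boundary), and let $L,L'\subset X$ be embedded Lagrangian submanifolds that intersect transversely, i.e. $T_xL+T_xL'=T_xX$ for every $x\in L\cap L'$. Assume that $L\cap L'$ is a closed subset of $X$ (this is automatic if $L$ and $L'$ are closed subsets of $X$, e.g. compact). Then there exists a smooth almost complex structure $J$ on $X$ compatible with $\omega$ (that is, $\omega(Ju,Jv)=\omega(u,v)$ for all $u,v$, and $\omega(u,Ju)>0$ for $u\neq 0$) such that the intersection of $L$ and $L'$ is locally standard. Here the intersection of $L$ and $L'$ is called locally standard (with respect to $\omega$ and $J$) if for every $x\in L\cap L'$ there exist an integer $0\le k\le n$, an open set $U\subset\mathbb{C}^n$ containing $0$, and a diffeomorphism $\phi$ from $U$ onto an open subset of $X$ such that $\phi(0)=x$, $\phi^{-1}(L)=U\cap\sqrt{-1}\,\mathbb{R}^n$, $\phi^{-1}(L')=U\cap(\mathbb{R}^{n-k}\times\sqrt{-1}\,\mathbb{R}^k)$, $\phi^*J=J_{\mathbb{C}^n}$ (multiplication by $\sqrt{-1}$) and $\phi^*\omega=\omega_{\mathbb{C}^n}=\sum_{j=1}^n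 dx_j\wedge dy_j$, where $z_j=x_j+\sqrt{-1}\,y_j$. Moreover, for this $J$, the chart at every $x\in L\cap L'$ can be chosen with $k=0$, so that $\phi^{-1}(L)=U\cap\sqrt{-1}\,\mathbb{R}^n$ and $\phi^{-1}(L')=U\cap\mathbb{R}^n$. -/

import Mathlib

open scoped Manifold ContDiff

noncomputable section

/-- The space `ℂⁿ`. -/
abbrev CSpace (n : ℕ) : Type := EuclideanSpace ℂ (Fin n)

/-- The standard symplectic form `∑ⱼ dxⱼ ∧ dyⱼ` of `ℂⁿ`, where `zⱼ = xⱼ + √-1 yⱼ`. -/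
def stdSymplectic {n : ℕ} (u v : CSpace n) : ℝ :=
  ∑ j : Fin n, ((u j).re * (v j).im - (u j).im * (v j).re)

/-- The linear subspace `ℝⁿ⁻ᵏ × √-1 ℝᵏ` of `ℂⁿ`, for `k ≤ n`. -/
def mixedPlane (n k : ℕ) : Set (CSpace n) :=
  {z | ∀ j : Fin n, if (j : ℕ) + k < n then (z j).im = 0 else (z j).re = 0}

/-- The linear subspace `√-1 ℝⁿ` of `ℂⁿ`. -/
def imagPlane (n : ℕ) : Set (CSpace n) :=
  {z | ∀ j : Fin n, (z j).re = 0}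

/-- The linear subspace `ℝⁿ` of `ℂⁿ`. -/
def realPlane (n : ℕ) : Set (CSpace n) :=
  {z | ∀ j : Fin n, (z j).im = 0}

section Structures

variable (E : Type*) [NormedAddCommGroup E] [NormedSpace ℝ E]
  (X : Type*) [TopologicalSpace X] [ChartedSpace E X]

/-- A family of alternating bilinear forms on the tangent spaces of `X`. -/
abbrev TwoForm : Type _ :=
  ∀ x : X, (TangentSpace 𝓘(ℝ, E) x) [⋀^Fin 2]→L[ℝ] ℝ

variable {E X}

/-- The expression of a two-form in the chart `e`, that is, its pullback along `e.symm`
(meaningful on `e.target`). -/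
def TwoForm.inChart (σ : TwoForm E X) (e : OpenPartialHomeomorph X E) (y : E) :
    E [⋀^Fin 2]→L[ℝ] ℝ :=
  (σ (e.symm y)).compContinuousLinearMap (mfderiv 𝓘(ℝ, E) 𝓘(ℝ, E) e.symm y)

variable (E X) in
/-- A symplectic form on `X`: a smooth closed nondegenerate two-form. -/
structure SymplecticForm where
  toForm : TwoForm E X
  smooth : ∀ e ∈ atlas E X, ContDiffOn ℝ ∞ (toForm.inChart e) e.target
  closed : ∀ e ∈ atlas E X, ∀ y ∈ e.target, extDeriv (toForm.inChart e) y = 0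
  nondegenerate : ∀ (x : X) (u : TangentSpace 𝓘(ℝ, E) x),
    (∀ v : TangentSpace 𝓘(ℝ, E) x, toForm x ![u, v] = 0) → u = 0

variable (E X) in
/-- An almost complex structure on `X`: a smooth field of endomorphisms of the tangent spaces of
`X` with square `-1`. -/
structure AlmostComplexStructure [IsManifold 𝓘(ℝ, E) ∞ X] where
  toEnd : ∀ x : X, TangentSpace 𝓘(ℝ, E) x →L[ℝ] TangentSpace 𝓘(ℝ, E) x
  smooth : haveI : IsManifold 𝓘(ℝ, E) 1 X := .of_le (n := ∞) (by simp)
    ContMDiff 𝓘(ℝ, E) (𝓘(ℝ, E).prod 𝓘(ℝ, E →L[ℝ] E)) ∞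
      (fun x ↦ Bundle.TotalSpace.mk' (E →L[ℝ] E)
        (E := fun x : X ↦ TangentSpace 𝓘(ℝ, E) x →L[ℝ] TangentSpace 𝓘(ℝ, E) x) x (toEnd x))
  sq_eq_neg : ∀ (x : X) (u : TangentSpace 𝓘(ℝ, E) x), toEnd x (toEnd x u) = -u

variable [IsManifold 𝓘(ℝ, E) ∞ X]

/-- `J` is compatible with `σ`: `σ(J u, J v) = σ(u, v)`, and `σ(u, J u) > 0` for `u ≠ 0`; in other
words `σ(·, J ·)` is a Riemannian metric. -/
def AlmostComplexStructure.IsCompatible (J : AlmostComplexStructure E X)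
    (σ : SymplecticForm E X) : Prop :=
  ∀ x : X,
    (∀ u v : TangentSpace 𝓘(ℝ, E) x,
      σ.toForm x ![J.toEnd x u, J.toEnd x v] = σ.toForm x ![u, v]) ∧
    (∀ u : TangentSpace 𝓘(ℝ, E) x, u ≠ 0 → 0 < σ.toForm x ![u, J.toEnd x u])

/-- `φ`, defined on the open subset `φ.source` of `ℂⁿ`, is a holomorphic symplectic chart of `X`
centered at `x`: it is a diffeomorphism onto an open subset of `X` with `φ(0) = x`, `φ^* J = J_{ℂⁿ}`
and `φ^* σ = ∑ⱼ dxⱼ ∧ dyⱼ`. -/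
structure IsKahlerChartAt {n : ℕ} (σ : SymplecticForm E X) (J : AlmostComplexStructure E X)
    (x : X) (φ : OpenPartialHomeomorph (CSpace n) X) : Prop where
  zero_mem : 0 ∈ φ.source
  map_zero : φ 0 = x
  smooth : ContMDiffOn 𝓘(ℝ, CSpace n) 𝓘(ℝ, E) ∞ φ φ.source
  smooth_symm : ContMDiffOn 𝓘(ℝ, E) 𝓘(ℝ, CSpace n) ∞ φ.symm φ.target
  pullback_complex : ∀ z ∈ φ.source, ∀ u : CSpace n,
    mfderiv 𝓘(ℝ, CSpace n) 𝓘(ℝ, E) φ z (Complex.I • u : CSpace n) =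
      J.toEnd (φ z) (mfderiv 𝓘(ℝ, CSpace n) 𝓘(ℝ, E) φ z u)
  pullback_symplectic : ∀ z ∈ φ.source, ∀ u v : CSpace n,
    σ.toForm (φ z) ![mfderiv 𝓘(ℝ, CSpace n) 𝓘(ℝ, E) φ z u,
      mfderiv 𝓘(ℝ, CSpace n) 𝓘(ℝ, E) φ z v] = stdSymplectic u v

/-- The intersection of the subsets `A` and `B` of the `2n`-dimensional manifold `X` is locally
standard: around every point of `A ∩ B` there is a holomorphic symplectic chart in which `A` is
`√-1 ℝⁿ` and `B` is `ℝⁿ⁻ᵏ × √-1 ℝᵏ` for some `0 ≤ k ≤ n`. -/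
def LocallyStandard (n : ℕ) (σ : SymplecticForm E X) (J : AlmostComplexStructure E X)
    (A B : Set X) : Prop :=
  ∀ x ∈ A ∩ B, ∃ φ : OpenPartialHomeomorph (CSpace n) X, ∃ k ≤ n,
    IsKahlerChartAt σ J x φ ∧
    φ.source ∩ φ ⁻¹' A = φ.source ∩ imagPlane n ∧
    φ.source ∩ φ ⁻¹' B = φ.source ∩ mixedPlane n k

end Structures

section Lagrangian

variable (n : ℕ) {E : Type*} [NormedAddCommGroup E] [NormedSpace ℝ E]
  {X : Type*} [TopologicalSpace X] [ChartedSpace E X]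
  {L L' : Type*} [TopologicalSpace L] [ChartedSpace (EuclideanSpace ℝ (Fin n)) L]
  [TopologicalSpace L'] [ChartedSpace (EuclideanSpace ℝ (Fin n)) L']

/-- The smooth embedding `ι` of the `n`-dimensional manifold `L` in `X` is Lagrangian:
`dim X = 2n` and `ι^* σ = 0`. Its image is an embedded Lagrangian submanifold of `X`. -/
structure IsLagrangianEmbedding (σ : SymplecticForm E X) (ι : L → X) : Prop where
  isSmoothEmbedding : Manifold.IsSmoothEmbedding (𝓡 n) 𝓘(ℝ, E) ∞ ι
  half_dim : Module.finrank ℝ E = 2 * n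
  isotropic : ∀ (p : L) (u v : TangentSpace (𝓡 n) p),
    σ.toForm (ι p) ![mfderiv (𝓡 n) 𝓘(ℝ, E) ι p u, mfderiv (𝓡 n) 𝓘(ℝ, E) ι p v] = 0

/-- The image of the differential of `ι` at `p`, a subspace of `T_{ι p} X`, whose underlying
vector space is `E`. -/
def tangentImage (E : Type*) [NormedAddCommGroup E] [NormedSpace ℝ E] [ChartedSpace E X]
    (ι : L → X) (p : L) : Submodule ℝ E :=
  (mfderiv (𝓡 n) 𝓘(ℝ, E) ι p : EuclideanSpace ℝ (Fin n) →L[ℝ] E).range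

/-- The images of `ι` and `ι'` intersect transversely: at every intersection point, their tangent
spaces together span the tangent space of `X`. -/
def IntersectTransversely (E : Type*) [NormedAddCommGroup E] [NormedSpace ℝ E]
    [ChartedSpace E X] (ι : L → X) (ι' : L' → X) : Prop :=
  ∀ (p : L) (q : L'), ι p = ι' q →
    tangentImage n E ι p ⊔ tangentImage n E ι' q = ⊤

end Lagrangian

end

/-! The almost complex structure comes from a polar decomposition. Given a Riemannian metric `g`,
write `g(u, Av) = ω(u, v)` with `A` skew for `g`; then `J = A⁻¹ √(-A²)` is compatible with `ω` and
orthogonal for `g`, and it is the only such structure (`IsPolar.unique`). So `J` at a point depends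
only on `g` and `ω` at that point. If a chart is symplectic and `g` is Euclidean in it, then `J` is
multiplication by `√-1` there. It is therefore enough to find Darboux charts adapted to the two
Lagrangians, and a metric that is Euclidean in such a chart near each intersection point.

Adapted charts (`exists_symplectic_chart`): near an intersection point, `L` and `L'` are zero sets
of maps `F₁`, `F₂` to `ℝⁿ`. By transversality and a dimension count `(F₁, F₂)` is a local
diffeomorphism, so both submanifolds become complementary linear subspaces. Moser's argument makes
the form constant. The primitive used is the radial one, which vanishes on any subspace that is
isotropic for the form at each of its points. Moser's field is then orthogonal to each of the two
Lagrangian subspaces, hence tangent to it, and the flow preserves both. A linear change of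
coordinates sends the constant form to the standard one and the two subspaces to `√-1 ℝⁿ` and `ℝⁿ`.

Metric (`exists_glued_metric`): since `√-1 ℝⁿ ∩ ℝⁿ = 0`, an adapted chart contains one intersection
point only. As the intersection is closed, the covering can be chosen so that each intersection
point lies in a single member. The partition of unity then equals one near that point, and gluing
leaves the Euclidean metric of the adapted chart untouched there.

Two analytic inputs are proved by the inverse function theorem. Smooth dependence of flows is
obtained on the Banach space of curves (`exists_smooth_flow`). Smoothness of the polar decomposition
is obtained from the squaring map on endomorphisms (`exists_smooth_polar`). -/

noncomputable section

open scoped Topology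
open Set Filter

set_option maxSynthPendingDepth 3

/-! ### Smoothness of superposition operators -/

section Superposition

universe u

variable {K : Type*} [TopologicalSpace K] [CompactSpace K]

/-- Pointwise application of a continuous family of operators, as a continuous bilinear map. -/
def ContinuousMap.pointwiseApply (K : Type*) [TopologicalSpace K] [CompactSpace K]
    (E F : Type*) [NormedAddCommGroup E] [NormedSpace ℝ E] [NormedAddCommGroup F]
    [NormedSpace ℝ F] : C(K, E →L[ℝ] F) →L[ℝ] C(K, E) →L[ℝ] C(K, F) :=
  LinearMap.mkContinuous₂
    (LinearMap.mk₂ ℝ (fun (A : C(K, E →L[ℝ] F)) (h : C(K, E)) ↦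
        (⟨fun t ↦ A t (h t), by fun_prop⟩ : C(K, F)))
      (fun _ _ _ ↦ by ext; simp) (fun _ _ _ ↦ by ext; simp)
      (fun _ _ _ ↦ by ext; simp) (fun _ _ _ ↦ by ext; simp)) 1
    (fun A h ↦ by
      rw [one_mul]
      refine (ContinuousMap.norm_le _ (by positivity)).2 fun t ↦ ?_
      exact (A t).le_of_opNorm_le_of_le (A.norm_coe_le_norm t) (h.norm_coe_le_norm t))

@[simp]
theorem ContinuousMap.pointwiseApply_apply {E F : Type*} [NormedAddCommGroup E] [NormedSpace ℝ E]
    [NormedAddCommGroup F] [NormedSpace ℝ F] (A : C(K, E →L[ℝ] F)) (h : C(K, E)) (t : K) :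
    ContinuousMap.pointwiseApply K E F A h t = A t (h t) := rfl

/-- The pointwise first-order error is controlled by the mean value inequality. It is uniform in `t`
because `g'` is uniformly continuous near the compact range of `γ`. -/
theorem hasFDerivAt_superposition {E F : Type*} [NormedAddCommGroup E] [NormedSpace ℝ E]
    [NormedAddCommGroup F] [NormedSpace ℝ F] (g : C(E, F)) (g' : C(E, E →L[ℝ] F))
    (hg : ∀ x, HasFDerivAt g (g' x) x) (γ : C(K, E)) :
    HasFDerivAt (fun η : C(K, E) ↦ g.comp η)
      (ContinuousMap.pointwiseApply K E F (g'.comp γ)) γ := by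
  rw [hasFDerivAt_iff_isLittleO, Asymptotics.isLittleO_iff]
  intro c hc
  have hcomp : IsCompact (range γ) := isCompact_range γ.continuous
  have hunif := hcomp.uniformContinuousAt_of_continuousAt g'
    (fun a _ ↦ g'.continuous.continuousAt) (Metric.dist_mem_uniformity hc)
  obtain ⟨δ, hδ, hδ'⟩ := Metric.mem_uniformity_dist.1 hunif
  filter_upwards [Metric.ball_mem_nhds γ hδ] with η hη
  refine (ContinuousMap.norm_le _ (by positivity)).2 fun t ↦ ?_
  have hηt : dist (η t) (γ t) < δ := (ContinuousMap.dist_apply_le_dist t).trans_lt hη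
  have := (convex_ball (γ t) δ).norm_image_sub_le_of_norm_hasFDerivWithin_le'
    (f := g) (f' := g') (φ := g' (γ t)) (C := c) (x := γ t) (y := η t)
    (fun x _ ↦ (hg x).hasFDerivWithinAt)
    (fun x hx ↦ by
      have h := @hδ' (γ t) x (by rw [dist_comm]; exact hx) (mem_range_self t)
      rw [← dist_eq_norm, dist_comm]
      exact (show dist (g' (γ t)) (g' x) < c from h).le)
    (Metric.mem_ball_self hδ) hηt
  calc _ = ‖g (η t) - g (γ t) - g' (γ t) (η t - γ t)‖ := by simp
    _ ≤ c * ‖η t - γ t‖ := this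
    _ ≤ c * ‖η - γ‖ := by
      gcongr
      exact (η - γ).norm_coe_le_norm t

/-- Induction on the order: the derivative is superposition with `g'` followed by the continuous
linear map `pointwiseApply`. The target changes from `F` to `E →L[ℝ] F` at each step, which is why
both spaces share one universe. -/
theorem contDiff_superposition {E F : Type u} [NormedAddCommGroup E] [NormedSpace ℝ E]
    [NormedAddCommGroup F] [NormedSpace ℝ F] (g : C(E, F)) (hg : ContDiff ℝ ∞ g) :
    ContDiff ℝ ∞ (fun η : C(K, E) ↦ g.comp η) := by
  refine contDiff_infty.2 fun n ↦ ?_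
  replace hg := contDiff_infty.1 hg n
  induction n generalizing F with
  | zero =>
    refine contDiff_zero.2 ?_
    exact g.continuous_postcomp
  | succ n ih =>
    obtain ⟨g', hg', hgd⟩ := contDiff_succ_iff_hasFDerivAt.1 hg
    refine contDiff_succ_iff_hasFDerivAt.2
      ⟨_, ?_, hasFDerivAt_superposition g ⟨g', hg'.continuous⟩ hgd⟩
    exact (ContinuousMap.pointwiseApply K E F).contDiff.comp (ih ⟨g', hg'.continuous⟩ hg')

end Superposition

/-! ### The smooth inverse function theorem -/

/-- The source is cut down to the open set where the derivative is invertible, which makes the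
inverse smooth on its whole domain and not only at the image of `a`. -/
theorem exists_openPartialHomeomorph_of_contDiffOn {E F : Type*} [NormedAddCommGroup E]
    [NormedSpace ℝ E] [CompleteSpace E] [NormedAddCommGroup F] [NormedSpace ℝ F]
    {f : E → F} {U : Set E} (hU : IsOpen U) (hf : ContDiffOn ℝ ∞ f U) {a : E} (ha : a ∈ U)
    (f' : E ≃L[ℝ] F) (hf' : HasFDerivAt f (f' : E →L[ℝ] F) a) :
    ∃ e : OpenPartialHomeomorph E F, ⇑e = f ∧ a ∈ e.source ∧ e.source ⊆ U ∧
      (∀ x ∈ e.source, ∃ D : E ≃L[ℝ] F, HasFDerivAt f (D : E →L[ℝ] F) x) ∧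
      ContDiffOn ℝ ∞ e.symm e.target := by
  have hfa : ContDiffAt ℝ ∞ f a := hf.contDiffAt (hU.mem_nhds ha)
  have hcont : ContinuousOn (fderiv ℝ f) U := hf.continuousOn_fderiv_of_isOpen hU (by simp)
  set V := U ∩ fderiv ℝ f ⁻¹' (range ((↑) : (E ≃L[ℝ] F) → (E →L[ℝ] F)))
  have hV : IsOpen V := hcont.isOpen_inter_preimage hU ContinuousLinearEquiv.isOpen
  have haV : a ∈ V := ⟨ha, f', hf'.fderiv.symm⟩
  set e₀ := hfa.toOpenPartialHomeomorph f hf' (by simp)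
  have hsrc : (e₀.restrOpen V hV).source ⊆ V := fun x hx ↦ by
    rw [OpenPartialHomeomorph.restrOpen_source] at hx
    exact hx.2
  have hD : ∀ x ∈ (e₀.restrOpen V hV).source,
      ∃ D : E ≃L[ℝ] F, HasFDerivAt f (D : E →L[ℝ] F) x := by
    intro x hx
    obtain ⟨hxU, D, hD⟩ := hsrc hx
    refine ⟨D, ?_⟩
    rw [hD]
    exact ((hf.contDiffAt (hU.mem_nhds hxU)).differentiableAt (by simp)).hasFDerivAt
  refine ⟨e₀.restrOpen V hV, rfl, ?_, fun x hx ↦ (hsrc hx).1, hD, ?_⟩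
  · rw [OpenPartialHomeomorph.restrOpen_source]
    exact ⟨hfa.mem_toOpenPartialHomeomorph_source hf' (by simp), haV⟩
  · intro y hy
    have hx := (e₀.restrOpen V hV).map_target hy
    obtain ⟨D, hD⟩ := hD _ hx
    exact ((e₀.restrOpen V hV).contDiffAt_symm hy hD
      (hf.contDiffAt (hU.mem_nhds (hsrc hx).1))).contDiffWithinAt

/-! ### Smooth dependence of flows on the initial condition -/

section Flow

universe u

open unitInterval

variable {E : Type u} [NormedAddCommGroup E] [NormedSpace ℝ E]

/-- The operator sending a continuous curve on the unit interval to its primitive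
vanishing at zero. -/
def primitive (E : Type*) [NormedAddCommGroup E] [NormedSpace ℝ E] : C(I, E) →L[ℝ] C(I, E) :=
  LinearMap.mkContinuous
    { toFun := fun h ↦ ⟨fun t ↦ ∫ s in (0 : ℝ)..t, h (projIcc 0 1 zero_le_one s), by
        have : Continuous fun t : ℝ ↦ ∫ s in (0 : ℝ)..t, h (projIcc 0 1 zero_le_one s) :=
          intervalIntegral.continuous_primitive (fun a b ↦ Continuous.intervalIntegrable
            (h.continuous.comp continuous_projIcc) a b) 0
        exact this.comp continuous_subtype_val⟩
      map_add' := fun h k ↦ by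
        ext t
        exact intervalIntegral.integral_add
          (Continuous.intervalIntegrable (h.continuous.comp continuous_projIcc) _ _)
          (Continuous.intervalIntegrable (k.continuous.comp continuous_projIcc) _ _)
      map_smul' := fun c h ↦ by
        ext t
        exact intervalIntegral.integral_smul c _ } 1
    (fun h ↦ by
      refine (ContinuousMap.norm_le _ (by positivity)).2 fun t ↦ ?_
      have := intervalIntegral.norm_integral_le_of_norm_le_const (a := (0 : ℝ)) (b := t)
        (f := fun s ↦ h (projIcc 0 1 zero_le_one s)) (C := ‖h‖)
        (fun s _ ↦ h.norm_coe_le_norm _)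
      refine this.trans ?_
      rw [mul_comm, sub_zero, abs_of_nonneg t.2.1]
      exact mul_le_mul_of_nonneg_right t.2.2 (norm_nonneg _))

theorem primitive_apply (h : C(I, E)) (t : I) :
    primitive E h t = ∫ s in (0 : ℝ)..t, h (projIcc 0 1 zero_le_one s) := rfl

theorem primitive_apply_zero (h : C(I, E)) : primitive E h 0 = 0 := by
  simp [primitive_apply]

theorem hasDerivWithinAt_primitive [CompleteSpace E] (h : C(I, E)) {t : ℝ} (ht : t ∈ Icc (0 : ℝ) 1) :
    HasDerivWithinAt (fun s ↦ primitive E h (projIcc 0 1 zero_le_one s))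
      (h (projIcc 0 1 zero_le_one t)) (Icc 0 1) t := by
  have hc : Continuous fun s ↦ h (projIcc 0 1 zero_le_one s) :=
    h.continuous.comp continuous_projIcc
  have := (hc.integral_hasStrictDerivAt 0 t).hasDerivAt.hasDerivWithinAt (s := Icc 0 1)
  refine this.congr (fun s hs ↦ ?_) ?_
  · rw [primitive_apply, projIcc_of_mem _ hs]
  · rw [primitive_apply, projIcc_of_mem _ ht]

/-- The curve `t ↦ (t, γ t)`. -/
def graphCurve (γ : C(I, E)) : C(I, ℝ × E) := ⟨fun t ↦ ((t : ℝ), γ t), by fun_prop⟩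

theorem hasFDerivAt_graphCurve (γ : C(I, E)) :
    HasFDerivAt (graphCurve : C(I, E) → C(I, ℝ × E))
      ((ContinuousLinearMap.inr ℝ ℝ E).compLeftContinuous ℝ I) γ := by
  have : (graphCurve : C(I, E) → C(I, ℝ × E)) =
      fun γ ↦ (ContinuousLinearMap.inr ℝ ℝ E).compLeftContinuous ℝ I γ + graphCurve 0 := by
    ext γ t <;> simp [graphCurve]
  rw [this]
  exact (ContinuousLinearMap.hasFDerivAt _).add_const _

theorem contDiff_graphCurve : ContDiff ℝ ∞ (graphCurve : C(I, E) → C(I, ℝ × E)) := by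
  have : (graphCurve : C(I, E) → C(I, ℝ × E)) =
      fun γ ↦ (ContinuousLinearMap.inr ℝ ℝ E).compLeftContinuous ℝ I γ + graphCurve 0 := by
    ext γ t <;> simp [graphCurve]
  rw [this]
  exact (ContinuousLinearMap.contDiff _).add contDiff_const

/-- The linearisation of the Picard operator along a curve. -/
def picardDeriv {f : ℝ × E → E} (hf : ContDiff ℝ ∞ f) (γ : C(I, E)) : C(I, E) →L[ℝ] C(I, E) :=
  primitive E ∘L (ContinuousMap.pointwiseApply I (ℝ × E) E
    ((⟨fderiv ℝ f, hf.continuous_fderiv (by simp)⟩ : C(ℝ × E, ℝ × E →L[ℝ] E)).comp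
      (graphCurve γ))) ∘L (ContinuousLinearMap.inr ℝ ℝ E).compLeftContinuous ℝ I

/-- An integral curve from `x` solves `γ - ∫ f(s, γ(s)) ds = x` in the Banach space `C(I, E)`. The
left side is smooth in `γ`. Since `f` vanishes to first order along `y = 0`, its derivative at the
zero curve is the identity, so the inverse function theorem gives a solution depending smoothly on
`x`, valid at once on all of `[0, 1]`. Differentiating this equation in `x` gives the variational
equation. -/
theorem exists_smooth_flow [CompleteSpace E] {f : ℝ × E → E} (hf : ContDiff ℝ ∞ f)
    (hf0 : ∀ t, f (t, 0) = 0) (hf1 : ∀ t v, fderiv ℝ f (t, 0) (0, v) = 0) :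
    ∃ (U : Set E) (φ : ℝ → E → E), IsOpen U ∧ 0 ∈ U ∧ (∀ x ∈ U, φ 0 x = x) ∧
      (∀ x ∈ U, ∀ t ∈ Icc (0 : ℝ) 1,
        HasDerivWithinAt (fun s ↦ φ s x) (f (t, φ t x)) (Icc 0 1) t) ∧
      (∀ t, ContDiffOn ℝ ∞ (φ t) U) ∧
      (∀ x ∈ U, ∀ v, ∀ t ∈ Icc (0 : ℝ) 1,
        HasDerivWithinAt (fun s ↦ fderiv ℝ (φ s) x v)
          (fderiv ℝ f (t, φ t x) (0, fderiv ℝ (φ t) x v)) (Icc 0 1) t) ∧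
      (∀ t, HasFDerivAt (φ t) (ContinuousLinearMap.id ℝ E) 0) ∧ (∀ t, φ t 0 = 0) ∧
      ∀ N ∈ 𝓝 (0 : E), ∀ᶠ x in 𝓝 0, ∀ t, φ t x ∈ N := by
  set fC : C(ℝ × E, E) := ⟨f, hf.continuous⟩
  set Φ : C(I, E) → C(I, E) := fun γ ↦ γ - primitive E (fC.comp (graphCurve γ))
  have hΦ : ContDiff ℝ ∞ Φ := contDiff_id.sub ((primitive E).contDiff.comp
    ((contDiff_superposition fC hf).comp contDiff_graphCurve))
  have hΦd : ∀ γ, HasFDerivAt Φ (ContinuousLinearMap.id ℝ _ - picardDeriv hf γ) γ := by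
    intro γ
    refine (hasFDerivAt_id γ).sub ((primitive E).hasFDerivAt.comp γ ?_)
    exact (hasFDerivAt_superposition fC ⟨fderiv ℝ f, hf.continuous_fderiv (by simp)⟩
      (fun x ↦ ((hf.differentiable (by simp)) x).hasFDerivAt) (graphCurve γ)).comp γ
      (hasFDerivAt_graphCurve γ)
  have hgraph0 : fC.comp (graphCurve 0) = 0 := by ext t; simp [fC, graphCurve, hf0]
  have hΦ0 : Φ 0 = 0 := by simp [Φ, hgraph0]
  have hpic0 : picardDeriv hf 0 = 0 := by
    have : ∀ h : C(I, E), (ContinuousMap.pointwiseApply I (ℝ × E) E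
        ((⟨fderiv ℝ f, hf.continuous_fderiv (by simp)⟩ : C(ℝ × E, ℝ × E →L[ℝ] E)).comp
        (graphCurve 0))) ((ContinuousLinearMap.inr ℝ ℝ E).compLeftContinuous ℝ I h) = 0 := by
      intro h
      ext t
      simp [graphCurve, hf1]
    ext h : 1
    rw [picardDeriv, ContinuousLinearMap.comp_apply, ContinuousLinearMap.comp_apply, this]
    simp
  have hΦd0 : HasFDerivAt Φ
      ((ContinuousLinearEquiv.refl ℝ C(I, E) : C(I, E) ≃L[ℝ] C(I, E)) :
        C(I, E) →L[ℝ] C(I, E)) 0 := by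
    have := hΦd 0
    rw [hpic0, sub_zero] at this
    exact this
  obtain ⟨e, he, he0, -, heD, hes⟩ :=
    exists_openPartialHomeomorph_of_contDiffOn isOpen_univ hΦ.contDiffOn (mem_univ 0) _ hΦd0
  set cst : E →L[ℝ] C(I, E) := ContinuousLinearMap.const ℝ I
  set U : Set E := cst ⁻¹' e.target
  have hU : IsOpen U := e.open_target.preimage cst.continuous
  have he00 : e 0 = 0 := by rw [he, hΦ0]
  have h0t : (0 : C(I, E)) ∈ e.target := by simpa [he00] using e.map_source he0
  have h0U : (0 : E) ∈ U := by simpa [U] using h0t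
  set γ : E → C(I, E) := fun x ↦ e.symm (cst x)
  have hγ : ContDiffOn ℝ ∞ γ U := hes.comp cst.contDiff.contDiffOn (fun x hx ↦ hx)
  have hγ0 : γ 0 = 0 := by
    have := e.left_inv he0
    simpa [γ, he00] using this
  have hγe : ∀ x ∈ U, γ x = cst x + primitive E (fC.comp (graphCurve (γ x))) := by
    intro x hx
    have : Φ (γ x) = cst x := by rw [← he]; exact e.right_inv hx
    rw [← this]
    simp [Φ]
  have hγd : ∀ x ∈ U, DifferentiableAt ℝ γ x := fun x hx ↦
    (hγ.contDiffAt (hU.mem_nhds hx)).differentiableAt (by simp)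
  have hγD : ∀ x ∈ U, ∀ v, fderiv ℝ γ x v = cst v + picardDeriv hf (γ x) (fderiv ℝ γ x v) := by
    intro x hx v
    have h1 : HasFDerivAt (Φ ∘ γ)
        ((ContinuousLinearMap.id ℝ _ - picardDeriv hf (γ x)) ∘L fderiv ℝ γ x) x :=
      (hΦd (γ x)).comp x (hγd x hx).hasFDerivAt
    have h2 : HasFDerivAt (Φ ∘ γ) cst x := by
      refine cst.hasFDerivAt.congr_of_eventuallyEq ?_
      filter_upwards [hU.mem_nhds hx] with y hy
      rw [← he]
      exact e.right_inv hy
    have := congrArg (fun T ↦ T v) (h1.unique h2)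
    simp only [ContinuousLinearMap.comp_apply, _root_.sub_apply,
      ContinuousLinearMap.id_apply] at this
    rw [← this]
    abel
  -- Times outside `[0, 1]` are clamped, so the clauses quantified over every real `t` need no
  -- restriction.
  set p : ℝ → I := projIcc 0 1 zero_le_one
  have hp : ∀ t ∈ Icc (0 : ℝ) 1, ((p t : I) : ℝ) = t := fun t ht ↦ by
    simp [p, projIcc_of_mem _ ht]
  have hp0 : p 0 = 0 := by simp [p, projIcc_left]
  set φ : ℝ → E → E := fun t x ↦ γ x (p t)
  have hφD : ∀ t, ∀ x ∈ U, HasFDerivAt (φ t)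
      ((ContinuousMap.evalCLM ℝ (p t)) ∘L fderiv ℝ γ x) x := fun t x hx ↦
    (ContinuousMap.evalCLM ℝ (p t) : C(I, E) →L[ℝ] E).hasFDerivAt (x := γ x) |>.comp x
      (hγd x hx).hasFDerivAt
  have hφf : ∀ t, ∀ x ∈ U, ∀ v, fderiv ℝ (φ t) x v = fderiv ℝ γ x v (p t) := by
    intro t x hx v
    rw [(hφD t x hx).fderiv]
    rfl
  refine ⟨U, φ, hU, h0U, ?_, ?_, ?_, ?_, ?_, ?_, ?_⟩
  · intro x hx
    change γ x (p 0) = x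
    rw [hγe x hx, hp0]
    simp [primitive_apply_zero, cst]
  · intro x hx t ht
    have h := (hasDerivWithinAt_primitive (fC.comp (graphCurve (γ x))) ht).const_add x
    have h2 : fC.comp (graphCurve (γ x)) (projIcc 0 1 zero_le_one t) = f (t, φ t x) := by
      change f (((p t : I) : ℝ), γ x (p t)) = _
      rw [hp t ht]
    rw [h2] at h
    refine h.congr_of_mem (fun s hs ↦ ?_) ht
    change γ x (p s) = _
    conv_lhs => rw [hγe x hx]
    simp [cst, p]
  · intro t
    exact (ContinuousMap.evalCLM ℝ (p t)).contDiff.comp_contDiffOn hγ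
  · intro x hx v t ht
    have h := (hasDerivWithinAt_primitive (ContinuousMap.pointwiseApply I (ℝ × E) E
      ((⟨fderiv ℝ f, hf.continuous_fderiv (by simp)⟩ : C(ℝ × E, ℝ × E →L[ℝ] E)).comp
      (graphCurve (γ x))) ((ContinuousLinearMap.inr ℝ ℝ E).compLeftContinuous ℝ I
        (fderiv ℝ γ x v))) ht).const_add v
    refine (h.congr_of_mem (fun s hs ↦ ?_) ht).congr_deriv ?_
    · rw [hφf s x hx]
      conv_lhs => rw [hγD x hx]
      simp [cst, p, picardDeriv]
    · rw [hφf t x hx]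
      change fderiv ℝ f (((p t : I) : ℝ), γ x (p t)) (0, fderiv ℝ γ x v (p t)) = _
      rw [hp t ht]
  · intro t
    convert! hφD t 0 h0U using 1
    ext v
    simp only [ContinuousLinearMap.comp_apply]
    rw [hγD 0 h0U, hγ0, hpic0]
    simp [cst]
  · intro t
    simp [φ, hγ0]
  · intro N hN
    obtain ⟨ε, hε, hεN⟩ := Metric.mem_nhds_iff.1 hN
    have hc : ContinuousAt γ 0 := (hγd 0 h0U).continuousAt
    have := hc.preimage_mem_nhds (Metric.ball_mem_nhds (γ 0) hε)
    filter_upwards [this] with x hx t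
    apply hεN
    rw [mem_preimage, hγ0] at hx
    exact (ContinuousMap.dist_apply_le_dist (f := γ x) (g := 0) (p t)).trans_lt hx

end Flow

/-! ### The radial primitive of a two-form -/

section RadialPrimitive

universe u

open unitInterval

variable {E : Type u} [NormedAddCommGroup E] [NormedSpace ℝ E]

/-- The integrand of the radial primitive. -/
def radialIntegrand (β : E → E →L[ℝ] E →L[ℝ] ℝ) (p : ℝ × E) : E →L[ℝ] ℝ :=
  p.1 • β (p.1 • p.2) p.2

theorem contDiff_radialIntegrand {β : E → E →L[ℝ] E →L[ℝ] ℝ} (hβ : ContDiff ℝ ∞ β) :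
    ContDiff ℝ ∞ (radialIntegrand β) := by
  unfold radialIntegrand
  exact contDiff_fst.smul ((hβ.comp (contDiff_fst.smul contDiff_snd)).clm_apply contDiff_snd)

theorem fderiv_radialIntegrand {β : E → E →L[ℝ] E →L[ℝ] ℝ} (hβ : ContDiff ℝ ∞ β) (t : ℝ)
    (y u v : E) : fderiv ℝ (radialIntegrand β) (t, y) (0, u) v =
      t ^ 2 * fderiv ℝ β (t • y) u y v + t * β (t • y) u v := by
  have h1 : HasFDerivAt (fun z : E ↦ radialIntegrand β (t, z))
      ((fderiv ℝ (radialIntegrand β) (t, y)) ∘L ContinuousLinearMap.inr ℝ ℝ E) y := by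
    have hd : HasFDerivAt (radialIntegrand β) (fderiv ℝ (radialIntegrand β) (t, y)) (t, y) :=
      ((contDiff_radialIntegrand hβ).differentiable (by simp) _).hasFDerivAt
    exact hd.comp y (hasFDerivAt_prodMk_right t y)
  have hs : HasFDerivAt (fun z : E ↦ t • z) (t • ContinuousLinearMap.id ℝ E) y :=
    (hasFDerivAt_id y).const_smul t
  have hb : HasFDerivAt β (fderiv ℝ β (t • y)) (t • y) :=
    (hβ.differentiable (by simp) _).hasFDerivAt
  have hbs : HasFDerivAt (fun z : E ↦ β (t • z)) _ y := hb.comp y hs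
  have h2 : HasFDerivAt (fun z : E ↦ radialIntegrand β (t, z)) _ y :=
    (hbs.clm_apply (hasFDerivAt_id y)).const_smul t
  have := congrArg (fun T ↦ T u v) (h1.unique h2)
  simp only [ContinuousLinearMap.comp_apply, ContinuousLinearMap.inr_apply] at this
  rw [this]
  simp
  ring

/-- The one-form `∫ t β(ty)(y, ·) dt`. -/
def radialPrimitive {β : E → E →L[ℝ] E →L[ℝ] ℝ} (hβ : ContDiff ℝ ∞ β) (y : E) : E →L[ℝ] ℝ :=
  primitive (E →L[ℝ] ℝ)
    ((⟨radialIntegrand β, (contDiff_radialIntegrand hβ).continuous⟩ : C(ℝ × E, E →L[ℝ] ℝ)).comp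
      (graphCurve (ContinuousMap.const I y))) 1

variable {β : E → E →L[ℝ] E →L[ℝ] ℝ} (hβ : ContDiff ℝ ∞ β)

theorem contDiff_radialPrimitive : ContDiff ℝ ∞ (radialPrimitive hβ) := by
  have hg := contDiff_radialIntegrand hβ
  have h1 := contDiff_superposition (K := I)
    (⟨radialIntegrand β, hg.continuous⟩ : C(ℝ × E, E →L[ℝ] ℝ)) hg
  exact ((ContinuousMap.evalCLM ℝ (1 : I) : C(I, E →L[ℝ] ℝ) →L[ℝ] E →L[ℝ] ℝ) ∘L
    primitive (E →L[ℝ] ℝ)).contDiff.comp ((h1.comp contDiff_graphCurve).comp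
      (ContinuousLinearMap.const ℝ I : E →L[ℝ] C(I, E)).contDiff)

theorem primitive_apply_one_apply (h : C(I, E →L[ℝ] ℝ)) (v : E) (k : ℝ → ℝ)
    (hk : ∀ t : I, h t v = k t) : primitive (E →L[ℝ] ℝ) h 1 v = ∫ t in (0 : ℝ)..1, k t := by
  have hc : Continuous fun s ↦ h (projIcc 0 1 zero_le_one s) :=
    h.continuous.comp continuous_projIcc
  rw [primitive_apply, ContinuousLinearMap.intervalIntegral_apply (hc.intervalIntegrable _ _)]
  refine intervalIntegral.integral_congr fun s hs ↦ ?_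
  have hs' : s ∈ Icc (0 : ℝ) 1 := by rwa [uIcc_of_le (by simp)] at hs
  simp only [hk, projIcc_of_mem _ hs']

theorem radialPrimitive_apply (y v : E) :
    radialPrimitive hβ y v = ∫ t in (0 : ℝ)..1, t * β (t • y) y v :=
  primitive_apply_one_apply _ _ _ fun t ↦ by simp [graphCurve, radialIntegrand]

theorem fderiv_radialPrimitive (y u v : E) : fderiv ℝ (radialPrimitive hβ) y u v =
    ∫ t in (0 : ℝ)..1, (t ^ 2 * fderiv ℝ β (t • y) u y v + t * β (t • y) u v) := by
  have hg := contDiff_radialIntegrand hβ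
  have h1 := hasFDerivAt_superposition (K := I) ⟨radialIntegrand β, hg.continuous⟩
    ⟨fderiv ℝ (radialIntegrand β), hg.continuous_fderiv (by simp)⟩
    (fun x ↦ (hg.differentiable (by simp) x).hasFDerivAt)
  have hc : HasFDerivAt (fun z : E ↦ graphCurve (ContinuousMap.const I z)) _ y :=
    HasFDerivAt.comp (f := (ContinuousLinearMap.const ℝ I : E →L[ℝ] C(I, E)))
      (g := graphCurve) y (hasFDerivAt_graphCurve _) (ContinuousLinearMap.hasFDerivAt _)
  have h2 : HasFDerivAt (radialPrimitive hβ) _ y :=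
    (((ContinuousMap.evalCLM ℝ (1 : I) : C(I, E →L[ℝ] ℝ) →L[ℝ] E →L[ℝ] ℝ) ∘L
      primitive (E →L[ℝ] ℝ)).hasFDerivAt).comp y ((h1 _).comp y hc)
  rw [h2.fderiv]
  refine primitive_apply_one_apply _ _ _ fun t ↦ ?_
  rw [← fderiv_radialIntegrand hβ]
  rfl

theorem radialPrimitive_zero : radialPrimitive hβ 0 = 0 := by
  ext v
  simp [radialPrimitive_apply]

/-- This second-order vanishing is what gives Moser's field zero linear part at the origin, as
`exists_smooth_flow` demands. -/
theorem fderiv_radialPrimitive_zero (h0 : β 0 = 0) : fderiv ℝ (radialPrimitive hβ) 0 = 0 := by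
  ext u v
  rw [fderiv_radialPrimitive]
  simp [h0]

theorem radialPrimitive_eq_zero {W : Submodule ℝ E} (hW : ∀ y ∈ W, ∀ u ∈ W, ∀ v ∈ W, β y u v = 0)
    {y v : E} (hy : y ∈ W) (hv : v ∈ W) : radialPrimitive hβ y v = 0 := by
  rw [radialPrimitive_apply]
  simp [fun t : ℝ ↦ hW (t • y) (W.smul_mem t hy) y hy v hv]

/-- Poincaré lemma on a ball: closedness turns the antisymmetrized integrand into `d/dt (t² β(ty)(u,
v))`, whose integral over `[0, 1]` is `β(y)(u, v)`. Only points `ty` of the segment from `0` to `y`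
occur, and they stay in the ball. -/
theorem fderiv_radialPrimitive_sub {r : ℝ}
    (hclosed : ∀ y ∈ Metric.ball (0 : E) r, ∀ u v w,
      fderiv ℝ β y u v w - fderiv ℝ β y v u w + fderiv ℝ β y w u v = 0)
    (halt : ∀ y u v, β y u v = -β y v u) {y : E} (hy : y ∈ Metric.ball (0 : E) r) (u v : E) :
    fderiv ℝ (radialPrimitive hβ) y u v - fderiv ℝ (radialPrimitive hβ) y v u = β y u v := by
  have hdalt : ∀ y a u v, fderiv ℝ β y a u v = -fderiv ℝ β y a v u := by
    intro y a u v
    have h1 : HasDerivAt (fun s : ℝ ↦ y + s • a) a 0 := by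
      simpa using ((hasDerivAt_id (0 : ℝ)).smul_const a).const_add y
    have hb : HasFDerivAt β (fderiv ℝ β y) (y + (0 : ℝ) • a) := by
      simpa using (hβ.differentiable (by simp) y).hasFDerivAt
    have h2 : HasDerivAt (fun s : ℝ ↦ β (y + s • a)) (fderiv ℝ β y a) 0 :=
      hb.comp_hasDerivAt 0 h1
    have hd : ∀ u v, HasDerivAt (fun s : ℝ ↦ β (y + s • a) u v) (fderiv ℝ β y a u v) 0 :=
      fun u v ↦ by
        simpa using (h2.clm_apply (hasDerivAt_const 0 u)).clm_apply (hasDerivAt_const 0 v)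
    refine (hd u v).unique ?_
    exact (hd v u).neg.congr_of_eventuallyEq (Eventually.of_forall fun s ↦ halt (y + s • a) u v)
  have hcd : Continuous (fderiv ℝ β) := hβ.continuous_fderiv (by simp)
  have hcb : Continuous β := hβ.continuous
  have hderiv : ∀ t ∈ uIcc (0 : ℝ) 1, HasDerivAt (fun s ↦ s ^ 2 * β (s • y) u v)
      (t ^ 2 * fderiv ℝ β (t • y) y u v + 2 * t * β (t • y) u v) t := by
    intro t _
    have h1 : HasDerivAt (fun s : ℝ ↦ s • y) y t := by
      simpa using (hasDerivAt_id t).smul_const y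
    have h2 : HasDerivAt (fun s : ℝ ↦ β (s • y)) (fderiv ℝ β (t • y) y) t :=
      HasFDerivAt.comp_hasDerivAt t (hβ.differentiable (by simp) (t • y)).hasFDerivAt h1
    have h3 : HasDerivAt (fun s : ℝ ↦ β (s • y) u v) (fderiv ℝ β (t • y) y u v) t := by
      simpa using (h2.clm_apply (hasDerivAt_const t u)).clm_apply (hasDerivAt_const t v)
    convert! (hasDerivAt_pow 2 t).mul h3 using 1
    simp
    ring
  rw [fderiv_radialPrimitive, fderiv_radialPrimitive, ← intervalIntegral.integral_sub
    (Continuous.intervalIntegrable (by fun_prop) _ _)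
    (Continuous.intervalIntegrable (by fun_prop) _ _)]
  have hint : ∫ t in (0 : ℝ)..1,
      (t ^ 2 * fderiv ℝ β (t • y) y u v + 2 * t * β (t • y) u v) = _ := intervalIntegral.integral_eq_sub_of_hasDerivAt hderiv
    (Continuous.intervalIntegrable (by fun_prop) _ _)
  have heq : (1 : ℝ) ^ 2 * β ((1 : ℝ) • y) u v - 0 ^ 2 * β ((0 : ℝ) • y) u v = β y u v := by simp
  rw [heq] at hint
  rw [← hint]
  refine intervalIntegral.integral_congr fun t ht ↦ ?_
  rw [uIcc_of_le (by simp)] at ht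
  have hty : t • y ∈ Metric.ball (0 : E) r := by
    rw [mem_ball_zero_iff] at hy ⊢
    rw [norm_smul, Real.norm_of_nonneg ht.1]
    exact (mul_le_of_le_one_left (norm_nonneg _) ht.2).trans_lt hy
  have h1 := hclosed _ hty u y v
  have h2 := hdalt (t • y) v u y
  have h3 := halt (t • y) v u
  linear_combination t ^ 2 * h1 - t ^ 2 * h2 - t * h3

end RadialPrimitive

/-! ### Lagrangian subspaces -/

/-- An isotropic `W` lies in its orthogonal, and half dimension forces equality. -/
theorem mem_of_isotropic_of_half_dim {E : Type*} [NormedAddCommGroup E] [NormedSpace ℝ E]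
    [FiniteDimensional ℝ E] {B : E →L[ℝ] E →L[ℝ] ℝ} (hB : B.IsInvertible)
    (halt : ∀ u v, B u v = -B v u) {W : Submodule ℝ E}
    (hdim : 2 * Module.finrank ℝ W = Module.finrank ℝ E)
    (hW : ∀ u ∈ W, ∀ v ∈ W, B u v = 0) {z : E} (hz : ∀ w ∈ W, B z w = 0) : z ∈ W := by
  set b : LinearMap.BilinForm ℝ E :=
    (ContinuousLinearMap.coeLM ℝ : (E →L[ℝ] ℝ) →ₗ[ℝ] E →ₗ[ℝ] ℝ) ∘ₗ B.toLinearMap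
  have hb : ∀ u v, b u v = B u v := fun _ _ ↦ rfl
  have hinj : ∀ u, (∀ v, B u v = 0) → u = 0 := by
    intro u hu
    obtain ⟨A, hA⟩ := hB
    apply A.injective
    rw [map_zero]
    ext v
    have := hu v
    rw [← hA] at this
    simpa using this
  have hnd : b.Nondegenerate := by
    refine ⟨fun u hu ↦ hinj u hu, fun u hu ↦ hinj u fun v ↦ ?_⟩
    rw [halt, ← hb, hu, neg_zero]
  have h1 := LinearMap.BilinForm.finrank_orthogonal hnd W
  have hle : W ≤ b.orthogonal W := fun u hu v hv ↦ hW v hv u hu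
  have heq : W = b.orthogonal W := Submodule.eq_of_le_of_finrank_eq hle (by omega)
  rw [heq]
  intro w hw
  change B w z = 0
  rw [halt, hz w hw, neg_zero]

/-- Grönwall's inequality forwards in time, then applied to the reversed curve `t ↦ w (1 - t)`. -/
theorem eq_zero_iff_of_norm_deriv_le {E : Type*} [NormedAddCommGroup E] [NormedSpace ℝ E]
    {w w' : ℝ → E} {K : ℝ} (hw : ∀ t ∈ Icc (0 : ℝ) 1, HasDerivWithinAt w (w' t) (Icc 0 1) t)
    (hK : ∀ t ∈ Icc (0 : ℝ) 1, ‖w' t‖ ≤ K * ‖w t‖) : w 1 = 0 ↔ w 0 = 0 := by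
  have key : ∀ w w' : ℝ → E, (∀ t ∈ Icc (0 : ℝ) 1, HasDerivWithinAt w (w' t) (Icc 0 1) t) →
      (∀ t ∈ Icc (0 : ℝ) 1, ‖w' t‖ ≤ K * ‖w t‖) → w 0 = 0 → w 1 = 0 := by
    intro w w' hw hK h0
    refine eq_zero_of_abs_deriv_le_mul_abs_self_of_eq_zero_right
      (fun t ht ↦ (hw t ht).continuousWithinAt) (fun t ht ↦ ?_) h0
      (fun t ht ↦ hK t (Ico_subset_Icc_self ht)) 1 (by simp)
    exact (hw t (Ico_subset_Icc_self ht)).mono_of_mem_nhdsWithin (Icc_mem_nhdsGE_of_mem ht)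
  refine ⟨fun h ↦ ?_, key w w' hw hK⟩
  have hmaps : MapsTo (fun s : ℝ ↦ 1 - s) (Icc 0 1) (Icc 0 1) := fun s hs ↦
    ⟨by linarith [hs.2], by linarith [hs.1]⟩
  have := key (fun t ↦ w (1 - t)) (fun t ↦ -w' (1 - t)) (fun t ht ↦ ?_) (fun t ht ↦ ?_) (by simpa)
  · simpa using this
  · have h1 : HasDerivWithinAt (fun s : ℝ ↦ 1 - s) (-1) (Icc 0 1) t :=
      ((hasDerivAt_id t).const_sub 1).hasDerivWithinAt
    have h2 : HasDerivWithinAt (fun s ↦ w (1 - s)) ((-1 : ℝ) • w' (1 - t)) (Icc 0 1) t :=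
      (hw (1 - t) (hmaps ht)).scomp t h1 hmaps
    simpa using h2
  · simpa using hK (1 - t) (hmaps ht)

/-! ### Moser's argument -/

theorem hasDerivAt_comp_line {E F : Type*} [NormedAddCommGroup E] [NormedSpace ℝ E]
    [NormedAddCommGroup F] [NormedSpace ℝ F] {g : E → F} {x : E} (hg : DifferentiableAt ℝ g x)
    (v : E) : HasDerivAt (fun r : ℝ ↦ g (x + r • v)) (fderiv ℝ g x v) 0 :=
  hg.hasFDerivAt.hasLineDerivAt v

theorem DifferentiableAt.hasDerivWithinAt_comp {E F : Type*} [NormedAddCommGroup E]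
    [NormedSpace ℝ E] [NormedAddCommGroup F] [NormedSpace ℝ F] {g : E → F} {c : ℝ → E} {c' : E}
    {s : Set ℝ} {t : ℝ} (hg : DifferentiableAt ℝ g (c t)) (hc : HasDerivWithinAt c c' s t) :
    HasDerivWithinAt (fun r ↦ g (c r)) (fderiv ℝ g (c t) c') s t :=
  hg.hasFDerivAt.comp_hasDerivWithinAt t hc

section Moser

universe u

variable {E : Type u} [NormedAddCommGroup E] [NormedSpace ℝ E]

/-- The path of two-forms joining the constant form `η 0` to `η`. -/
def moserForm (η : E → E →L[ℝ] E →L[ℝ] ℝ) (p : ℝ × E) : E →L[ℝ] E →L[ℝ] ℝ :=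
  η 0 + Real.smoothTransition p.1 • (η p.2 - η 0)

theorem contDiff_moserForm {η : E → E →L[ℝ] E →L[ℝ] ℝ} (hη : ContDiff ℝ ∞ η) :
    ContDiff ℝ ∞ (moserForm η) :=
  contDiff_const.add ((Real.smoothTransition.contDiff.comp contDiff_fst).smul
    ((hη.comp contDiff_snd).sub contDiff_const))

theorem fderiv_moserForm {η : E → E →L[ℝ] E →L[ℝ] ℝ} (hη : ContDiff ℝ ∞ η) (t s : ℝ) (y u : E) :
    fderiv ℝ (moserForm η) (t, y) (s, u) =
      (s * deriv Real.smoothTransition t) • (η y - η 0) +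
        Real.smoothTransition t • fderiv ℝ η y u := by
  have hτ : HasDerivAt Real.smoothTransition (deriv Real.smoothTransition t) t :=
    ((Real.smoothTransition.contDiff (n := 1)).differentiable (by simp) t).hasDerivAt
  have h1 : HasDerivAt (fun r : ℝ ↦ moserForm η ((t, y) + r • ((s, u) : ℝ × E)))
      (fderiv ℝ (moserForm η) (t, y) (s, u)) 0 :=
    hasDerivAt_comp_line ((contDiff_moserForm hη).differentiable (by simp) _) _
  have hts : HasDerivAt (fun r : ℝ ↦ t + r * s) s 0 := by
    simpa using ((hasDerivAt_id (0 : ℝ)).mul_const s).const_add t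
  have hτ' : HasDerivAt (fun r : ℝ ↦ Real.smoothTransition (t + r * s))
      (deriv Real.smoothTransition t * s) 0 :=
    HasDerivAt.comp (h₂ := Real.smoothTransition) (h := fun r : ℝ ↦ t + r * s) 0
      (by simpa using hτ) hts
  have hηd : HasDerivAt (fun r : ℝ ↦ η (y + r • u)) (fderiv ℝ η y u) 0 :=
    hasDerivAt_comp_line (hη.differentiable (by simp) y) u
  have h2 : HasDerivAt (fun r : ℝ ↦ moserForm η ((t, y) + r • ((s, u) : ℝ × E))) _ 0 :=
    (hτ'.smul (hηd.sub_const (η 0))).const_add (η 0)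
  rw [h1.unique h2]
  simp
  rw [add_comm, mul_comm s]

variable {η : E → E →L[ℝ] E →L[ℝ] ℝ} (hη : ContDiff ℝ ∞ η)

/-- The primitive of `η - η 0` used in Moser's argument. -/
def moserPrimitive : E → E →L[ℝ] ℝ := radialPrimitive (hη.sub (contDiff_const (c := η 0)))

/-- Moser's time-dependent vector field. -/
def moserField (p : ℝ × E) : E :=
  -(deriv Real.smoothTransition p.1) • (moserForm η p).inverse (moserPrimitive hη p.2)

theorem contDiff_moserField
    (hinv : ∀ p, (moserForm η p).IsInvertible) [CompleteSpace E] : ContDiff ℝ ∞ (moserField hη) := by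
  have hτ : ContDiff ℝ ∞ (deriv Real.smoothTransition) :=
    (contDiff_infty_iff_deriv.1 Real.smoothTransition.contDiff).2
  refine (hτ.comp contDiff_fst).neg.smul (ContDiff.clm_apply ?_ ?_)
  · refine contDiff_iff_contDiffAt.2 fun p ↦ ?_
    exact ContDiffAt.comp p (hinv p).contDiffAt_map_inverse (contDiff_moserForm hη).contDiffAt
  · exact (contDiff_radialPrimitive _).comp contDiff_snd

theorem moserForm_moserField
    (hinv : ∀ p, (moserForm η p).IsInvertible) (p : ℝ × E) :
    moserForm η p (moserField hη p) =
      -(deriv Real.smoothTransition p.1) • moserPrimitive hη p.2 := by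
  rw [moserField, map_smul, (hinv p).self_apply_inverse]

/-- Obtained by differentiating the identity `ω_t(X_t, ·) = -τ' α` in the space variable, which
avoids differentiating the inverse that defines the field. -/
theorem fderiv_moserForm_moserField
    (hinv : ∀ p, (moserForm η p).IsInvertible) [CompleteSpace E] (t : ℝ) (y a : E) :
    fderiv ℝ (moserForm η) (t, y) (0, a) (moserField hη (t, y)) +
      moserForm η (t, y) (fderiv ℝ (moserField hη) (t, y) (0, a)) =
      -(deriv Real.smoothTransition t) • fderiv ℝ (moserPrimitive hη) y a := by
  have h1 : HasDerivAt (fun r : ℝ ↦ moserForm η ((t, y) + r • ((0, a) : ℝ × E))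
      (moserField hη ((t, y) + r • ((0, a) : ℝ × E)))) _ 0 :=
    (hasDerivAt_comp_line ((contDiff_moserForm hη).differentiable (by simp) (t, y))
      (0, a)).clm_apply
    (hasDerivAt_comp_line ((contDiff_moserField hη hinv).differentiable (by simp) (t, y)) (0, a))
  have h2 : HasDerivAt (fun r : ℝ ↦ -(deriv Real.smoothTransition t) •
      moserPrimitive hη (y + r • a)) _ 0 :=
    (hasDerivAt_comp_line (g := moserPrimitive hη) ((contDiff_radialPrimitive
      (hη.sub contDiff_const)).differentiable (by simp) y) a).const_smul
        (-(deriv Real.smoothTransition t))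
  have h3 := h1.unique (h2.congr_of_eventuallyEq (Eventually.of_forall fun r ↦ by
    simp only [moserForm_moserField hη hinv]
    simp))
  simpa using h3

theorem moserField_zero (t : ℝ) : moserField hη (t, 0) = 0 := by
  simp [moserField, moserPrimitive, radialPrimitive_zero]

/-- In the differentiated identity at `y = 0`, the field and the derivative of the primitive both
vanish; invertibility of `ω_t` then kills the remaining factor. -/
theorem fderiv_moserField_zero
    (hinv : ∀ p, (moserForm η p).IsInvertible) [CompleteSpace E] (t : ℝ) (v : E) :
    fderiv ℝ (moserField hη) (t, 0) (0, v) = 0 := by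
  have h := fderiv_moserForm_moserField hη hinv t 0 v
  rw [moserField_zero hη, map_zero, zero_add, moserPrimitive,
    fderiv_radialPrimitive_zero _ (sub_self _)] at h
  obtain ⟨A, hA⟩ := hinv (t, 0)
  apply A.injective
  rw [map_zero]
  simpa [← hA] using h

theorem moserForm_alt (halt : ∀ y u v, η y u v = -η y v u)
    (p : ℝ × E) (u v : E) : moserForm η p u v = -moserForm η p v u := by
  simp only [moserForm, _root_.add_apply, _root_.smul_apply, _root_.sub_apply, smul_eq_mul]
  rw [halt 0 u v, halt p.2 u v]
  ring

/-- The Lie derivative of the path of forms along Moser's vector field compensates the time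
derivative. -/
theorem moser_lieDeriv_eq_zero
    (hinv : ∀ p, (moserForm η p).IsInvertible)
    (halt : ∀ y u v, η y u v = -η y v u) [CompleteSpace E] {r : ℝ}
    (hclosed : ∀ y ∈ Metric.ball (0 : E) r, ∀ u v w,
      fderiv ℝ η y u v w - fderiv ℝ η y v u w + fderiv ℝ η y w u v = 0)
    {y : E} (hy : y ∈ Metric.ball (0 : E) r) (t : ℝ) (a b : E) :
    fderiv ℝ (moserForm η) (t, y) (1, moserField hη (t, y)) a b +
      moserForm η (t, y) (fderiv ℝ (moserField hη) (t, y) (0, a)) b +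
      moserForm η (t, y) a (fderiv ℝ (moserField hη) (t, y) (0, b)) = 0 := by
  have hfd : ∀ y, fderiv ℝ (fun y ↦ η y - η 0) y = fderiv ℝ η y := fun y ↦ by
    rw [fderiv_sub_const]
  have hα : fderiv ℝ (moserPrimitive hη) y a b - fderiv ℝ (moserPrimitive hη) y b a =
      (η y - η 0) a b := by
    refine fderiv_radialPrimitive_sub (hη.sub contDiff_const) (r := r) (fun y hy u v w ↦ ?_)
      (fun y u v ↦ ?_) hy a b
    · rw [hfd]
      exact hclosed y hy u v w
    · simp only [_root_.sub_apply]
      rw [halt y u v, halt 0 u v]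
      ring
  -- Cartan's formula by hand: closedness trades the derivative of the form along the field for
  -- derivatives in the directions `a` and `b`. The identities `h1`, `h2` reduce these to `-τ' dα`,
  -- and `dα = η - η 0` cancels the time derivative.
  have h1 := congrArg (fun T ↦ T b) (fderiv_moserForm_moserField hη hinv t y a)
  have h2 := congrArg (fun T ↦ T a) (fderiv_moserForm_moserField hη hinv t y b)
  have h3 := hclosed y hy (moserField hη (t, y)) a b
  rw [moserForm_alt halt (t, y) a]
  simp only [fderiv_moserForm hη, _root_.add_apply, _root_.smul_apply, smul_eq_mul, zero_mul,
    zero_smul, zero_add, one_mul] at h1 h2 ⊢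
  linear_combination Real.smoothTransition t * h3 + h1 - h2 -
    deriv Real.smoothTransition t * hα

/-- The primitive vanishes on `W` at points of `W`, so the field is `ω_t`-orthogonal to `W`. As `W`
is Lagrangian for every `ω_t`, the field lies in `W`. -/
theorem moserField_mem
    (hinv : ∀ p, (moserForm η p).IsInvertible)
    (halt : ∀ y u v, η y u v = -η y v u) [FiniteDimensional ℝ E] {W : Submodule ℝ E}
    (hdim : 2 * Module.finrank ℝ W = Module.finrank ℝ E)
    (hW : ∀ y ∈ W, ∀ u ∈ W, ∀ v ∈ W, η y u v = 0) (t : ℝ) {y : E} (hy : y ∈ W) :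
    moserField hη (t, y) ∈ W := by
  refine mem_of_isotropic_of_half_dim (hinv (t, y)) (moserForm_alt halt _) hdim
    (fun u hu v hv ↦ ?_) (fun w hw ↦ ?_)
  · simp [moserForm, hW 0 W.zero_mem u hu v hv, hW y hy u hu v hv]
  · rw [moserForm_moserField hη hinv]
    have := radialPrimitive_eq_zero (hη.sub (contDiff_const (c := η 0))) (W := W)
      (fun y hy u hu v hv ↦ by simp [hW 0 W.zero_mem u hu v hv, hW y hy u hu v hv]) hy hw
    simp [moserPrimitive, this]

end Moser

/-- A curve following a vector field tangent to a subspace lies in this subspace at time one iff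
it does at time zero. -/
theorem mem_submodule_iff_of_hasDerivWithinAt {E : Type*} [NormedAddCommGroup E] [NormedSpace ℝ E]
    [FiniteDimensional ℝ E] {f : ℝ × E → E} (hf : ContDiff ℝ ∞ f) {W : Submodule ℝ E}
    (hW : ∀ t, ∀ y ∈ W, f (t, y) ∈ W) {γ : ℝ → E}
    (hγ : ∀ t ∈ Icc (0 : ℝ) 1, HasDerivWithinAt γ (f (t, γ t)) (Icc 0 1) t) :
    γ 1 ∈ W ↔ γ 0 ∈ W := by
  obtain ⟨W', hWW'⟩ := W.exists_isCompl
  -- `π` is the projection onto a complement with kernel `W`, so the aim is to show that `π ∘ γ`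
  -- vanishes at time one iff it does at time zero.
  set π : E →L[ℝ] E := LinearMap.toContinuousLinearMap
    (W'.subtype ∘ₗ W'.projectionOnto W hWW'.symm)
  have hπ : ∀ x, π x = 0 ↔ x ∈ W := fun x ↦ by
    simp [π]
  have hsub : ∀ x, x - π x ∈ W := fun x ↦ by
    rw [← hπ, map_sub, sub_eq_zero]
    simp only [π, LinearMap.coe_toContinuousLinearMap', LinearMap.comp_apply, Submodule.subtype_apply]
    rw [Submodule.projectionOnto_apply_left]
  have hγc : ContinuousOn γ (Icc 0 1) := fun t ht ↦ (hγ t ht).continuousWithinAt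
  obtain ⟨R, hR⟩ := (isCompact_Icc.image_of_continuousOn hγc).isBounded.exists_norm_le
  -- This radius contains both `γ t` and its component `γ t - π (γ t)` in `W`, so a bound on the
  -- derivative over the convex compact set gives a Lipschitz estimate between them.
  set R' := R + ‖π‖ * R
  have hcompact : IsCompact (Icc (0 : ℝ) 1 ×ˢ Metric.closedBall (0 : E) R') :=
    isCompact_Icc.prod (isCompact_closedBall 0 R')
  obtain ⟨K, hK⟩ := hcompact.exists_bound_of_continuousOn
    (hf.continuous_fderiv (by simp)).continuousOn
  have hlip : ∀ t ∈ Icc (0 : ℝ) 1, ‖f (t, γ t) - f (t, γ t - π (γ t))‖ ≤ K * ‖π (γ t)‖ := by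
    intro t ht
    have hγR : ‖γ t‖ ≤ R := hR _ (mem_image_of_mem _ ht)
    have hR0 : 0 ≤ R := (norm_nonneg _).trans hγR
    have hπR : ‖π (γ t)‖ ≤ ‖π‖ * R := π.le_opNorm_of_le hγR
    have h1 : ((t, γ t) : ℝ × E) ∈ Icc (0 : ℝ) 1 ×ˢ Metric.closedBall (0 : E) R' := by
      refine ⟨ht, ?_⟩
      rw [mem_closedBall_zero_iff]
      exact hγR.trans (le_add_of_nonneg_right (by positivity))
    have h2 : ((t, γ t - π (γ t)) : ℝ × E) ∈ Icc (0 : ℝ) 1 ×ˢ Metric.closedBall (0 : E) R' := by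
      refine ⟨ht, ?_⟩
      rw [mem_closedBall_zero_iff]
      exact (norm_sub_le _ _).trans (add_le_add hγR hπR)
    have := ((convex_Icc (0 : ℝ) 1).prod (convex_closedBall (0 : E) R')).norm_image_sub_le_of_norm_fderiv_le
      (𝕜 := ℝ) (f := f) (fun x _ ↦ hf.differentiable (by simp) x) hK h2 h1
    refine this.trans (le_of_eq ?_)
    congr 1
    simp [Prod.norm_def]
  have hw : ∀ t ∈ Icc (0 : ℝ) 1, HasDerivWithinAt (fun s ↦ π (γ s)) (π (f (t, γ t))) (Icc 0 1) t :=
    fun t ht ↦ π.hasFDerivAt.comp_hasDerivWithinAt t (hγ t ht)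
  have hbound : ∀ t ∈ Icc (0 : ℝ) 1, ‖π (f (t, γ t))‖ ≤ (‖π‖ * K) * ‖π (γ t)‖ := by
    intro t ht
    -- Tangency to `W` at the component in `W` makes `π f` of order `π γ`, which is the input of
    -- Grönwall's inequality.
    have h0 : π (f (t, γ t - π (γ t))) = 0 := (hπ _).2 (hW t _ (hsub _))
    have : π (f (t, γ t)) = π (f (t, γ t) - f (t, γ t - π (γ t))) := by rw [map_sub, h0, sub_zero]
    rw [this, mul_assoc]
    exact π.le_opNorm_of_le (hlip t ht)
  rw [← hπ, ← hπ]
  exact eq_zero_iff_of_norm_deriv_le hw hbound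

/-- The relative Darboux theorem: around a point, a symplectic form is the pullback of a constant
form by a local diffeomorphism preserving the given Lagrangian subspaces. -/
theorem exists_moser_chart {E : Type*} [NormedAddCommGroup E] [NormedSpace ℝ E]
    [FiniteDimensional ℝ E] {η : E → E →L[ℝ] E →L[ℝ] ℝ} (hη : ContDiff ℝ ∞ η)
    (halt : ∀ y u v, η y u v = -η y v u) (hinv : ∀ p, (moserForm η p).IsInvertible) {r : ℝ}
    (hr : 0 < r) (hclosed : ∀ y ∈ Metric.ball (0 : E) r, ∀ u v w,
      fderiv ℝ η y u v w - fderiv ℝ η y v u w + fderiv ℝ η y w u v = 0) :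
    ∃ e : OpenPartialHomeomorph E E, 0 ∈ e.source ∧ e 0 = 0 ∧ e.target ⊆ Metric.ball 0 r ∧
      ContDiffOn ℝ ∞ e e.source ∧ ContDiffOn ℝ ∞ e.symm e.target ∧
      (∀ x ∈ e.source, ∀ u v, η (e x) (fderiv ℝ e x u) (fderiv ℝ e x v) = η 0 u v) ∧
      ∀ W : Submodule ℝ E, 2 * Module.finrank ℝ W = Module.finrank ℝ E →
        (∀ y ∈ W, ∀ u ∈ W, ∀ v ∈ W, η y u v = 0) → ∀ x ∈ e.source, (e x ∈ W ↔ x ∈ W) := by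
  have := FiniteDimensional.complete ℝ E
  have hf := contDiff_moserField hη hinv
  obtain ⟨U, φ, hU, h0U, hφ0, hφt, hφs, hφd, hφid, hφz, hφN⟩ :=
    exists_smooth_flow hf (moserField_zero hη) (fderiv_moserField_zero hη hinv)
  -- Trajectories starting in `N` stay in the ball where the form is closed, for all times.
  obtain ⟨N, hN, hNo, h0N⟩ := eventually_nhds_iff.1 (hφN _ (Metric.ball_mem_nhds 0 hr))
  obtain ⟨e, he, h0e, heU, -, hes⟩ := exists_openPartialHomeomorph_of_contDiffOn
    (hU.inter hNo) ((hφs 1).mono inter_subset_left) ⟨h0U, h0N⟩ (ContinuousLinearEquiv.refl ℝ E)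
    (hφid 1)
  refine ⟨e, h0e, by rw [he, hφz], ?_, ?_, hes, ?_, ?_⟩
  · intro y hy
    have := hN _ (heU (e.map_target hy)).2 1
    rwa [← he, e.right_inv hy] at this
  · rw [he]
    exact (hφs 1).mono fun x hx ↦ (heU hx).1
  · intro x hx u v
    obtain ⟨hxU, hxN⟩ := heU hx
    rw [he]
    -- The pullback of `ω_t` under the time-`t` flow is constant in `t`; at `t = 0` it is `η 0`, at
    -- `t = 1` the pullback of `η`.
    set h : ℝ → ℝ := fun t ↦ moserForm η (t, φ t x) (fderiv ℝ (φ t) x u) (fderiv ℝ (φ t) x v)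
    have hh : ∀ t ∈ Icc (0 : ℝ) 1, HasDerivWithinAt h 0 (Icc 0 1) t := by
      intro t ht
      have hc : HasDerivWithinAt (fun s ↦ (s, φ s x)) (1, moserField hη (t, φ t x)) (Icc 0 1) t :=
        (hasDerivWithinAt_id t _).prodMk (hφt x hxU t ht)
      have hM : HasDerivWithinAt (fun s ↦ moserForm η (s, φ s x)) _ (Icc 0 1) t :=
        DifferentiableAt.hasDerivWithinAt_comp (g := moserForm η) (c := fun s ↦ (s, φ s x))
          ((contDiff_moserForm hη).differentiable (by simp) _) hc
      refine ((hM.clm_apply (hφd x hxU u t ht)).clm_apply (hφd x hxU v t ht)).congr_deriv ?_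
      exact moser_lieDeriv_eq_zero hη hinv halt hclosed (hN x hxN t) t _ _
    have hconst := constant_of_derivWithin_zero (f := h) (a := 0) (b := 1)
      (fun t ht ↦ (hh t ht).differentiableWithinAt)
      (fun t ht ↦ (hh t (Ico_subset_Icc_self ht)).derivWithin
        (uniqueDiffOn_Icc zero_lt_one t (Ico_subset_Icc_self ht))) 1 (by simp)
    have hD0 : fderiv ℝ (φ 0) x = ContinuousLinearMap.id ℝ E := by
      have : φ 0 =ᶠ[𝓝 x] id := by
        filter_upwards [hU.mem_nhds hxU] with y hy using hφ0 y hy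
      rw [this.fderiv_eq, fderiv_id]
    simpa [h, moserForm, hD0] using hconst
  · intro W hdim hW x hx
    rw [he]
    have := mem_submodule_iff_of_hasDerivWithinAt hf (W := W)
      (fun t y hy ↦ moserField_mem hη hinv halt hdim hW t hy) (hφt x (heU hx).1)
    rwa [hφ0 x (heU hx).1] at this

/-! ### The relative Darboux theorem in a vector space -/

/-- A local symplectic form extends, after shrinking, to a global two-form for which the linear
path to its value at the origin is nondegenerate. -/
theorem exists_global_form {E : Type*} [NormedAddCommGroup E] [NormedSpace ℝ E]
    [FiniteDimensional ℝ E] {U : Set E} (hU : IsOpen U) (h0 : 0 ∈ U)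
    {η : E → E →L[ℝ] E →L[ℝ] ℝ} (hη : ContDiffOn ℝ ∞ η U)
    (halt : ∀ y ∈ U, ∀ u v, η y u v = -η y v u) (hinv : (η 0).IsInvertible) :
    ∃ (θ : E → E →L[ℝ] E →L[ℝ] ℝ) (r : ℝ), 0 < r ∧ Metric.ball 0 r ⊆ U ∧ ContDiff ℝ ∞ θ ∧
      (∀ y u v, θ y u v = -θ y v u) ∧ (∀ p, (moserForm θ p).IsInvertible) ∧
      (∀ y ∈ Metric.ball 0 r, θ y = η y) ∧
      ∀ W : Submodule ℝ E, (∀ y ∈ W, y ∈ U → ∀ u ∈ W, ∀ v ∈ W, η y u v = 0) →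
        ∀ y ∈ W, ∀ u ∈ W, ∀ v ∈ W, θ y u v = 0 := by
  have := FiniteDimensional.complete ℝ E
  obtain ⟨A, hA⟩ := hinv
  have hopen : {B : E →L[ℝ] E →L[ℝ] ℝ | B.IsInvertible} ∈ 𝓝 (η 0) := by
    rw [← hA]
    exact A.nhds
  obtain ⟨ε, hε, hball⟩ := Metric.mem_nhds_iff.1 hopen
  have hV : η ⁻¹' Metric.ball (η 0) ε ∈ 𝓝 0 :=
    (hη.continuousOn.continuousAt (hU.mem_nhds h0)).preimage_mem_nhds (Metric.ball_mem_nhds _ hε)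
  obtain ⟨R, hR, hRV⟩ := Metric.mem_nhds_iff.1 (inter_mem hV (hU.mem_nhds h0))
  -- The bump equals one on the ball of radius `R / 4` and vanishes beyond `R / 2`, strictly inside
  -- the ball of radius `R` where `η` is defined and close to `η 0`.
  set χ : ContDiffBump (0 : E) := ⟨R / 4, R / 2, by linarith, by linarith⟩
  have hχsub : Metric.closedBall (0 : E) (R / 2) ⊆ Metric.ball 0 R :=
    Metric.closedBall_subset_ball (by linarith)
  have hχ0 : ∀ y, y ∉ Metric.ball (0 : E) R → χ y = 0 := by
    intro y hy
    apply χ.zero_of_le_dist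
    rw [Metric.mem_ball, not_lt] at hy
    exact le_trans (show R / 2 ≤ R by linarith) hy
  set θ : E → E →L[ℝ] E →L[ℝ] ℝ := fun y ↦ η 0 + χ y • (η y - η 0)
  have hθ0 : θ 0 = η 0 := by simp [θ]
  refine ⟨θ, R / 4, by linarith, ?_, ?_, ?_, ?_, ?_, ?_⟩
  · exact fun y hy ↦ (hRV (Metric.ball_subset_ball (by linarith) hy)).2
  · refine contDiff_iff_contDiffAt.2 fun y ↦ ?_
    by_cases hy : y ∈ Metric.ball (0 : E) R
    · exact contDiffAt_const.add (χ.contDiff.contDiffAt.smul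
        ((hη.contDiffAt (hU.mem_nhds (hRV hy).2)).sub contDiffAt_const))
    · have hy' : y ∈ (Metric.closedBall (0 : E) (R / 2))ᶜ := fun h ↦ hy (hχsub h)
      refine (contDiffAt_const (c := η 0)).congr_of_eventuallyEq ?_
      filter_upwards [Metric.isClosed_closedBall.isOpen_compl.mem_nhds hy'] with z hz
      have : χ z = 0 := χ.zero_of_le_dist (by
        rw [mem_compl_iff, Metric.mem_closedBall, not_le] at hz
        exact hz.le)
      simp [θ, this]
  · intro y u v
    by_cases hy : y ∈ Metric.ball (0 : E) R
    · simp only [θ, _root_.add_apply, _root_.smul_apply, _root_.sub_apply, smul_eq_mul]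
      rw [halt y (hRV hy).2 u v, halt 0 h0 u v]
      ring
    · simp [θ, hχ0 y hy, halt 0 h0 u v]
  · rintro ⟨t, y⟩
    apply hball
    rw [mem_ball_iff_norm]
    by_cases hy : y ∈ Metric.ball (0 : E) R
    · have h1 : ‖η y - η 0‖ < ε := by
        rw [← mem_ball_iff_norm]
        exact (hRV hy).1
      -- `Real.smoothTransition` and the bump both take values in `[0, 1]`, so for every real `t`
      -- the path stays on the segment from `η 0` to `η y`, inside a ball of invertible forms.
      have h2 : moserForm θ (t, y) - η 0 =
          (Real.smoothTransition t * χ y) • (η y - η 0) := by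
        simp [moserForm, θ, mul_smul]
      have h3 : |Real.smoothTransition t * χ y| ≤ 1 := by
        rw [abs_of_nonneg (mul_nonneg (Real.smoothTransition.nonneg t) χ.nonneg)]
        exact mul_le_one₀ (Real.smoothTransition.le_one t) χ.nonneg χ.le_one
      rw [h2, norm_smul, Real.norm_eq_abs]
      exact (mul_le_of_le_one_left (norm_nonneg _) h3).trans_lt h1
    · simpa [moserForm, θ, hχ0 y hy] using hε
  · intro y hy
    simp [θ, χ.one_of_mem_closedBall (Metric.ball_subset_closedBall hy)]
  · intro W hW y hy u hu v hv
    by_cases hyR : y ∈ Metric.ball (0 : E) R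
    · simp [θ, hW 0 W.zero_mem h0 u hu v hv, hW y hy (hRV hyR).2 u hu v hv]
    · simp [θ, hχ0 y hyR, hW 0 W.zero_mem h0 u hu v hv]

/-- Moser's argument applies to the globally defined cut-off form; its flow stays in the small ball
where that form agrees with `η`. -/
theorem exists_relative_darboux_chart {E : Type*} [NormedAddCommGroup E] [NormedSpace ℝ E]
    [FiniteDimensional ℝ E] {U : Set E} (hU : IsOpen U) (h0 : 0 ∈ U)
    {η : E → E →L[ℝ] E →L[ℝ] ℝ} (hη : ContDiffOn ℝ ∞ η U)
    (halt : ∀ y ∈ U, ∀ u v, η y u v = -η y v u) (hinv : (η 0).IsInvertible)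
    (hclosed : ∀ y ∈ U, ∀ u v w,
      fderiv ℝ η y u v w - fderiv ℝ η y v u w + fderiv ℝ η y w u v = 0) :
    ∃ e : OpenPartialHomeomorph E E, 0 ∈ e.source ∧ e 0 = 0 ∧ e.target ⊆ U ∧
      ContDiffOn ℝ ∞ e e.source ∧ ContDiffOn ℝ ∞ e.symm e.target ∧
      (∀ x ∈ e.source, ∀ u v, η (e x) (fderiv ℝ e x u) (fderiv ℝ e x v) = η 0 u v) ∧
      ∀ W : Submodule ℝ E, 2 * Module.finrank ℝ W = Module.finrank ℝ E →
        (∀ y ∈ W, y ∈ U → ∀ u ∈ W, ∀ v ∈ W, η y u v = 0) →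
        ∀ x ∈ e.source, (e x ∈ W ↔ x ∈ W) := by
  obtain ⟨θ, r, hr, hrU, hθ, hθalt, hθinv, hθη, hθW⟩ := exists_global_form hU h0 hη halt hinv
  have hfd : ∀ y ∈ Metric.ball (0 : E) r, fderiv ℝ θ y = fderiv ℝ η y := fun y hy ↦
    Filter.EventuallyEq.fderiv_eq (by
      filter_upwards [Metric.isOpen_ball.mem_nhds hy] with z hz using hθη z hz)
  obtain ⟨e, h0e, he0, het, hes, hest, hpull, hW⟩ := exists_moser_chart hθ hθalt hθinv hr
    (fun y hy u v w ↦ by rw [hfd y hy]; exact hclosed y (hrU hy) u v w)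
  refine ⟨e, h0e, he0, het.trans hrU, hes, hest, fun x hx u v ↦ ?_, fun W hdim hWU ↦
    hW W hdim (hθW W hWU)⟩
  rw [← hθη _ (het (e.map_source hx)), ← hθη 0 (Metric.mem_ball_self hr)]
  exact hpull x hx u v

/-! ### Alternating two-forms as bilinear forms -/

theorem update_pair_zero {α : Type*} (u v x : α) [DecidableEq (Fin 2)] :
    Function.update ![u, v] 0 x = ![x, v] := by
  ext i
  fin_cases i <;> simp

theorem update_pair_one {α : Type*} (u v x : α) [DecidableEq (Fin 2)] :
    Function.update ![u, v] 1 x = ![u, x] := by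
  ext i
  fin_cases i <;> simp

section ToBilin

variable {E : Type*} [NormedAddCommGroup E] [NormedSpace ℝ E] [FiniteDimensional ℝ E]

/-- The continuous bilinear form associated with an alternating two-form. -/
def ContinuousAlternatingMap.toBilin (a : E [⋀^Fin 2]→L[ℝ] ℝ) : E →L[ℝ] E →L[ℝ] ℝ :=
  LinearMap.toContinuousLinearMap
    (((LinearMap.toContinuousLinearMap : (E →ₗ[ℝ] ℝ) ≃ₗ[ℝ] (E →L[ℝ] ℝ)) :
      (E →ₗ[ℝ] ℝ) →ₗ[ℝ] (E →L[ℝ] ℝ)) ∘ₗ LinearMap.mk₂ ℝ (fun u v ↦ a ![u, v])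
      (fun u u' v ↦ by
        have := a.map_update_add ![u, v] 0 u u'
        simpa only [update_pair_zero] using this)
      (fun c u v ↦ by
        have := a.map_update_smul ![u, v] 0 c u
        simpa only [update_pair_zero] using this)
      (fun u v v' ↦ by
        have := a.map_update_add ![u, v] 1 v v'
        simpa only [update_pair_one] using this)
      (fun c u v ↦ by
        have := a.map_update_smul ![u, v] 1 c v
        simpa only [update_pair_one] using this))

@[simp]
theorem ContinuousAlternatingMap.toBilin_apply (a : E [⋀^Fin 2]→L[ℝ] ℝ) (u v : E) :
    a.toBilin u v = a ![u, v] := rfl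

theorem ContinuousAlternatingMap.toBilin_alt (a : E [⋀^Fin 2]→L[ℝ] ℝ) (u v : E) :
    a.toBilin u v = -a.toBilin v u := by
  have := a.toAlternatingMap.map_swap ![v, u] (show (0 : Fin 2) ≠ 1 by decide)
  have h : ![v, u] ∘ Equiv.swap (0 : Fin 2) 1 = ![u, v] := by
    ext i
    fin_cases i <;> rfl
  rw [h] at this
  exact this

theorem contDiffOn_toBilin {F : Type*} [NormedAddCommGroup F] [NormedSpace ℝ F]
    {ν : F → E [⋀^Fin 2]→L[ℝ] ℝ} {s : Set F} (hν : ContDiffOn ℝ ∞ ν s) :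
    ContDiffOn ℝ ∞ (fun y ↦ (ν y).toBilin) s := by
  refine contDiffOn_clm_apply.2 fun u ↦ contDiffOn_clm_apply.2 fun v ↦ ?_
  exact (ContinuousAlternatingMap.apply ℝ E ℝ ![u, v]).contDiff.comp_contDiffOn hν

theorem fderiv_toBilin_cyclic {ν : E → E [⋀^Fin 2]→L[ℝ] ℝ} {y : E}
    (hν : DifferentiableAt ℝ ν y) (hb : DifferentiableAt ℝ (fun z ↦ (ν z).toBilin) y)
    (hclosed : extDeriv ν y = 0) (u v w : E) :
    fderiv ℝ (fun z ↦ (ν z).toBilin) y u v w - fderiv ℝ (fun z ↦ (ν z).toBilin) y v u w +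
      fderiv ℝ (fun z ↦ (ν z).toBilin) y w u v = 0 := by
  have key : ∀ a b c, fderiv ℝ (fun z ↦ ν z ![b, c]) y a =
      fderiv ℝ (fun z ↦ (ν z).toBilin) y a b c := by
    intro a b c
    have h1 : HasFDerivAt (fun z ↦ ν z ![b, c])
        ((ContinuousLinearMap.apply ℝ ℝ c ∘L ContinuousLinearMap.apply ℝ (E →L[ℝ] ℝ) b) ∘L
          fderiv ℝ (fun z ↦ (ν z).toBilin) y) y :=
      HasFDerivAt.comp (f := fun z ↦ (ν z).toBilin) (g := fun B : E →L[ℝ] E →L[ℝ] ℝ ↦ B b c) y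
        (ContinuousLinearMap.apply ℝ ℝ c ∘L
          ContinuousLinearMap.apply ℝ (E →L[ℝ] ℝ) b).hasFDerivAt hb.hasFDerivAt
    rw [h1.fderiv]
    rfl
  have h := extDeriv_apply hν ![u, v, w]
  rw [hclosed] at h
  have e0 : (0 : Fin 3).removeNth ![u, v, w] = ![v, w] := by ext i; fin_cases i <;> rfl
  have e1 : (1 : Fin 3).removeNth ![u, v, w] = ![u, w] := by ext i; fin_cases i <;> rfl
  have e2 : (2 : Fin 3).removeNth ![u, v, w] = ![u, v] := by ext i; fin_cases i <;> rfl
  rw [Fin.sum_univ_three, e0, e1, e2] at h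
  simp only [Matrix.cons_val_zero, Matrix.cons_val_one, Matrix.cons_val, key] at h
  simp at h
  linear_combination -h

end ToBilin

/-! ### Linear normal form of a pair of transverse Lagrangian subspaces -/

section LinearNormalForm

variable {n : ℕ}

local notation "ℝN" => EuclideanSpace ℝ (Fin n)

/-- Real and imaginary parts. -/
def reImEquiv (n : ℕ) : CSpace n ≃ₗ[ℝ] EuclideanSpace ℝ (Fin n) × EuclideanSpace ℝ (Fin n) where
  toFun z := (WithLp.toLp 2 fun j ↦ (z j).re, WithLp.toLp 2 fun j ↦ (z j).im)
  invFun p := WithLp.toLp 2 fun j ↦ ⟨p.1 j, p.2 j⟩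
  map_add' _ _ := by ext <;> simp
  map_smul' _ _ := by ext <;> simp
  left_inv _ := by ext; simp
  right_inv _ := by ext <;> simp

/-- Since both factors are isotropic, `B` is determined by its pairing between them, which
nondegeneracy makes perfect. Representing the pairing by `A` through the inner product and replacing
the first factor by its image under `A⁻¹` turns it into the Euclidean pairing, that is, into the
standard form. -/
theorem exists_linear_symplectic_equiv {B : (ℝN × ℝN) →L[ℝ] (ℝN × ℝN) →L[ℝ] ℝ}
    (halt : ∀ u v, B u v = -B v u) (hB : ∀ u, (∀ v, B u v = 0) → u = 0)
    (h1 : ∀ a a', B (a, 0) (a', 0) = 0) (h2 : ∀ b b', B (0, b) (0, b') = 0) :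
    ∃ Λ : CSpace n ≃L[ℝ] ℝN × ℝN, (∀ z w, B (Λ z) (Λ w) = stdSymplectic z w) ∧
      (∀ z, (Λ z).1 = 0 ↔ z ∈ imagPlane n) ∧ (∀ z, (Λ z).2 = 0 ↔ z ∈ realPlane n) := by
  set A : ℝN →ₗ[ℝ] ℝN :=
    { toFun := fun a ↦ (InnerProductSpace.toDual ℝ ℝN).symm
        (B (a, 0) ∘L ContinuousLinearMap.inr ℝ ℝN ℝN)
      map_add' := fun a a' ↦ by
        rw [← map_add]
        congr 1
        ext b
        simp [← _root_.add_apply, ← map_add]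
      map_smul' := fun c a ↦ by
        rw [RingHom.id_apply]
        rw [show ((c • a, 0) : ℝN × ℝN) = c • (a, 0) by simp, map_smul]
        simp }
  have hA : ∀ a b, inner ℝ (A a) b = B (a, 0) (0, b) := fun a b ↦ by
    simp [A]
  have hsplit : ∀ p : ℝN × ℝN, p = (p.1, 0) + (0, p.2) := fun p ↦ by simp
  have hAinj : Function.Injective A := by
    refine (injective_iff_map_eq_zero A).2 fun a ha ↦ ?_
    have : ((a, 0) : ℝN × ℝN) = 0 := hB _ fun v ↦ by
      rw [hsplit v, map_add, h1, ← hA, ha, inner_zero_left, add_zero]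
    exact congrArg Prod.fst this
  set T := (LinearEquiv.ofInjectiveEndo A hAinj).symm
  have hT : ∀ a b, B (T a, 0) (0, b) = inner ℝ a b := fun a b ↦ by
    rw [← hA]
    congr 1
    exact (LinearEquiv.ofInjectiveEndo A hAinj).apply_symm_apply a
  refine ⟨((reImEquiv n).trans (T.prodCongr (LinearEquiv.refl ℝ ℝN))).toContinuousLinearEquiv,
    fun z w ↦ ?_, fun z ↦ ?_, fun z ↦ ?_⟩
  · change B (T (reImEquiv n z).1, (reImEquiv n z).2) (T (reImEquiv n w).1, (reImEquiv n w).2) = _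
    rw [hsplit (T (reImEquiv n z).1, _), hsplit (T (reImEquiv n w).1, _)]
    simp only [map_add, _root_.add_apply, h1, h2]
    rw [halt (0, _), hT, hT]
    simp only [reImEquiv, PiLp.inner_apply, stdSymplectic, Finset.sum_sub_distrib]
    simp only [conj_trivial, RCLike.inner_apply]
    simp [mul_comm]
    ring
  · change T (reImEquiv n z).1 = 0 ↔ _
    rw [LinearEquiv.map_eq_zero_iff]
    simp only [imagPlane, mem_ofPred_eq, reImEquiv]
    exact ⟨fun h j ↦ congrArg (fun x : ℝN ↦ x j) h, fun h ↦ by ext j; exact h j⟩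
  · change (reImEquiv n z).2 = 0 ↔ _
    simp only [realPlane, mem_ofPred_eq, reImEquiv]
    exact ⟨fun h j ↦ congrArg (fun x : ℝN ↦ x j) h, fun h ↦ by ext j; exact h j⟩

end LinearNormalForm

/-! ### Local defining functions of embedded submanifolds -/

section Straightening

variable {n : ℕ} {X : Type*} [TopologicalSpace X]
  [ChartedSpace (EuclideanSpace ℝ (Fin (2 * n))) X]

local notation "ℝN" => EuclideanSpace ℝ (Fin n)
local notation "ℝM" => EuclideanSpace ℝ (Fin (2 * n))

theorem OpenPartialHomeomorph.mdifferentiable_of_mem_maximalAtlas {E M : Type*}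
    [NormedAddCommGroup E] [NormedSpace ℝ E] [TopologicalSpace M] [ChartedSpace E M]
    {c : OpenPartialHomeomorph M E}
    (hc : c ∈ IsManifold.maximalAtlas 𝓘(ℝ, E) ∞ M) :
    c.MDifferentiable 𝓘(ℝ, E) 𝓘(ℝ, E) :=
  ⟨(contMDiffOn_of_mem_maximalAtlas hc).mdifferentiableOn (by simp),
    (contMDiffOn_symm_of_mem_maximalAtlas hc).mdifferentiableOn (by simp)⟩

/-- In immersion charts `ι` reads `u ↦ Θ (u, 0)`, so the complement component of the chart is a
defining function; the dimension count identifies the complement with `ℝⁿ`. -/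
theorem exists_local_defining_function {L : Type*} [TopologicalSpace L] [ChartedSpace ℝN L]
    {ι : L → X} (hι : Manifold.IsSmoothEmbedding (𝓡 n) (𝓡 (2 * n)) ∞ ι) (p : L) :
    ∃ (N : Set X) (F : X → ℝN), IsOpen N ∧ ι p ∈ N ∧
      ContMDiffOn (𝓡 (2 * n)) 𝓘(ℝ, ℝN) ∞ F N ∧ (∀ y ∈ N, y ∈ range ι ↔ F y = 0) ∧
      ∀ q, ι q ∈ N → ∀ w : TangentSpace (𝓡 (2 * n)) (ι q),
        mfderiv (𝓡 (2 * n)) 𝓘(ℝ, ℝN) F (ι q) w = 0 →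
          ∃ a : TangentSpace (𝓡 n) q, mfderiv (𝓡 n) (𝓡 (2 * n)) ι q a = w := by
  have him := hι.isImmersion.isImmersionAt p
  set c := him.codChart
  set d := him.domChart
  have hc := him.codChart_mem_maximalAtlas
  have hd := him.domChart_mem_maximalAtlas
  have hcM := OpenPartialHomeomorph.mdifferentiable_of_mem_maximalAtlas hc
  have hdM := OpenPartialHomeomorph.mdifferentiable_of_mem_maximalAtlas hd
  set Θ : (ℝN × him.complement) ≃L[ℝ] ℝM := him.equiv
  have hw : ∀ u ∈ d.target, c (ι (d.symm u)) = Θ (u, 0) := by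
    intro u hu
    have h1 := him.writtenInCharts
    have h2 : u ∈ (d.extend (𝓡 n)).target := by simpa using hu
    simpa using h1 h2
  have hdc : ∀ q ∈ d.source, ι q ∈ c.source := fun q hq ↦ him.source_subset_preimage_source hq
  have hwq : ∀ q ∈ d.source, c (ι q) = Θ (d q, 0) := fun q hq ↦ by
    rw [← hw _ (d.map_source hq), d.left_inv hq]
  have : FiniteDimensional ℝ (ℝN × him.complement) :=
    Θ.symm.toLinearEquiv.finiteDimensional
  have : FiniteDimensional ℝ him.complement :=
    Module.Finite.of_surjective (LinearMap.snd ℝ ℝN him.complement) LinearMap.snd_surjective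
  have hrank : Module.finrank ℝ him.complement = Module.finrank ℝ ℝN := by
    have h := Θ.toLinearEquiv.finrank_eq
    rw [Module.finrank_prod] at h
    simp only [finrank_euclideanSpace, Fintype.card_fin] at h ⊢
    omega
  set Ξ : him.complement ≃L[ℝ] ℝN := ContinuousLinearEquiv.ofFinrankEq hrank
  set G : ℝM →L[ℝ] ℝN := (Ξ : him.complement →L[ℝ] ℝN) ∘L
    ContinuousLinearMap.snd ℝ ℝN him.complement ∘L (Θ.symm : ℝM →L[ℝ] ℝN × him.complement)
  have hG : ∀ v, G v = 0 ↔ ∃ a, v = Θ (a, 0) := by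
    intro v
    have h1 : G v = Ξ (Θ.symm v).2 := rfl
    rw [h1, map_eq_zero_iff Ξ Ξ.injective]
    constructor
    · intro h
      refine ⟨(Θ.symm v).1, ?_⟩
      rw [← h]
      simp
    · rintro ⟨a, rfl⟩
      simp
  obtain ⟨V, hV, hVd⟩ := hι.isEmbedding.isOpen_iff.1 d.open_source
  set g : X → ℝN := fun y ↦ (Θ.symm (c y)).1
  have hg : ContinuousOn g c.source :=
    (continuous_fst.comp Θ.symm.continuous).comp_continuousOn c.continuousOn
  -- `V` comes from the embedding property and keeps other sheets of `L` out of `N`. The condition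
  -- on `g` discards points of the plane `Θ (u, 0)` with `u` outside the image of the domain chart.
  set N : Set X := V ∩ (c.source ∩ g ⁻¹' d.target)
  have hN : IsOpen N := hV.inter (hg.isOpen_inter_preimage c.open_source d.open_target)
  have hNd : ∀ q, ι q ∈ N → q ∈ d.source := fun q hq ↦ by
    rw [← hVd]
    exact hq.1
  refine ⟨N, fun y ↦ G (c y), hN, ?_, ?_, ?_, ?_⟩
  · have hp := him.mem_domChart_source
    refine ⟨?_, hdc p hp, ?_⟩
    · rw [← mem_preimage, hVd]
      exact hp
    · have h1 : g (ι p) = d p := by simp [g, hwq p hp]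
      rw [mem_preimage, h1]
      exact d.map_source hp
  · exact G.contMDiff.comp_contMDiffOn
      ((contMDiffOn_of_mem_maximalAtlas hc).mono fun y hy ↦ hy.2.1)
  · intro y hy
    constructor
    · rintro ⟨q, rfl⟩
      exact (hG _).2 ⟨d q, hwq q (hNd q hy)⟩
    · intro h
      obtain ⟨a, ha⟩ := (hG _).1 h
      have ha' : a ∈ d.target := by
        have : g y = a := by simp [g, ha]
        rw [← this]
        exact hy.2.2
      refine ⟨d.symm a, c.injOn (hdc _ (d.map_target ha')) hy.2.1 ?_⟩
      rw [hw a ha', ha]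
  · intro q hq w hFw
    have hqd := hNd q hq
    have hcd := hcM.mdifferentiableAt (hdc q hqd)
    have h1 : mfderiv (𝓡 (2 * n)) 𝓘(ℝ, ℝN) (fun y ↦ G (c y)) (ι q) =
        G ∘L (mfderiv (𝓡 (2 * n)) (𝓡 (2 * n)) c (ι q) : ℝM →L[ℝ] ℝM) := by
      have := (G.hasMFDerivAt (x := c (ι q))).comp (ι q) hcd.hasMFDerivAt
      exact this.mfderiv
    rw [h1] at hFw
    obtain ⟨a, ha⟩ := (hG _).1 hFw
    have hιd : MDifferentiableAt (𝓡 n) (𝓡 (2 * n)) ι q :=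
      (hι.contMDiff q).mdifferentiableAt (by simp)
    have h2 : HasMFDerivAt 𝓘(ℝ, ℝN) 𝓘(ℝ, ℝM) (fun u ↦ c (ι (d.symm u))) (d q)
        ((mfderiv (𝓡 (2 * n)) (𝓡 (2 * n)) c (ι q) : ℝM →L[ℝ] ℝM) ∘L
          (mfderiv (𝓡 n) (𝓡 (2 * n)) ι q : ℝN →L[ℝ] ℝM) ∘L
          (mfderiv (𝓡 n) (𝓡 n) d.symm (d q) : ℝN →L[ℝ] ℝN)) := by
      have hds := (hdM.mdifferentiableAt_symm (d.map_source hqd)).hasMFDerivAt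
      have hq' : d.symm (d q) = q := d.left_inv hqd
      have e1 := hιd.hasMFDerivAt
      have e2 := hcd.hasMFDerivAt
      have e3 : HasMFDerivAt 𝓘(ℝ, ℝN) 𝓘(ℝ, ℝM) (ι ∘ d.symm) (d q) _ :=
        HasMFDerivAt.comp (d q) (by rw [hq']; exact e1) hds
      have e4 := HasMFDerivAt.comp (g := c) (f := ι ∘ d.symm) (d q)
        (by
        rw [Function.comp_apply, hq']
        exact e2) e3
      exact e4
    have h3 : HasMFDerivAt 𝓘(ℝ, ℝN) 𝓘(ℝ, ℝM) (fun u ↦ c (ι (d.symm u))) (d q)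
        ((Θ : ℝN × him.complement →L[ℝ] ℝM) ∘L ContinuousLinearMap.inl ℝ ℝN him.complement) := by
      refine HasFDerivAt.hasMFDerivAt ?_
      refine HasFDerivAt.congr_of_eventuallyEq (ContinuousLinearMap.hasFDerivAt _) ?_
      filter_upwards [d.open_target.mem_nhds (d.map_source hqd)] with u hu using hw u hu
    have h4 := congrArg (fun T : ℝN →L[ℝ] ℝM ↦ T a) (hasMFDerivAt_unique h2 h3)
    refine ⟨(mfderiv (𝓡 n) (𝓡 n) d.symm (d q) : ℝN →L[ℝ] ℝN) a, ?_⟩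
    apply hcM.mfderiv_injective (hdc q hqd)
    exact h4.trans ha.symm

end Straightening

/-! ### Pullbacks of symplectic forms -/

section Pullback

variable {E : Type*} [NormedAddCommGroup E] [NormedSpace ℝ E] [FiniteDimensional ℝ E]
  {X : Type*} [TopologicalSpace X] [ChartedSpace E X]

/-- The bilinear form on `E` underlying a symplectic form at a point. -/
def SymplecticForm.bilin (σ : SymplecticForm E X) (x : X) : E →L[ℝ] E →L[ℝ] ℝ :=
  ContinuousAlternatingMap.toBilin (E := E) (σ.toForm x)

theorem SymplecticForm.bilin_alt (σ : SymplecticForm E X) (x : X) (u v : E) :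
    σ.bilin x u v = -σ.bilin x v u :=
  ContinuousAlternatingMap.toBilin_alt (E := E) (σ.toForm x) u v

theorem SymplecticForm.bilin_nondegenerate (σ : SymplecticForm E X) (x : X) (u : E)
    (hu : ∀ v, σ.bilin x u v = 0) : u = 0 := σ.nondegenerate x u hu

/-- Smoothness and closedness of `σ` are given in charts of the atlas, so the form is pulled back
from the chart at `x₀` along `κ ∘ ψ`; closedness passes over because the exterior derivative
commutes with pullback. -/
theorem SymplecticForm.exists_pullback [IsManifold 𝓘(ℝ, E) ∞ X] (σ : SymplecticForm E X)
    {F : Type*} [NormedAddCommGroup F] [NormedSpace ℝ F] [FiniteDimensional ℝ F] {ψ : F → X}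
    {s : Set F} (hs : IsOpen s) (hψ : ContMDiffOn 𝓘(ℝ, F) 𝓘(ℝ, E) ∞ ψ s) (x₀ : X)
    (hsx : MapsTo ψ s (chartAt E x₀).source) :
    ∃ η : F → F →L[ℝ] F →L[ℝ] ℝ, ContDiffOn ℝ ∞ η s ∧
      (∀ y ∈ s, ∀ u v, η y u v = σ.bilin (ψ y) (mfderiv 𝓘(ℝ, F) 𝓘(ℝ, E) ψ y u)
        (mfderiv 𝓘(ℝ, F) 𝓘(ℝ, E) ψ y v)) ∧
      ∀ y ∈ s, ∀ u v w,
        fderiv ℝ η y u v w - fderiv ℝ η y v u w + fderiv ℝ η y w u v = 0 := by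
  have : IsManifold 𝓘(ℝ, E) 1 X := .of_le (n := ∞) (by simp)
  set κ := chartAt E x₀
  have hκ : κ ∈ atlas E X := chart_mem_atlas E x₀
  set k : F → E := fun y ↦ κ (ψ y)
  have hk : ContDiffOn ℝ ∞ k s := by
    rw [← contMDiffOn_iff_contDiffOn]
    exact (contMDiffOn_chart (I := 𝓘(ℝ, E))).comp hψ hsx
  have hkt : MapsTo k s κ.target := fun y hy ↦ κ.map_source (hsx hy)
  have hkat : ∀ y ∈ s, ContDiffAt ℝ ∞ k y := fun y hy ↦ hk.contDiffAt (hs.mem_nhds hy)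
  have hcat : ∀ y ∈ s, ContDiffAt ℝ ∞ (σ.toForm.inChart κ) (k y) := fun y hy ↦
    (σ.smooth κ hκ).contDiffAt (κ.open_target.mem_nhds (hkt hy))
  have hDk : ContDiffOn ℝ ∞ (fderiv ℝ k) s := hk.fderiv_of_isOpen hs (by simp)
  set ν : F → F [⋀^Fin 2]→L[ℝ] ℝ := fun y ↦
    (σ.toForm.inChart κ (k y)).compContinuousLinearMap (fderiv ℝ k y)
  have hν : ∀ y ∈ s, DifferentiableAt ℝ ν y := fun y hy ↦
    DifferentiableAt.continuousAlternatingMapCompContinuousLinearMap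
      (((hcat y hy).comp y (hkat y hy)).differentiableAt (by simp))
      ((hDk.contDiffAt (hs.mem_nhds hy)).differentiableAt (by simp))
  have hb := contDiffOn_toBilin (σ.smooth κ hκ)
  have hη : ContDiffOn ℝ ∞ (fun y ↦ (ν y).toBilin) s := by
    refine contDiffOn_clm_apply.2 fun u ↦ contDiffOn_clm_apply.2 fun v ↦ ?_
    have h1 : ContDiffOn ℝ ∞
        (fun y ↦ (σ.toForm.inChart κ (k y)).toBilin (fderiv ℝ k y u) (fderiv ℝ k y v)) s :=
      ((hb.comp hk hkt).clm_apply (hDk.clm_apply contDiffOn_const)).clm_apply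
        (hDk.clm_apply contDiffOn_const)
    refine h1.congr fun y hy ↦ ?_
    change σ.toForm.inChart κ (k y) (fderiv ℝ k y ∘ ![u, v]) =
      σ.toForm.inChart κ (k y) ![fderiv ℝ k y u, fderiv ℝ k y v]
    congr 1
    ext i
    fin_cases i <;> rfl
  refine ⟨fun y ↦ (ν y).toBilin, hη, fun y hy u v ↦ ?_, fun y hy u v w ↦ ?_⟩
  · have hkd : HasMFDerivAt 𝓘(ℝ, F) 𝓘(ℝ, E) k y (fderiv ℝ k y) :=
      ((hkat y hy).differentiableAt (by simp)).hasFDerivAt.hasMFDerivAt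
    have hsd := (mdifferentiableAt_atlas_symm (I := 𝓘(ℝ, E)) hκ (hkt hy)).hasMFDerivAt
    have hcomp := (hsd.comp y hkd).congr_of_eventuallyEq (f₁ := ψ) (by
      filter_upwards [hs.mem_nhds hy] with z hz using (κ.left_inv (hsx hz)).symm)
    have hD : (mfderiv 𝓘(ℝ, F) 𝓘(ℝ, E) ψ y : F →L[ℝ] E) =
      (mfderiv 𝓘(ℝ, E) 𝓘(ℝ, E) κ.symm (k y) : E →L[ℝ] E) ∘L fderiv ℝ k y := hcomp.mfderiv
    -- The points `κ.symm (κ (ψ y))` and `ψ y` are equal only propositionally, so the form must be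
    -- transported between their tangent spaces, both of which are `E`.
    have hbase : ∀ x, x = ψ y → ∀ a b : E, σ.bilin x a b = σ.bilin (ψ y) a b := by
      rintro _ rfl a b
      rfl
    rw [hD]
    refine Eq.trans ?_ (hbase (κ.symm (k y)) (κ.left_inv (hsx hy)) _ _)
    change (σ.toForm (κ.symm (k y)) : E [⋀^Fin 2]→L[ℝ] ℝ)
      ((mfderiv 𝓘(ℝ, E) 𝓘(ℝ, E) κ.symm (k y) : E →L[ℝ] E) ∘ (fderiv ℝ k y ∘ ![u, v])) =
      (σ.toForm (κ.symm (k y)) : E [⋀^Fin 2]→L[ℝ] ℝ) ![_, _]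
    congr 1
    ext i
    fin_cases i <;> rfl
  · refine fderiv_toBilin_cyclic (hν y hy)
      ((hη.contDiffAt (hs.mem_nhds hy)).differentiableAt (by simp)) ?_ u v w
    have := extDeriv_pullback (r := 2) ((hcat y hy).differentiableAt (by simp))
      ((hkat y hy).of_le (by norm_cast)) (by simp)
    rw [σ.closed κ hκ _ (hkt hy)] at this
    refine this.trans ?_
    ext v
    rfl

end Pullback

/-! ### Darboux charts adapted to two transverse Lagrangians -/

section LinearAlgebra

variable {V : Type*} [NormedAddCommGroup V] [NormedSpace ℝ V] [FiniteDimensional ℝ V]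

theorem ContinuousLinearMap.isInvertible_of_nondegenerate {B : V →L[ℝ] V →L[ℝ] ℝ}
    (hB : ∀ u, (∀ v, B u v = 0) → u = 0) : B.IsInvertible := by
  have hinj : Function.Injective (B : V →ₗ[ℝ] V →L[ℝ] ℝ) :=
    (injective_iff_map_eq_zero _).2 fun u hu ↦ hB u fun v ↦ by
      have : B u = 0 := hu
      simp [this]
  have hrank : Module.finrank ℝ V = Module.finrank ℝ (V →L[ℝ] ℝ) := by
    rw [← (LinearMap.toContinuousLinearMap : (V →ₗ[ℝ] ℝ) ≃ₗ[ℝ] (V →L[ℝ] ℝ)).finrank_eq]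
    exact (Subspace.dual_finrank_eq (K := ℝ) (V := V)).symm
  exact ⟨(LinearEquiv.ofInjectiveOfFinrankEq (B : V →ₗ[ℝ] V →L[ℝ] ℝ) hinj
    hrank).toContinuousLinearEquiv, by ext; rfl⟩

theorem Submodule.inf_eq_bot_of_sup_eq_top {W₁ W₂ : Submodule ℝ V} {n : ℕ}
    (h₁ : Module.finrank ℝ W₁ ≤ n) (h₂ : Module.finrank ℝ W₂ ≤ n)
    (hV : Module.finrank ℝ V = 2 * n) (hsup : W₁ ⊔ W₂ = ⊤) : W₁ ⊓ W₂ = ⊥ := by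
  have := Submodule.finrank_sup_add_finrank_inf_eq W₁ W₂
  rw [hsup, finrank_top] at this
  exact Submodule.finrank_eq_zero.1 (by omega)

end LinearAlgebra

section SymplecticChart

variable {n : ℕ} {X : Type*} [TopologicalSpace X]
  [ChartedSpace (EuclideanSpace ℝ (Fin (2 * n))) X]

local notation "ℝN" => EuclideanSpace ℝ (Fin n)
local notation "ℝM" => EuclideanSpace ℝ (Fin (2 * n))

theorem finrank_tangentImage_le {L : Type*} [TopologicalSpace L] [ChartedSpace ℝN L]
    (ι : L → X) (p : L) : Module.finrank ℝ (tangentImage n ℝM ι p) ≤ n := by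
  have h : ∀ f : ℝN →L[ℝ] ℝM, Module.finrank ℝ f.range ≤ n := fun f ↦
    (LinearMap.finrank_range_le (f : ℝN →ₗ[ℝ] ℝM)).trans_eq (by simp)
  exact h _

/-- The kernel of the differential of `F` lies in the tangent space of `L`, so isotropy of `ι`
becomes isotropy of that kernel. The points are named `z` with `z = ι q` so that the clauses apply
where the equality is not definitional. -/
theorem IsLagrangianEmbedding.exists_defining_function {L : Type*} [TopologicalSpace L]
    [ChartedSpace ℝN L] {σ : SymplecticForm ℝM X} {ι : L → X}
    (hι : IsLagrangianEmbedding n σ ι) (p : L) :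
    ∃ (N : Set X) (F : X → ℝN), IsOpen N ∧ ι p ∈ N ∧
      ContMDiffOn (𝓡 (2 * n)) 𝓘(ℝ, ℝN) ∞ F N ∧ (∀ y ∈ N, y ∈ range ι ↔ F y = 0) ∧
      (∀ z ∈ N, ∀ q, z = ι q → ∀ w : ℝM,
        (mfderiv (𝓡 (2 * n)) 𝓘(ℝ, ℝN) F z : ℝM →L[ℝ] ℝN) w = 0 → w ∈ tangentImage n ℝM ι q) ∧
      ∀ z ∈ N, F z = 0 → ∀ u v : ℝM,
        (mfderiv (𝓡 (2 * n)) 𝓘(ℝ, ℝN) F z : ℝM →L[ℝ] ℝN) u = 0 →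
        (mfderiv (𝓡 (2 * n)) 𝓘(ℝ, ℝN) F z : ℝM →L[ℝ] ℝN) v = 0 → σ.bilin z u v = 0 := by
  obtain ⟨N, F, hN, hp, hF, hmem, hker⟩ := exists_local_defining_function hι.isSmoothEmbedding p
  have hker' : ∀ z ∈ N, ∀ q, z = ι q → ∀ w : ℝM,
      (mfderiv (𝓡 (2 * n)) 𝓘(ℝ, ℝN) F z : ℝM →L[ℝ] ℝN) w = 0 →
        w ∈ tangentImage n ℝM ι q := by
    rintro _ hz q rfl w hw
    exact hker q hz w hw
  refine ⟨N, F, hN, hp, hF, hmem, hker', fun z hz h0 u v hu hv ↦ ?_⟩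
  obtain ⟨q, rfl⟩ := (hmem z hz).2 h0
  obtain ⟨a, rfl⟩ := hker' _ hz q rfl u hu
  obtain ⟨b, rfl⟩ := hker' _ hz q rfl v hv
  exact hι.isotropic q a b

theorem mfderiv_comp_eq_of_eventuallyEq {V G : Type*} [NormedAddCommGroup V] [NormedSpace ℝ V]
    [NormedAddCommGroup G] [NormedSpace ℝ G] {F : X → G} {ψ : V → X} {y : V} {π : V →L[ℝ] G}
    (hF : MDifferentiableAt (𝓡 (2 * n)) 𝓘(ℝ, G) F (ψ y))
    (hψ : MDifferentiableAt 𝓘(ℝ, V) (𝓡 (2 * n)) ψ y)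
    (h : ∀ᶠ z in 𝓝 y, F (ψ z) = π z) (u : V) :
    (mfderiv (𝓡 (2 * n)) 𝓘(ℝ, G) F (ψ y) : ℝM →L[ℝ] G)
      ((mfderiv 𝓘(ℝ, V) (𝓡 (2 * n)) ψ y : V →L[ℝ] ℝM) u) = π u := by
  have h1 := (hF.hasMFDerivAt.comp y hψ.hasMFDerivAt).congr_of_eventuallyEq (f₁ := π)
    (h.mono fun z hz ↦ hz.symm)
  exact congrArg (fun T : V →L[ℝ] G ↦ T u)
    (hasMFDerivAt_unique h1 (π.hasFDerivAt.hasMFDerivAt (x := y)))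

/-- With `(F₁, F₂)` as coordinates, `L` is `{0} × ℝⁿ` and `L'` is `ℝⁿ × {0}`. The relative Darboux
chart `e` and the linear map `Λ` then normalize the form without moving the two subspaces away from
the required planes. -/
theorem exists_symplectic_chart [IsManifold (𝓡 (2 * n)) ∞ X] {σ : SymplecticForm ℝM X}
    {L L' : Type*} [TopologicalSpace L] [ChartedSpace ℝN L]
    [TopologicalSpace L'] [ChartedSpace ℝN L'] {ι : L → X} {ι' : L' → X}
    (hι : IsLagrangianEmbedding n σ ι) (hι' : IsLagrangianEmbedding n σ ι') {p : L} {q : L'}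
    (hpq : ι p = ι' q) (htr : tangentImage n ℝM ι p ⊔ tangentImage n ℝM ι' q = ⊤) :
    ∃ φ : OpenPartialHomeomorph (CSpace n) X, 0 ∈ φ.source ∧ φ 0 = ι p ∧
      ContMDiffOn 𝓘(ℝ, CSpace n) (𝓡 (2 * n)) ∞ φ φ.source ∧
      ContMDiffOn (𝓡 (2 * n)) 𝓘(ℝ, CSpace n) ∞ φ.symm φ.target ∧
      (∀ z ∈ φ.source, ∀ u v : CSpace n,
        σ.bilin (φ z) (mfderiv 𝓘(ℝ, CSpace n) (𝓡 (2 * n)) φ z u)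
          (mfderiv 𝓘(ℝ, CSpace n) (𝓡 (2 * n)) φ z v) = stdSymplectic u v) ∧
      φ.source ∩ φ ⁻¹' range ι = φ.source ∩ imagPlane n ∧
      φ.source ∩ φ ⁻¹' range ι' = φ.source ∩ realPlane n := by
  have : IsManifold (𝓡 (2 * n)) 1 X := .of_le (n := ∞) (by simp)
  obtain ⟨N₁, F₁, hN₁, hpN₁, hF₁, hmem₁, hker₁, hiso₁⟩ := hι.exists_defining_function p
  obtain ⟨N₂, F₂, hN₂, hqN₂, hF₂, hmem₂, hker₂, hiso₂⟩ := hι'.exists_defining_function q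
  rw [← hpq] at hqN₂
  set x := ι p with hx
  set κ := chartAt ℝM x
  have hκ : κ ∈ atlas ℝM X := chart_mem_atlas ℝM x
  have hκm := OpenPartialHomeomorph.mdifferentiable_of_mem_maximalAtlas
    (IsManifold.subset_maximalAtlas (I := 𝓡 (2 * n)) (n := ∞) hκ)
  have hxκ : x ∈ κ.source := mem_chart_source ℝM x
  have hκa : κ.symm (κ x) = x := κ.left_inv hxκ
  set T : Set ℝM := κ.target ∩ κ.symm ⁻¹' (N₁ ∩ N₂)
  have hT : IsOpen T := κ.isOpen_inter_preimage_symm (hN₁.inter hN₂)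
  have haT : κ x ∈ T := ⟨κ.map_source hxκ, by rw [mem_preimage, hκa]; exact ⟨hpN₁, hqN₂⟩⟩
  have hsymm : ContMDiffOn (𝓡 (2 * n)) (𝓡 (2 * n)) ∞ κ.symm κ.target :=
    contMDiffOn_chart_symm (I := 𝓡 (2 * n))
  set H : ℝM → ℝN × ℝN := fun y ↦ (F₁ (κ.symm y), F₂ (κ.symm y))
  have hH₁ : ContDiffOn ℝ ∞ (fun y ↦ F₁ (κ.symm y)) T := by
    rw [← contMDiffOn_iff_contDiffOn]
    exact hF₁.comp (hsymm.mono inter_subset_left) fun y hy ↦ hy.2.1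
  have hH₂ : ContDiffOn ℝ ∞ (fun y ↦ F₂ (κ.symm y)) T := by
    rw [← contMDiffOn_iff_contDiffOn]
    exact hF₂.comp (hsymm.mono inter_subset_left) fun y hy ↦ hy.2.2
  have hH : ContDiffOn ℝ ∞ H T := hH₁.prodMk hH₂
  have hF₁d : ∀ y ∈ N₁, MDifferentiableAt (𝓡 (2 * n)) 𝓘(ℝ, ℝN) F₁ y := fun y hy ↦
    ((hF₁ y hy).contMDiffAt (hN₁.mem_nhds hy)).mdifferentiableAt (by simp)
  have hF₂d : ∀ y ∈ N₂, MDifferentiableAt (𝓡 (2 * n)) 𝓘(ℝ, ℝN) F₂ y := fun y hy ↦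
    ((hF₂ y hy).contMDiffAt (hN₂.mem_nhds hy)).mdifferentiableAt (by simp)
  have hκd := (hκm.mdifferentiableAt_symm haT.1)
  have hHd : HasFDerivAt H (fderiv ℝ H (κ x)) (κ x) :=
    ((hH.contDiffAt (hT.mem_nhds haT)).differentiableAt (by simp)).hasFDerivAt
  have hd₁ := hasMFDerivAt_unique (hasFDerivAt_fst.comp (κ x) hHd).hasMFDerivAt
    ((hF₁d _ haT.2.1).hasMFDerivAt.comp (κ x) hκd.hasMFDerivAt)
  have hd₂ := hasMFDerivAt_unique (hasFDerivAt_snd.comp (κ x) hHd).hasMFDerivAt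
    ((hF₂d _ haT.2.2).hasMFDerivAt.comp (κ x) hκd.hasMFDerivAt)
  -- A vector killed by both differentials is tangent to `L` and to `L'`; transversality and
  -- dimensions leave only zero.
  have hinj : Function.Injective (fderiv ℝ H (κ x)) := by
    refine (injective_iff_map_eq_zero _).2 fun w hw ↦ ?_
    set w' : ℝM := (mfderiv (𝓡 (2 * n)) (𝓡 (2 * n)) κ.symm (κ x) : ℝM →L[ℝ] ℝM) w
    have e₁ : (mfderiv (𝓡 (2 * n)) 𝓘(ℝ, ℝN) F₁ (κ.symm (κ x)) : ℝM →L[ℝ] ℝN) w' = 0 := by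
      refine (congrArg (fun S : ℝM →L[ℝ] ℝN ↦ S w) hd₁).symm.trans ?_
      change (fderiv ℝ H (κ x) w).1 = 0
      rw [hw]
      rfl
    have e₂ : (mfderiv (𝓡 (2 * n)) 𝓘(ℝ, ℝN) F₂ (κ.symm (κ x)) : ℝM →L[ℝ] ℝN) w' = 0 := by
      refine (congrArg (fun S : ℝM →L[ℝ] ℝN ↦ S w) hd₂).symm.trans ?_
      change (fderiv ℝ H (κ x) w).2 = 0
      rw [hw]
      rfl
    have hw' : w' ∈ tangentImage n ℝM ι p ⊓ tangentImage n ℝM ι' q :=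
      ⟨hker₁ _ haT.2.1 p hκa w' e₁, hker₂ _ haT.2.2 q (hκa.trans hpq) w' e₂⟩
    rw [Submodule.inf_eq_bot_of_sup_eq_top (finrank_tangentImage_le ι p)
      (finrank_tangentImage_le ι' q) (by simp) htr, Submodule.mem_bot] at hw'
    apply hκm.symm.mfderiv_injective haT.1
    exact hw'.trans (map_zero (mfderiv (𝓡 (2 * n)) (𝓡 (2 * n)) κ.symm (κ x))).symm
  set A : ℝM ≃L[ℝ] ℝN × ℝN := (LinearEquiv.ofInjectiveOfFinrankEq
    (fderiv ℝ H (κ x) : ℝM →ₗ[ℝ] ℝN × ℝN) hinj (by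
      simp [Module.finrank_prod, two_mul])).toContinuousLinearEquiv
  obtain ⟨h, hhH, hah, hhT, -, hhs⟩ := exists_openPartialHomeomorph_of_contDiffOn hT hH haT A
    hHd
  set ψ : OpenPartialHomeomorph (ℝN × ℝN) X := h.symm ≫ₕ κ.symm
  have hψs : ∀ y, y ∈ ψ.source ↔ y ∈ h.target := by
    intro y
    simp only [ψ, OpenPartialHomeomorph.trans_source, OpenPartialHomeomorph.symm_source,
      mem_inter_iff, mem_preimage, and_iff_left_iff_imp]
    exact fun hy ↦ (hhT (h.map_target hy)).1
  have hψT : ∀ y ∈ ψ.source, h.symm y ∈ T := fun y hy ↦ hhT (h.map_target ((hψs y).1 hy))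
  have hψc : ContMDiffOn 𝓘(ℝ, ℝN × ℝN) (𝓡 (2 * n)) ∞ ψ ψ.source :=
    hsymm.comp ((contMDiffOn_iff_contDiffOn.2 hhs).mono fun y hy ↦ (hψs y).1 hy)
      fun y hy ↦ (hψT y hy).1
  have hψc' : ContMDiffOn (𝓡 (2 * n)) 𝓘(ℝ, ℝN × ℝN) ∞ ψ.symm ψ.target := by
    have h1 : ContMDiffOn (𝓡 (2 * n)) 𝓘(ℝ, ℝN × ℝN) ∞ h h.source := by
      rw [hhH]
      exact contMDiffOn_iff_contDiffOn.2 (hH.mono hhT)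
    refine h1.comp ((contMDiffOn_chart (I := 𝓡 (2 * n)) (x := x)).mono ?_) ?_
    · exact fun y hy ↦ hy.1
    · exact fun y hy ↦ hy.2
  have hHψ : ∀ y ∈ ψ.source, H (h.symm y) = y := fun y hy ↦ by
    rw [← hhH]
    exact h.right_inv ((hψs y).1 hy)
  have hψ₁ : ∀ y ∈ ψ.source, F₁ (ψ y) = y.1 := fun y hy ↦ congrArg Prod.fst (hHψ y hy)
  have hψ₂ : ∀ y ∈ ψ.source, F₂ (ψ y) = y.2 := fun y hy ↦ congrArg Prod.snd (hHψ y hy)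
  have hψm : ψ.MDifferentiable 𝓘(ℝ, ℝN × ℝN) (𝓡 (2 * n)) :=
    ⟨hψc.mdifferentiableOn (by simp), hψc'.mdifferentiableOn (by simp)⟩
  have hHa : h (κ x) = 0 := by
    rw [hhH]
    change (F₁ (κ.symm (κ x)), F₂ (κ.symm (κ x))) = 0
    rw [hκa, (hmem₁ x hpN₁).1 ⟨p, rfl⟩, (hmem₂ x hqN₂).1 ⟨q, hpq.symm⟩]
    rfl
  have h0ψ : (0 : ℝN × ℝN) ∈ ψ.source := by
    rw [hψs, ← hHa]
    exact h.map_source hah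
  have hψ0 : ψ 0 = x := by
    change κ.symm (h.symm 0) = x
    rw [← hHa, h.left_inv hah, hκa]
  obtain ⟨η, hη, hησ, hηc⟩ := σ.exists_pullback ψ.open_source hψc x
    fun y hy ↦ κ.map_target (hψT y hy).1
  have hηalt : ∀ y ∈ ψ.source, ∀ u v, η y u v = -η y v u := fun y hy u v ↦ by
    rw [hησ y hy, hησ y hy]
    exact σ.bilin_alt _ _ _
  have hηnd : ∀ u, (∀ v, η 0 u v = 0) → u = 0 := by
    intro u hu
    apply hψm.mfderiv_injective h0ψ
    refine Eq.trans ?_ (map_zero (mfderiv 𝓘(ℝ, ℝN × ℝN) (𝓡 (2 * n)) ψ 0)).symm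
    refine σ.bilin_nondegenerate (ψ 0) _ fun v ↦ ?_
    obtain ⟨v', rfl⟩ := hψm.mfderiv_surjective h0ψ v
    exact (hησ 0 h0ψ u v').symm.trans (hu v')
  have hη₁ : ∀ y ∈ ψ.source, y.1 = 0 → ∀ u v : ℝN × ℝN, u.1 = 0 → v.1 = 0 → η y u v = 0 := by
    intro y hy hy1 u v hu hv
    have hyd : ∀ᶠ z in 𝓝 y, F₁ (ψ z) = ContinuousLinearMap.fst ℝ ℝN ℝN z := by
      filter_upwards [ψ.open_source.mem_nhds hy] with z hz using hψ₁ z hz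
    have hyN : ψ y ∈ N₁ := (hψT y hy).2.1
    rw [hησ y hy]
    exact hiso₁ _ hyN ((hψ₁ y hy).trans hy1) _ _
      ((mfderiv_comp_eq_of_eventuallyEq (hF₁d _ hyN) (hψm.mdifferentiableAt hy) hyd u).trans hu)
      ((mfderiv_comp_eq_of_eventuallyEq (hF₁d _ hyN) (hψm.mdifferentiableAt hy) hyd v).trans hv)
  have hη₂ : ∀ y ∈ ψ.source, y.2 = 0 → ∀ u v : ℝN × ℝN, u.2 = 0 → v.2 = 0 → η y u v = 0 := by
    intro y hy hy1 u v hu hv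
    have hyd : ∀ᶠ z in 𝓝 y, F₂ (ψ z) = ContinuousLinearMap.snd ℝ ℝN ℝN z := by
      filter_upwards [ψ.open_source.mem_nhds hy] with z hz using hψ₂ z hz
    have hyN : ψ y ∈ N₂ := (hψT y hy).2.2
    rw [hησ y hy]
    exact hiso₂ _ hyN ((hψ₂ y hy).trans hy1) _ _
      ((mfderiv_comp_eq_of_eventuallyEq (hF₂d _ hyN) (hψm.mdifferentiableAt hy) hyd u).trans hu)
      ((mfderiv_comp_eq_of_eventuallyEq (hF₂d _ hyN) (hψm.mdifferentiableAt hy) hyd v).trans hv)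
  obtain ⟨e, h0e, he0, het, hes, hest, hepull, heW⟩ := exists_relative_darboux_chart
    ψ.open_source h0ψ hη hηalt (ContinuousLinearMap.isInvertible_of_nondegenerate hηnd) hηc
  obtain ⟨Λ, hΛ, hΛ₁, hΛ₂⟩ := exists_linear_symplectic_equiv (B := η 0)
    (fun u v ↦ hηalt 0 h0ψ u v) hηnd
    (fun a a' ↦ hη₂ 0 h0ψ rfl _ _ rfl rfl) (fun b b' ↦ hη₁ 0 h0ψ rfl _ _ rfl rfl)
  have he₁ : ∀ y ∈ e.source, (e y).1 = 0 ↔ y.1 = 0 := fun y hy ↦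
    heW (LinearMap.ker (LinearMap.fst ℝ ℝN ℝN)) (by
      have := LinearMap.finrank_range_add_finrank_ker (LinearMap.fst ℝ ℝN ℝN)
      rw [LinearMap.range_eq_top.2 LinearMap.fst_surjective, finrank_top] at this
      simp only [Module.finrank_prod, finrank_euclideanSpace, Fintype.card_fin] at this ⊢
      omega) (fun y hy hyU u hu v hv ↦ hη₁ y hyU hy u v hu hv) y hy
  have he₂ : ∀ y ∈ e.source, (e y).2 = 0 ↔ y.2 = 0 := fun y hy ↦
    heW (LinearMap.ker (LinearMap.snd ℝ ℝN ℝN)) (by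
      have := LinearMap.finrank_range_add_finrank_ker (LinearMap.snd ℝ ℝN ℝN)
      rw [LinearMap.range_eq_top.2 LinearMap.snd_surjective, finrank_top] at this
      simp only [Module.finrank_prod, finrank_euclideanSpace, Fintype.card_fin] at this ⊢
      omega) (fun y hy hyU u hu v hv ↦ hη₂ y hyU hy u v hu hv) y hy
  set φ : OpenPartialHomeomorph (CSpace n) X :=
    Λ.toHomeomorph.toOpenPartialHomeomorph ≫ₕ e ≫ₕ ψ
  have hφe : ∀ z ∈ φ.source, Λ z ∈ e.source := fun z hz ↦ hz.2.1
  have hφψ : ∀ z ∈ φ.source, e (Λ z) ∈ ψ.source := fun z hz ↦ hz.2.2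
  have heM : ContMDiffOn 𝓘(ℝ, ℝN × ℝN) 𝓘(ℝ, ℝN × ℝN) ∞ e e.source :=
    contMDiffOn_iff_contDiffOn.2 hes
  have heM' : ContMDiffOn 𝓘(ℝ, ℝN × ℝN) 𝓘(ℝ, ℝN × ℝN) ∞ e.symm e.target :=
    contMDiffOn_iff_contDiffOn.2 hest
  have hΛM : ContMDiff 𝓘(ℝ, CSpace n) 𝓘(ℝ, ℝN × ℝN) ∞ Λ := Λ.contDiff.contMDiff
  have hΛM' : ContMDiff 𝓘(ℝ, ℝN × ℝN) 𝓘(ℝ, CSpace n) ∞ Λ.symm := Λ.symm.contDiff.contMDiff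
  refine ⟨φ, ⟨mem_univ _, ?_⟩, ?_, ?_, ?_, ?_, ?_, ?_⟩
  · change Λ 0 ∈ e.source ∩ e ⁻¹' ψ.source
    rw [map_zero]
    exact ⟨h0e, by rw [mem_preimage, he0]; exact h0ψ⟩
  · change ψ (e (Λ 0)) = x
    rw [map_zero, he0, hψ0]
  · have h1 : ContMDiffOn 𝓘(ℝ, CSpace n) 𝓘(ℝ, ℝN × ℝN) ∞ (fun z ↦ e (Λ z)) φ.source :=
      heM.comp hΛM.contMDiffOn hφe
    exact hψc.comp h1 hφψ
  · have h1 : ContMDiffOn (𝓡 (2 * n)) 𝓘(ℝ, ℝN × ℝN) ∞ (fun z ↦ e.symm (ψ.symm z)) φ.target :=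
      heM'.comp (hψc'.mono fun z hz ↦ hz.1.1) fun z hz ↦ hz.1.2
    exact hΛM'.comp_contMDiffOn h1
  · intro z hz u v
    have hed : DifferentiableAt ℝ e (Λ z) :=
      (hes.contDiffAt (e.open_source.mem_nhds (hφe z hz))).differentiableAt (by simp)
    have hφd : (mfderiv 𝓘(ℝ, CSpace n) (𝓡 (2 * n)) φ z : CSpace n →L[ℝ] ℝM) =
        (mfderiv 𝓘(ℝ, ℝN × ℝN) (𝓡 (2 * n)) ψ (e (Λ z)) : ℝN × ℝN →L[ℝ] ℝM) ∘L
          (fderiv ℝ e (Λ z) ∘L (Λ : CSpace n →L[ℝ] ℝN × ℝN)) := by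
      have h1 : HasMFDerivAt 𝓘(ℝ, CSpace n) 𝓘(ℝ, ℝN × ℝN) (fun z ↦ e (Λ z)) z
          (fderiv ℝ e (Λ z) ∘L (Λ : CSpace n →L[ℝ] ℝN × ℝN)) :=
        (hed.hasFDerivAt.comp z Λ.hasFDerivAt).hasMFDerivAt
      exact ((hψm.mdifferentiableAt (hφψ z hz)).hasMFDerivAt.comp z h1).mfderiv
    rw [hφd]
    exact ((hησ _ (hφψ z hz) _ _).symm.trans (hepull _ (hφe z hz) (Λ u) (Λ v))).trans (hΛ u v)
  · ext z
    refine and_congr_right fun hz ↦ ?_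
    refine (hmem₁ _ (hψT _ (hφψ z hz)).2.1).trans ?_
    change F₁ (ψ (e (Λ z))) = 0 ↔ _
    rw [hψ₁ _ (hφψ z hz), he₁ _ (hφe z hz), hΛ₁]
  · ext z
    refine and_congr_right fun hz ↦ ?_
    refine (hmem₂ _ (hψT _ (hφψ z hz)).2.2).trans ?_
    change F₂ (ψ (e (Λ z))) = 0 ↔ _
    rw [hψ₂ _ (hφψ z hz), he₂ _ (hφe z hz), hΛ₂]

end SymplecticChart

/-! ### Polar decomposition of symplectic forms -/

section Spectral

variable {V : Type*} [AddCommGroup V] [Module ℝ V] [FiniteDimensional ℝ V]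

/-- The inner product space structure of a symmetric positive definite bilinear form. -/
@[reducible]
def LinearMap.innerCore (g : V →ₗ[ℝ] V →ₗ[ℝ] ℝ) (hg : ∀ u v, g u v = g v u)
    (hpos : ∀ u, u ≠ 0 → 0 < g u u) : InnerProductSpace.Core ℝ V where
  inner u v := g u v
  conj_inner_symm u v := hg v u
  re_inner_nonneg u := by
    by_cases hu : u = 0
    · simp [hu]
    · exact (hpos u hu).le
  add_left u v w := by simp
  smul_left u v r := by simp
  definite u hu := by
    by_contra h
    exact (hpos u h).ne' hu

/-- The spectral theorem for the inner product `g`, installed as a local instance. -/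
theorem exists_eigenbasis (g : V →ₗ[ℝ] V →ₗ[ℝ] ℝ) (hg : ∀ u v, g u v = g v u)
    (hpos : ∀ u, u ≠ 0 → 0 < g u u) (T : V →ₗ[ℝ] V) (hT : ∀ u v, g u (T v) = g (T u) v)
    (hTpos : ∀ u, u ≠ 0 → 0 < g u (T u)) :
    ∃ (b : Module.Basis (Fin (Module.finrank ℝ V)) ℝ V) (μ : Fin (Module.finrank ℝ V) → ℝ),
      ∀ i, 0 < μ i ∧ T (b i) = μ i • b i := by
  let _ := (LinearMap.innerCore g hg hpos).toNormedAddCommGroup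
  let _ : InnerProductSpace ℝ V := InnerProductSpace.ofCore (LinearMap.innerCore g hg hpos).toCore
  have hsymm : T.IsSymmetric := fun u v ↦ (hT u v).symm
  have heig : ∀ i, T (hsymm.eigenvectorBasis rfl i) =
      hsymm.eigenvalues rfl i • hsymm.eigenvectorBasis rfl i := fun i ↦
    hsymm.apply_eigenvectorBasis rfl i
  refine ⟨(hsymm.eigenvectorBasis rfl).toBasis, hsymm.eigenvalues rfl, fun i ↦ ⟨?_, ?_⟩⟩
  · have hne : hsymm.eigenvectorBasis rfl i ≠ 0 :=
      (hsymm.eigenvectorBasis rfl).orthonormal.ne_zero i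
    have h1 := hTpos _ hne
    rw [heig, map_smul, smul_eq_mul] at h1
    exact pos_of_mul_pos_left h1 (hpos _ hne).le
  · simp [heig]

/-- A Sylvester equation with positive coefficients has only the trivial solution. -/
theorem eq_zero_of_sylvester (g : V →ₗ[ℝ] V →ₗ[ℝ] ℝ) (hg : ∀ u v, g u v = g v u)
    (hpos : ∀ u, u ≠ 0 → 0 < g u u) {S S' H : V →ₗ[ℝ] V}
    (hS : ∀ u, u ≠ 0 → 0 < g u (S u)) (hS' : ∀ u v, g u (S' v) = g (S' u) v)
    (hS'pos : ∀ u, u ≠ 0 → 0 < g u (S' u)) (h : ∀ u, S (H u) + H (S' u) = 0) : H = 0 := by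
  obtain ⟨b, μ, hb⟩ := exists_eigenbasis g hg hpos S' hS' hS'pos
  refine b.ext fun i ↦ ?_
  by_contra hne
  -- On an eigenvector `b i` of `S'`, the equation reads `S (H (b i)) = -μ i • H (b i)`, against the
  -- positivity of `S`.
  have h1 := h (b i)
  rw [(hb i).2, map_smul] at h1
  have h2 := hS _ hne
  rw [eq_neg_of_add_eq_zero_left h1, map_neg, map_smul, smul_eq_mul] at h2
  nlinarith [hpos _ hne, mul_pos (hb i).1 (hpos _ hne)]

theorem exists_sqrt (g : V →ₗ[ℝ] V →ₗ[ℝ] ℝ) (hg : ∀ u v, g u v = g v u)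
    (hpos : ∀ u, u ≠ 0 → 0 < g u u) (T : V →ₗ[ℝ] V) (hT : ∀ u v, g u (T v) = g (T u) v)
    (hTpos : ∀ u, u ≠ 0 → 0 < g u (T u)) :
    ∃ S : V →ₗ[ℝ] V, (∀ u, S (S u) = T u) ∧ (∀ u v, g u (S v) = g (S u) v) ∧
      ∀ u, u ≠ 0 → 0 < g u (S u) := by
  let _ := (LinearMap.innerCore g hg hpos).toNormedAddCommGroup
  let _ : InnerProductSpace ℝ V := InnerProductSpace.ofCore (LinearMap.innerCore g hg hpos).toCore
  have hsymm : T.IsSymmetric := fun u v ↦ (hT u v).symm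
  set b := hsymm.eigenvectorBasis rfl
  have hb : ∀ i, T (b i) = hsymm.eigenvalues rfl i • b i := fun i ↦
    hsymm.apply_eigenvectorBasis rfl i
  have hμ : ∀ i, 0 < hsymm.eigenvalues rfl i := fun i ↦ by
    have hne : b i ≠ 0 := by simpa using b.toBasis.ne_zero i
    have h1 := hTpos _ hne
    rw [hb, map_smul, smul_eq_mul] at h1
    exact pos_of_mul_pos_left h1 (hpos _ hne).le
  set s : Fin (Module.finrank ℝ V) → ℝ := fun i ↦ √(hsymm.eigenvalues rfl i)
  have hs : ∀ i, 0 < s i := fun i ↦ Real.sqrt_pos.2 (hμ i)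
  set S : V →ₗ[ℝ] V := b.toBasis.constr ℝ fun i ↦ s i • b i
  have hSb : ∀ i, S (b i) = s i • b i := fun i ↦ by
    have := b.toBasis.constr_basis ℝ (fun i ↦ s i • b i) i
    rwa [b.coe_toBasis] at this
  have hgS : ∀ u v, g u (S v) = ∑ i, s i * (inner ℝ (b i) u * inner ℝ (b i) v) := by
    intro u v
    conv_lhs => rw [← b.sum_repr' v]
    simp only [map_sum, map_smul, hSb, smul_eq_mul]
    refine Finset.sum_congr rfl fun i _ ↦ ?_
    have : g u (b i) = inner ℝ (b i) u := hg u (b i)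
    rw [this]
    ring
  refine ⟨S, fun u ↦ ?_, fun u v ↦ ?_, fun u hu ↦ ?_⟩
  · have : S ∘ₗ S = T := b.toBasis.ext fun i ↦ by
      simp only [b.coe_toBasis, LinearMap.comp_apply, hSb, map_smul, hb, smul_smul, s,
        Real.mul_self_sqrt (hμ i).le]
    exact LinearMap.congr_fun this u
  · rw [hg (S u) v, hgS, hgS]
    exact Finset.sum_congr rfl fun i _ ↦ by ring
  · rw [hgS]
    refine lt_of_le_of_ne (Finset.sum_nonneg fun i _ ↦
      mul_nonneg (hs i).le (mul_self_nonneg _)) fun h0 ↦ hu ?_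
    have h1 := (Finset.sum_eq_zero_iff_of_nonneg fun i _ ↦
      mul_nonneg (hs i).le (mul_self_nonneg _)).1 h0.symm
    rw [← b.sum_repr' u]
    refine Finset.sum_eq_zero fun i hi ↦ ?_
    have h2 := (mul_eq_zero.1 (h1 i hi)).resolve_left (hs i).ne'
    rw [mul_self_eq_zero.1 h2, zero_smul]

end Spectral

/-! ### Uniqueness of the polar complex structure and its construction from a square root. -/

section Polar

variable {V : Type*} [NormedAddCommGroup V] [NormedSpace ℝ V]

/-- `J` is the complex structure compatible with `η` and orthogonal for `g`. -/
structure IsPolar (g η : V →L[ℝ] V →L[ℝ] ℝ) (J : V →L[ℝ] V) : Prop where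
  sq : ∀ u, J (J u) = -u
  metric : ∀ u v, g (J u) (J v) = g u v
  symplectic : ∀ u v, η (J u) (J v) = η u v
  pos : ∀ u, u ≠ 0 → 0 < η u (J u)

/-- The bilinear form underlying a continuous bilinear form. -/
def ContinuousLinearMap.toLin₂ (g : V →L[ℝ] V →L[ℝ] ℝ) : V →ₗ[ℝ] V →ₗ[ℝ] ℝ :=
  LinearMap.mk₂ ℝ (fun u v ↦ g u v) (by simp) (by simp) (by simp) (by simp)

@[simp]
theorem ContinuousLinearMap.toLin₂_apply (g : V →L[ℝ] V →L[ℝ] ℝ) (u v : V) :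
    g.toLin₂ u v = g u v := rfl

variable [FiniteDimensional ℝ V]

theorem exists_metric_endomorphism {g : V →L[ℝ] V →L[ℝ] ℝ} (hpos : ∀ u, u ≠ 0 → 0 < g u u)
    (η : V →L[ℝ] V →L[ℝ] ℝ) : g.IsInvertible ∧ ∀ v w, g (g.inverse (η v)) w = η v w := by
  have hinv : g.IsInvertible := ContinuousLinearMap.isInvertible_of_nondegenerate fun u hu ↦ by
    by_contra h
    exact (hpos u h).ne' (hu u)
  refine ⟨hinv, fun v w ↦ ?_⟩
  obtain ⟨e, rfl⟩ := hinv
  simp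

/-- A polar `J` commutes with `A`, and `A J` is a positive `g`-symmetric square root of `-A²`. Two
such roots `S`, `S'` satisfy `S (S - S') + (S - S') S' = S² - S'² = 0`, so they agree by the
Sylvester lemma, and `A` is injective. -/
theorem IsPolar.unique {g η : V →L[ℝ] V →L[ℝ] ℝ} (hg : ∀ u v, g u v = g v u)
    (hpos : ∀ u, u ≠ 0 → 0 < g u u) (hη : ∀ u v, η u v = -η v u) {J J' : V →L[ℝ] V}
    (hJ : IsPolar g η J) (hJ' : IsPolar g η J') : J = J' := by
  obtain ⟨-, hA⟩ := exists_metric_endomorphism hpos η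
  set A : V →L[ℝ] V := -(g.inverse ∘L η)
  have hgA : ∀ u v, g u (A v) = η u v := fun u v ↦ by
    rw [hg, hη u v, ← hA v u]
    simp [A]
  have hinj : ∀ u v, (∀ w, g w u = g w v) → u = v := fun u v h ↦ by
    by_contra hne
    have := hpos (u - v) (sub_ne_zero.2 hne)
    rw [map_sub (g (u - v)), h, sub_self] at this
    exact this.false
  have hAinj : ∀ u, A u = 0 → u = 0 := fun u hu ↦ by
    by_contra hne
    have h1 := hJ.pos u hne
    rw [hη, ← hgA, hu, map_zero, neg_zero] at h1
    exact h1.false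
  have key : ∀ {J : V →L[ℝ] V}, IsPolar g η J → (∀ v, A (J v) = J (A v)) ∧
      (∀ u v, g u (A (J v)) = g (A (J u)) v) ∧ ∀ u, u ≠ 0 → 0 < g u (A (J u)) := by
    intro J hJ
    have hηJ : ∀ u v, η u (J v) = -η (J u) v := fun u v ↦ by
      rw [← hJ.symplectic u (J v), hJ.sq, map_neg]
    have hgJ : ∀ u v, g u (J v) = -g (J u) v := fun u v ↦ by
      rw [← hJ.metric u (J v), hJ.sq, map_neg]
    refine ⟨fun v ↦ hinj _ _ fun w ↦ ?_, fun u v ↦ ?_, fun u hu ↦ ?_⟩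
    · rw [hgA, hηJ, hgJ, hgA]
    · rw [hg (A (J u)), hgA, hgA, hηJ, hη v]
    · rw [hgA]
      exact hJ.pos u hu
  obtain ⟨hc, -, hp⟩ := key hJ
  obtain ⟨hc', hs', hp'⟩ := key hJ'
  have h0 := eq_zero_of_sylvester g.toLin₂ hg hpos (S := (A ∘L J : V →L[ℝ] V))
    (S' := (A ∘L J' : V →L[ℝ] V)) (H := (A ∘L (J - J') : V →L[ℝ] V)) hp hs' hp' fun u ↦ by
      simp only [hc, hc', hJ.sq, hJ'.sq, ContinuousLinearMap.coe_coe,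
        ContinuousLinearMap.comp_apply, _root_.sub_apply, map_sub, map_neg]
      abel
  ext u
  exact sub_eq_zero.1 (hAinj _ (LinearMap.congr_fun h0 u))

/-- Here `J = A⁻¹ R = R A⁻¹`, whence `J² = A⁻² R² = -1`. Skewness of `A` and symmetry of `R` make
`J` skew for `g`, hence orthogonal. -/
theorem isPolar_of_sqrt {g η : V →L[ℝ] V →L[ℝ] ℝ} {A R J : V →L[ℝ] V}
    (hg : ∀ u v, g u v = g v u) (hη : ∀ u v, η u v = -η v u)
    (hgA : ∀ u v, g u (A v) = η u v) (hAinj : ∀ u, A u = 0 → u = 0)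
    (hAR : ∀ u, A (R u) = R (A u)) (hRR : ∀ u, R (R u) = -A (A u))
    (hR : ∀ u v, g u (R v) = g (R u) v) (hAJ : ∀ u, A (J u) = R u)
    (hpos : ∀ u, u ≠ 0 → 0 < η u (J u)) : IsPolar g η J := by
  have hinj : Function.Injective (A : V →ₗ[ℝ] V) := (injective_iff_map_eq_zero _).2 hAinj
  have hsurj := LinearMap.injective_iff_surjective.1 hinj
  have hJA : ∀ u, J (A u) = R u := fun u ↦ hinj (by
    change A (J (A u)) = A (R u)
    rw [hAJ, hAR])
  have hsq : ∀ u, J (J u) = -u := fun u ↦ hinj (hinj (by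
    change A (A (J (J u))) = A (A (-u))
    rw [hAJ, hAR, hAJ, hRR, map_neg, map_neg]))
  have hA : ∀ u v, g (A u) v = -g u (A v) := fun u v ↦ by
    rw [hg, hgA, hη, hgA]
  have hgJ : ∀ u v, g (J u) v = -g u (J v) := by
    intro u v
    obtain ⟨w, rfl⟩ := hsurj v
    change g (J u) (A w) = -g u (J (A w))
    rw [hJA, hR, ← hAJ, hA, neg_neg]
  have hm : ∀ u v, g (J u) (J v) = g u v := fun u v ↦ by rw [hgJ, hsq, map_neg, neg_neg]
  refine ⟨hsq, hm, fun u v ↦ ?_, hpos⟩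
  rw [← hgA, ← hgA, hAJ, ← hJA, hm]

/-- By compactness of the unit sphere `b u u ≥ c ‖u‖²` with `c > 0`, and the ball of radius `c`
around `b` keeps positivity. -/
theorem eventually_posDef {b : V →L[ℝ] V →L[ℝ] ℝ} (hb : ∀ u, u ≠ 0 → 0 < b u u) :
    ∀ᶠ b' : V →L[ℝ] V →L[ℝ] ℝ in 𝓝 b, ∀ u, u ≠ 0 → 0 < b' u u := by
  have hc : Continuous fun u ↦ b u u := by fun_prop
  obtain ⟨c, hc0, hcb⟩ : ∃ c > 0, ∀ u, ‖u‖ = 1 → c ≤ b u u := by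
    -- The sphere is empty when `V` is trivial; any positive constant then serves.
    rcases (Metric.sphere (0 : V) 1).eq_empty_or_nonempty with he | hne
    · refine ⟨1, one_pos, fun u hu ↦ ?_⟩
      have : u ∈ Metric.sphere (0 : V) 1 := by simpa using hu
      simp [he] at this
    · obtain ⟨u₀, hu₀, hmin⟩ := (isCompact_sphere (0 : V) 1).exists_isMinOn hne hc.continuousOn
      refine ⟨b u₀ u₀, hb u₀ ?_, fun u hu ↦ hmin (by simpa using hu)⟩
      rintro rfl
      simp at hu₀
  filter_upwards [Metric.ball_mem_nhds b hc0] with b' hb' u hu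
  have hn : 0 < ‖u‖ := norm_pos_iff.2 hu
  have h1 := hcb (‖u‖⁻¹ • u) (by rw [norm_smul, norm_inv, norm_norm, inv_mul_cancel₀ hn.ne'])
  simp only [map_smul, _root_.smul_apply, smul_eq_mul] at h1
  have h2 : c * (‖u‖ * ‖u‖) ≤ b u u := by
    have := mul_le_mul_of_nonneg_right h1 (mul_nonneg hn.le hn.le)
    refine this.trans_eq ?_
    field_simp
  have h3 : |(b' - b) u u| ≤ ‖b' - b‖ * ‖u‖ * ‖u‖ := (b' - b).le_opNorm₂ u u
  have h4 : ‖b' - b‖ < c := by rwa [mem_ball_iff_norm] at hb'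
  have h5 := (abs_le.1 h3).1
  simp only [_root_.sub_apply] at h5
  have h6 : ‖b' - b‖ * ‖u‖ * ‖u‖ < c * (‖u‖ * ‖u‖) := by
    rw [mul_assoc]
    exact mul_lt_mul_of_pos_right h4 (mul_pos hn hn)
  linarith

end Polar

/-! ### Smoothness of the polar decomposition -/

section SmoothPolar

variable {V : Type*} [NormedAddCommGroup V] [NormedSpace ℝ V]

/-- The adjoint of `R` for the bilinear form `g`. -/
def bilinAdjoint (g : V →L[ℝ] V →L[ℝ] ℝ) (R : V →L[ℝ] V) : V →L[ℝ] V :=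
  g.inverse ∘L ((ContinuousLinearMap.compL ℝ V V ℝ).flip R ∘L g)

theorem bilinAdjoint_apply {g : V →L[ℝ] V →L[ℝ] ℝ} (hg : g.IsInvertible) (R : V →L[ℝ] V)
    (u v : V) : g (bilinAdjoint g R u) v = g u (R v) := by
  obtain ⟨e, rfl⟩ := hg
  simp [bilinAdjoint]

theorem contDiffAt_inverse_of_isInvertible {W : Type*} [NormedAddCommGroup W] [NormedSpace ℝ W]
    [CompleteSpace W] {f : W →L[ℝ] V} (hf : f.IsInvertible) :
    ContDiffAt ℝ ∞ (ContinuousLinearMap.inverse : (W →L[ℝ] V) → V →L[ℝ] W) f := by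
  obtain ⟨e, rfl⟩ := hf
  exact contDiffAt_map_inverse e

variable [FiniteDimensional ℝ V]

/-- The derivative of squaring at `S` is `H ↦ S H + H S`, injective by the Sylvester lemma, so
squaring is a local diffeomorphism near `S`. -/
theorem exists_local_sqrt {g : V →L[ℝ] V →L[ℝ] ℝ} (hg : ∀ u v, g u v = g v u)
    (hpos : ∀ u, u ≠ 0 → 0 < g u u) {S : V →L[ℝ] V} (hS : ∀ u v, g u (S v) = g (S u) v)
    (hSpos : ∀ u, u ≠ 0 → 0 < g u (S u)) :
    ∃ e : OpenPartialHomeomorph (V →L[ℝ] V) (V →L[ℝ] V), (∀ R, e R = R ∘L R) ∧ S ∈ e.source ∧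
      ContDiffOn ℝ ∞ e.symm e.target := by
  have := FiniteDimensional.complete ℝ V
  set C := ContinuousLinearMap.compL ℝ V V V
  have hsmooth : ContDiff ℝ ∞ fun R : V →L[ℝ] V ↦ R ∘L R := contDiff_id.clm_comp contDiff_id
  have hd : HasFDerivAt (fun R : V →L[ℝ] V ↦ R ∘L R) (C S + C.flip S) S := by
    have := (hasFDerivAt_id S).clm_comp (hasFDerivAt_id S)
    exact this
  have hinj : Function.Injective (C S + C.flip S : (V →L[ℝ] V) →ₗ[ℝ] V →L[ℝ] V) := by
    refine (injective_iff_map_eq_zero _).2 fun H hH ↦ ?_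
    have h0 := eq_zero_of_sylvester g.toLin₂ hg hpos (S := (S : V →ₗ[ℝ] V)) (S' := (S : V →ₗ[ℝ] V))
      (H := (H : V →ₗ[ℝ] V)) hSpos hS hSpos
      fun u ↦ congrArg (fun T : V →L[ℝ] V ↦ T u) hH
    ext u
    exact LinearMap.congr_fun h0 u
  set D : (V →L[ℝ] V) ≃L[ℝ] (V →L[ℝ] V) :=
    (LinearEquiv.ofInjectiveEndo _ hinj).toContinuousLinearEquiv
  obtain ⟨e, he, hSe, -, -, hes⟩ := exists_openPartialHomeomorph_of_contDiffOn isOpen_univ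
    hsmooth.contDiffOn (mem_univ S) D hd
  exact ⟨e, fun R ↦ by rw [he], hSe, hes⟩

/-- Both `A R A⁻¹` and the `g`-adjoint of `R` are again square roots of `-A²`. Squaring is injective
on `e.source`, so both equal `R`: hence `R` commutes with `A` and is symmetric, without
diagonalizing `A²` at the varying parameter. -/
theorem isPolar_inverse_comp_sqrt {e : OpenPartialHomeomorph (V →L[ℝ] V) (V →L[ℝ] V)}
    (he : ∀ R, e R = R ∘L R) {g η : V →L[ℝ] V →L[ℝ] ℝ} {A : V →L[ℝ] V}
    (hg : ∀ u v, g u v = g v u) (hη : ∀ u v, η u v = -η v u) (hginv : g.IsInvertible)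
    (hgA : ∀ u v, g u (A v) = η u v) (hAinv : A.IsInvertible) (ht : -(A ∘L A) ∈ e.target)
    (hconj : A ∘L (e.symm (-(A ∘L A)) ∘L A.inverse) ∈ e.source)
    (hadj : bilinAdjoint g (e.symm (-(A ∘L A))) ∈ e.source)
    (hpos : ∀ u, u ≠ 0 → 0 < (η.flip ∘L (A.inverse ∘L e.symm (-(A ∘L A)))) u u) :
    IsPolar g η (A.inverse ∘L e.symm (-(A ∘L A))) := by
  set R := e.symm (-(A ∘L A))
  have hA : ∀ u v, g (A u) v = -g u (A v) := fun u v ↦ by rw [hg, hgA, hη, hgA]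
  have hRe : R ∈ e.source := e.map_target ht
  have heR : e R = -(A ∘L A) := e.right_inv ht
  have hRR : ∀ u, R (R u) = -A (A u) := fun u ↦ by
    rw [he] at heR
    exact congrArg (fun T : V →L[ℝ] V ↦ T u) heR
  have hAi : ∀ u, A (A.inverse u) = u := fun u ↦ by
    obtain ⟨a, ha⟩ := hAinv
    simp [← ha]
  have hAi' : ∀ u, A.inverse (A u) = u := fun u ↦ by
    obtain ⟨a, ha⟩ := hAinv
    simp [← ha]
  have hginj : ∀ u v, (∀ w, g u w = g v w) → u = v := fun u v h ↦ by
    obtain ⟨b, hb⟩ := hginv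
    apply b.injective
    ext w
    have := h w
    rw [← hb] at this
    exact this
  have hconj : A ∘L (R ∘L A.inverse) = R := by
    refine e.injOn hconj hRe ?_
    rw [heR, he]
    ext u
    simp [hAi', hRR, hAi]
  have hadj : bilinAdjoint g R = R := by
    refine e.injOn hadj hRe ?_
    rw [heR, he]
    ext u
    refine hginj _ _ fun w ↦ ?_
    change g (bilinAdjoint g R (bilinAdjoint g R u)) w = g (-A (A u)) w
    rw [bilinAdjoint_apply hginv, bilinAdjoint_apply hginv, hRR, map_neg, map_neg,
      _root_.neg_apply, hA, ← hA u]
    simp [hA]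
  refine isPolar_of_sqrt (A := A) (R := R) hg hη hgA (fun u hu ↦ ?_) (fun u ↦ ?_) hRR
    (fun u v ↦ ?_) (fun u ↦ hAi _) hpos
  · rw [← hAi' u, hu, map_zero]
  · have := congrArg (fun T : V →L[ℝ] V ↦ T (A u)) hconj
    simpa [hAi'] using this
  · rw [← bilinAdjoint_apply hginv, hadj]

/-- The spectral theorem supplies the square root at `(g₀, η₀)` only; nearby it is continued by the
smooth local inverse of squaring. The conditions of `isPolar_inverse_comp_sqrt` other than symmetry
of `g` and antisymmetry of `η` are open and hold at `(g₀, η₀)`. -/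
theorem exists_smooth_polar {g₀ η₀ : V →L[ℝ] V →L[ℝ] ℝ} (hg₀ : ∀ u v, g₀ u v = g₀ v u)
    (hpos₀ : ∀ u, u ≠ 0 → 0 < g₀ u u) (hη₀ : ∀ u v, η₀ u v = -η₀ v u)
    (hnd₀ : ∀ u, (∀ v, η₀ u v = 0) → u = 0) :
    ∃ Ψ : (V →L[ℝ] V →L[ℝ] ℝ) × (V →L[ℝ] V →L[ℝ] ℝ) → V →L[ℝ] V, ContDiffAt ℝ ∞ Ψ (g₀, η₀) ∧
      ∀ᶠ p in 𝓝 (g₀, η₀), (∀ u v, p.1 u v = p.1 v u) → (∀ u v, p.2 u v = -p.2 v u) →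
        IsPolar p.1 p.2 (Ψ p) := by
  have := FiniteDimensional.complete ℝ V
  obtain ⟨hinv₀, -⟩ := exists_metric_endomorphism hpos₀ η₀
  set 𝒜 : (V →L[ℝ] V →L[ℝ] ℝ) × (V →L[ℝ] V →L[ℝ] ℝ) → V →L[ℝ] V :=
    fun p ↦ -(p.1.inverse ∘L p.2)
  have h𝒜 : ContDiffAt ℝ ∞ 𝒜 (g₀, η₀) :=
    (((contDiffAt_inverse_of_isInvertible hinv₀).comp (g₀, η₀) contDiffAt_fst).clm_comp
      contDiffAt_snd).neg
  have hgA : ∀ p : (V →L[ℝ] V →L[ℝ] ℝ) × (V →L[ℝ] V →L[ℝ] ℝ), p.1.IsInvertible →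
      (∀ u v, p.1 u v = p.1 v u) → (∀ u v, p.2 u v = -p.2 v u) →
      ∀ u v, p.1 u (𝒜 p v) = p.2 u v := by
    rintro ⟨g, η⟩ ⟨e, he⟩ hg hη u v
    simp only at he hg hη ⊢
    rw [hg, hη u v]
    subst he
    simp [𝒜]
  set A₀ := 𝒜 (g₀, η₀)
  have hgA₀ : ∀ u v, g₀ u (A₀ v) = η₀ u v := hgA (g₀, η₀) hinv₀ hg₀ hη₀
  have hA₀ : ∀ u v, g₀ (A₀ u) v = -g₀ u (A₀ v) := fun u v ↦ by rw [hg₀, hgA₀, hη₀, hgA₀]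
  have hA₀inj : ∀ u, A₀ u = 0 → u = 0 := fun u hu ↦ hnd₀ u fun v ↦ by
    rw [hη₀, ← hgA₀, hu, map_zero, neg_zero]
  have hA₀inv : A₀.IsInvertible :=
    ⟨(LinearEquiv.ofInjectiveEndo (A₀ : V →ₗ[ℝ] V)
      ((injective_iff_map_eq_zero _).2 hA₀inj)).toContinuousLinearEquiv, by ext; rfl⟩
  obtain ⟨S', hSS, hS, hSpos⟩ := exists_sqrt g₀.toLin₂ hg₀ hpos₀
    (-(A₀ ∘L A₀ : V →L[ℝ] V) : V →L[ℝ] V)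
    (fun u v ↦ by simp [hA₀]) (fun u hu ↦ by
      have := hpos₀ (A₀ u) fun h ↦ hu (hA₀inj u h)
      rw [hA₀] at this
      simpa using this)
  set S : V →L[ℝ] V := LinearMap.toContinuousLinearMap S'
  have hSS : ∀ u, S (S u) = -A₀ (A₀ u) := hSS
  have hS : ∀ u v, g₀ u (S v) = g₀ (S u) v := hS
  have hSpos : ∀ u, u ≠ 0 → 0 < g₀ u (S u) := hSpos
  -- The commutator `H = A₀ S - S A₀` satisfies `S H + H S = A₀ S² - S² A₀ = 0`.
  have hcomm : ∀ u, A₀ (S u) = S (A₀ u) := by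
    have h0 := eq_zero_of_sylvester g₀.toLin₂ hg₀ hpos₀ (S := (S : V →ₗ[ℝ] V))
      (S' := (S : V →ₗ[ℝ] V)) (H := (A₀ ∘L S - S ∘L A₀ : V →L[ℝ] V)) hSpos hS hSpos fun u ↦ by
        simp only [hSS, ContinuousLinearMap.coe_coe, ContinuousLinearMap.comp_apply,
          _root_.sub_apply, map_sub, map_neg]
        abel
    exact fun u ↦ sub_eq_zero.1 (LinearMap.congr_fun h0 u)
  obtain ⟨e, he, hSe, hes⟩ := exists_local_sqrt hg₀ hpos₀ hS hSpos
  have heS : e S = -(A₀ ∘L A₀) := by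
    rw [he]
    ext u
    exact hSS u
  set 𝒬 : (V →L[ℝ] V →L[ℝ] ℝ) × (V →L[ℝ] V →L[ℝ] ℝ) → V →L[ℝ] V :=
    fun p ↦ -(𝒜 p ∘L 𝒜 p)
  have h𝒬 : ContDiffAt ℝ ∞ 𝒬 (g₀, η₀) := (h𝒜.clm_comp h𝒜).neg
  have h𝒬₀ : 𝒬 (g₀, η₀) = e S := heS.symm
  have h𝒬t : 𝒬 (g₀, η₀) ∈ e.target := by
    rw [h𝒬₀]
    exact e.map_source hSe
  have hR : ContDiffAt ℝ ∞ (fun p ↦ e.symm (𝒬 p)) (g₀, η₀) :=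
    (hes.contDiffAt (e.open_target.mem_nhds h𝒬t)).comp (g₀, η₀) h𝒬
  have hR₀ : e.symm (𝒬 (g₀, η₀)) = S := by rw [h𝒬₀, e.left_inv hSe]
  set Ψ : (V →L[ℝ] V →L[ℝ] ℝ) × (V →L[ℝ] V →L[ℝ] ℝ) → V →L[ℝ] V :=
    fun p ↦ (𝒜 p).inverse ∘L e.symm (𝒬 p)
  have hI : ContDiffAt ℝ ∞ (fun p ↦ (𝒜 p).inverse) (g₀, η₀) :=
    ContDiffAt.comp (g := ContinuousLinearMap.inverse) (f := 𝒜) (g₀, η₀)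
      (contDiffAt_inverse_of_isInvertible hA₀inv) h𝒜
  have hΨ : ContDiffAt ℝ ∞ Ψ (g₀, η₀) := hI.clm_comp hR
  have hopen : ∀ {f : V →L[ℝ] V}, f.IsInvertible → ∀ᶠ f' in 𝓝 f, f'.IsInvertible := by
    rintro _ ⟨a, rfl⟩
    exact a.nhds
  have hopen' : ∀ᶠ f' in 𝓝 g₀, f'.IsInvertible := by
    obtain ⟨a, ha⟩ := hinv₀
    rw [← ha]
    exact a.nhds
  have ev1 : ∀ᶠ p in 𝓝 (g₀, η₀), p.1.IsInvertible := continuousAt_fst.eventually hopen'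
  have ev2 : ∀ᶠ p in 𝓝 (g₀, η₀), (𝒜 p).IsInvertible := h𝒜.continuousAt.eventually (hopen hA₀inv)
  have ev3 : ∀ᶠ p in 𝓝 (g₀, η₀), 𝒬 p ∈ e.target :=
    h𝒬.continuousAt.eventually (e.open_target.mem_nhds h𝒬t)
  have ev4 : ∀ᶠ p in 𝓝 (g₀, η₀),
      𝒜 p ∘L (e.symm (𝒬 p) ∘L (𝒜 p).inverse) ∈ e.source := by
    have hc : ContinuousAt (fun p ↦ 𝒜 p ∘L (e.symm (𝒬 p) ∘L (𝒜 p).inverse)) (g₀, η₀) :=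
      (h𝒜.clm_comp (hR.clm_comp hI)).continuousAt
    refine hc.eventually (e.open_source.mem_nhds ?_)
    have : A₀ ∘L (S ∘L A₀.inverse) = S := by
      obtain ⟨a, ha⟩ := hA₀inv
      rw [← ha] at hcomm ⊢
      ext u
      have := hcomm (a.symm u)
      simpa using this
    change A₀ ∘L (e.symm (𝒬 (g₀, η₀)) ∘L A₀.inverse) ∈ e.source
    rw [hR₀, this]
    exact hSe
  have ev5 : ∀ᶠ p in 𝓝 (g₀, η₀), bilinAdjoint p.1 (e.symm (𝒬 p)) ∈ e.source := by
    have hc : ContinuousAt (fun p : (V →L[ℝ] V →L[ℝ] ℝ) × (V →L[ℝ] V →L[ℝ] ℝ) ↦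
        bilinAdjoint p.1 (e.symm (𝒬 p))) (g₀, η₀) := by
      have h1 : ContDiffAt ℝ ∞ (fun p ↦ (ContinuousLinearMap.compL ℝ V V ℝ).flip
          (e.symm (𝒬 p))) (g₀, η₀) := contDiffAt_const.clm_apply hR
      exact (((contDiffAt_inverse_of_isInvertible hinv₀).comp (g₀, η₀) contDiffAt_fst).clm_comp
        (h1.clm_comp contDiffAt_fst)).continuousAt
    refine hc.eventually (e.open_source.mem_nhds ?_)
    have : bilinAdjoint g₀ S = S := by
      ext u
      by_contra hne
      have h1 := hpos₀ (bilinAdjoint g₀ S u - S u) (sub_ne_zero.2 hne)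
      rw [map_sub g₀, _root_.sub_apply, bilinAdjoint_apply hinv₀, hS, sub_self] at h1
      exact h1.false
    change bilinAdjoint g₀ (e.symm (𝒬 (g₀, η₀))) ∈ e.source
    rw [hR₀, this]
    exact hSe
  have ev6 : ∀ᶠ p in 𝓝 (g₀, η₀), ∀ u, u ≠ 0 → 0 < (p.2.flip ∘L Ψ p) u u := by
    have hc : ContinuousAt (fun p : (V →L[ℝ] V →L[ℝ] ℝ) × (V →L[ℝ] V →L[ℝ] ℝ) ↦
        p.2.flip ∘L Ψ p) (g₀, η₀) := by
      have h1 : ContDiffAt ℝ ∞ (fun p : (V →L[ℝ] V →L[ℝ] ℝ) × (V →L[ℝ] V →L[ℝ] ℝ) ↦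
          ContinuousLinearMap.flipₗᵢ ℝ V V ℝ p.2) (g₀, η₀) :=
        (ContinuousLinearMap.flipₗᵢ ℝ V V ℝ).contDiff.contDiffAt.comp (g₀, η₀) contDiffAt_snd
      exact (h1.clm_comp hΨ).continuousAt
    refine hc.eventually (eventually_posDef fun u hu ↦ ?_)
    change 0 < η₀ u (A₀.inverse (e.symm (𝒬 (g₀, η₀)) u))
    rw [hR₀, ← hgA₀]
    obtain ⟨a, ha⟩ := hA₀inv
    rw [← ha]
    simpa using hSpos u hu
  refine ⟨Ψ, hΨ, ?_⟩
  filter_upwards [ev1, ev2, ev3, ev4, ev5, ev6] with p h1 h2 h3 h4 h5 h6 hg hη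
  exact isPolar_inverse_comp_sqrt he hg hη h1 (hgA p h1 hg hη) h2 h3 h4 h5 h6

end SmoothPolar

/-! ### The almost complex structure of a Riemannian metric and a symplectic form -/

section Pullback₂

variable {V W : Type*} [NormedAddCommGroup V] [NormedSpace ℝ V] [NormedAddCommGroup W]
  [NormedSpace ℝ W]

/-- The pullback of a bilinear form under a linear map. -/
def ContinuousLinearMap.pullback₂ (b : W →L[ℝ] W →L[ℝ] ℝ) (T : V →L[ℝ] W) :
    V →L[ℝ] V →L[ℝ] ℝ :=
  (ContinuousLinearMap.compL ℝ V W ℝ).flip T ∘L (b ∘L T)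

@[simp]
theorem ContinuousLinearMap.pullback₂_apply (b : W →L[ℝ] W →L[ℝ] ℝ) (T : V →L[ℝ] W) (u v : V) :
    b.pullback₂ T u v = b (T u) (T v) := rfl

theorem contDiff_pullback₂ (b : W →L[ℝ] W →L[ℝ] ℝ) :
    ContDiff ℝ ∞ fun T : V →L[ℝ] W ↦ b.pullback₂ T :=
  (contDiff_const.clm_apply contDiff_id).clm_comp (contDiff_const.clm_comp contDiff_id)

theorem IsPolar.pullback₂ {g η : W →L[ℝ] W →L[ℝ] ℝ} {J : W →L[ℝ] W} (h : IsPolar g η J)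
    {T : V →L[ℝ] W} {T' : W →L[ℝ] V} (hT : ∀ u, T' (T u) = u) (hT' : ∀ u, T (T' u) = u) :
    IsPolar (g.pullback₂ T) (η.pullback₂ T) (T' ∘L (J ∘L T)) where
  sq u := by simp [hT, hT', h.sq]
  metric u v := by simp [hT', h.metric]
  symplectic u v := by simp [hT', h.symplectic]
  pos u hu := by
    simp only [ContinuousLinearMap.pullback₂_apply, ContinuousLinearMap.comp_apply, hT']
    exact h.pos _ fun h0 ↦ hu (by rw [← hT u, h0, map_zero])

end Pullback₂

section AlmostComplex

variable {E : Type*} [NormedAddCommGroup E] [NormedSpace ℝ E]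
  {X : Type*} [TopologicalSpace X] [ChartedSpace E X]

/-- The differential at `x` of the chart at `x₀`. -/
def chartDeriv (E : Type*) [NormedAddCommGroup E] [NormedSpace ℝ E] [ChartedSpace E X]
    (x₀ x : X) : E →L[ℝ] E := mfderiv 𝓘(ℝ, E) 𝓘(ℝ, E) (chartAt E x₀) x

/-- The differential at the image of `x` of the inverse of the chart at `x₀`. -/
def chartDerivSymm (E : Type*) [NormedAddCommGroup E] [NormedSpace ℝ E] [ChartedSpace E X]
    (x₀ x : X) : E →L[ℝ] E :=
  mfderiv 𝓘(ℝ, E) 𝓘(ℝ, E) (chartAt E x₀).symm (chartAt E x₀ x)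

theorem inCoordinates_tangentSpace [IsManifold 𝓘(ℝ, E) 1 X] {x₀ x : X}
    (hx : x ∈ (chartAt E x₀).source) (J : E →L[ℝ] E) :
    ContinuousLinearMap.inCoordinates E (TangentSpace 𝓘(ℝ, E)) E (TangentSpace 𝓘(ℝ, E))
      x₀ x x₀ x J = chartDeriv E x₀ x ∘L (J ∘L chartDerivSymm E x₀ x) := by
  have h1 := TangentBundle.continuousLinearMapAt_trivializationAt (I := 𝓘(ℝ, E)) hx
  have h2 := TangentBundle.symmL_trivializationAt (I := 𝓘(ℝ, E)) hx
  simp only [mfld_simps, mfderivWithin_univ] at h1 h2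
  unfold ContinuousLinearMap.inCoordinates
  rw [h1, h2]
  rfl

variable [IsManifold 𝓘(ℝ, E) ∞ X]

theorem chartDeriv_chartDerivSymm {x₀ x : X} (hx : x ∈ (chartAt E x₀).source) (u : E) :
    chartDeriv E x₀ x (chartDerivSymm E x₀ x u) = u := by
  have hm := OpenPartialHomeomorph.mdifferentiable_of_mem_maximalAtlas
    (IsManifold.chart_mem_maximalAtlas (I := 𝓘(ℝ, E)) (n := ∞) x₀)
  have h := hm.comp_symm_deriv ((chartAt E x₀).map_source hx)
  rw [(chartAt E x₀).left_inv hx] at h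
  exact congrArg (fun T : E →L[ℝ] E ↦ T u) h

theorem chartDerivSymm_chartDeriv {x₀ x : X} (hx : x ∈ (chartAt E x₀).source) (u : E) :
    chartDerivSymm E x₀ x (chartDeriv E x₀ x u) = u := by
  have hm := OpenPartialHomeomorph.mdifferentiable_of_mem_maximalAtlas
    (IsManifold.chart_mem_maximalAtlas (I := 𝓘(ℝ, E)) (n := ∞) x₀)
  exact congrArg (fun T : E →L[ℝ] E ↦ T u) (hm.symm_comp_deriv hx)

variable [FiniteDimensional ℝ E]

theorem SymplecticForm.exists_smooth_reading (σ : SymplecticForm E X) (x₀ : X) :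
    ∃ β : X → E →L[ℝ] E →L[ℝ] ℝ, ContMDiffAt 𝓘(ℝ, E) 𝓘(ℝ, E →L[ℝ] E →L[ℝ] ℝ) ∞ β x₀ ∧
      ∀ x ∈ (chartAt E x₀).source, β x = (σ.bilin x).pullback₂ (chartDerivSymm E x₀ x) := by
  obtain ⟨η, hη, hησ, -⟩ := σ.exists_pullback (chartAt E x₀).open_target
    (contMDiffOn_chart_symm (I := 𝓘(ℝ, E)) (x := x₀)) x₀
    fun y hy ↦ (chartAt E x₀).map_target hy
  have hx₀ := mem_chart_source E x₀
  refine ⟨fun x ↦ η (chartAt E x₀ x), ?_, fun x hx ↦ ?_⟩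
  · have h1 : ContMDiffAt 𝓘(ℝ, E) 𝓘(ℝ, E →L[ℝ] E →L[ℝ] ℝ) ∞ η (chartAt E x₀ x₀) :=
      (hη.contDiffAt ((chartAt E x₀).open_target.mem_nhds
        ((chartAt E x₀).map_source hx₀))).contMDiffAt
    exact h1.comp x₀ ((contMDiffOn_chart (I := 𝓘(ℝ, E)) (x := x₀)).contMDiffAt
      ((chartAt E x₀).open_source.mem_nhds hx₀))
  · have hbase : ∀ z, z = x → ∀ a b : E, σ.bilin z a b = σ.bilin x a b := by
      rintro _ rfl a b
      rfl
    ext u v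
    exact (hησ _ ((chartAt E x₀).map_source hx) u v).trans
      (hbase _ ((chartAt E x₀).left_inv hx) _ _)

/-- `J` is chosen point by point, and uniqueness makes the choice harmless: read in the chart at
`x₀`, it must coincide with the smooth function `Ψ` of the readings of `g` and `σ`. -/
theorem exists_almostComplexStructure (σ : SymplecticForm E X) {g : X → E →L[ℝ] E →L[ℝ] ℝ}
    (hg : ∀ x u v, g x u v = g x v u) (hpos : ∀ x u, u ≠ 0 → 0 < g x u u)
    (hsmooth : ∀ x₀, ∃ γ : X → E →L[ℝ] E →L[ℝ] ℝ,
      ContMDiffAt 𝓘(ℝ, E) 𝓘(ℝ, E →L[ℝ] E →L[ℝ] ℝ) ∞ γ x₀ ∧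
      ∀ x ∈ (chartAt E x₀).source, γ x = (g x).pullback₂ (chartDerivSymm E x₀ x)) :
    ∃ J : AlmostComplexStructure E X, ∀ x, IsPolar (g x) (σ.bilin x) (J.toEnd x) := by
  have : IsManifold 𝓘(ℝ, E) 1 X := .of_le (n := ∞) (by simp)
  have hex : ∀ x, ∃ J, IsPolar (g x) (σ.bilin x) J := fun x ↦ by
    obtain ⟨Ψ, -, h⟩ := exists_smooth_polar (hg x) (hpos x) (σ.bilin_alt x)
      (σ.bilin_nondegenerate x)
    exact ⟨_, h.self_of_nhds (hg x) (σ.bilin_alt x)⟩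
  choose J hJ using hex
  refine ⟨⟨J, fun x₀ ↦ ?_, fun x u ↦ (hJ x).sq u⟩, hJ⟩
  rw [contMDiffAt_hom_bundle]
  refine ⟨contMDiffAt_id, ?_⟩
  obtain ⟨γ, hγ, hγg⟩ := hsmooth x₀
  obtain ⟨β, hβ, hβσ⟩ := σ.exists_smooth_reading x₀
  have hx₀ := mem_chart_source E x₀
  have hTinj : ∀ x ∈ (chartAt E x₀).source, ∀ u, chartDerivSymm E x₀ x u = 0 → u = 0 :=
    fun x hx u hu ↦ by rw [← chartDeriv_chartDerivSymm hx u, hu, map_zero]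
  have hγpos : ∀ x ∈ (chartAt E x₀).source, ∀ u, u ≠ 0 → 0 < γ x u u := fun x hx u hu ↦ by
    rw [hγg x hx]
    exact hpos x _ fun h ↦ hu (hTinj x hx u h)
  have hγsymm : ∀ x ∈ (chartAt E x₀).source, ∀ u v, γ x u v = γ x v u := fun x hx u v ↦ by
    rw [hγg x hx]
    exact hg x _ _
  have hβalt : ∀ x ∈ (chartAt E x₀).source, ∀ u v, β x u v = -β x v u := fun x hx u v ↦ by
    rw [hβσ x hx]
    exact σ.bilin_alt x _ _
  have hβnd : ∀ u, (∀ v, β x₀ u v = 0) → u = 0 := fun u hu ↦ by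
    refine hTinj x₀ hx₀ u (σ.bilin_nondegenerate x₀ _ fun v ↦ ?_)
    rw [hβσ x₀ hx₀] at hu
    have := hu (chartDeriv E x₀ x₀ v)
    rwa [ContinuousLinearMap.pullback₂_apply, chartDerivSymm_chartDeriv hx₀] at this
  obtain ⟨Ψ, hΨ, hΨp⟩ := exists_smooth_polar (hγsymm x₀ hx₀) (hγpos x₀ hx₀) (hβalt x₀ hx₀) hβnd
  have hpair : ContMDiffAt 𝓘(ℝ, E)
      𝓘(ℝ, (E →L[ℝ] E →L[ℝ] ℝ) × (E →L[ℝ] E →L[ℝ] ℝ)) ∞ (fun x ↦ (γ x, β x)) x₀ :=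
    hγ.prodMk_space hβ
  have hcomp : ContMDiffAt 𝓘(ℝ, E) 𝓘(ℝ, E →L[ℝ] E) ∞ (fun x ↦ Ψ (γ x, β x)) x₀ :=
    ContMDiffAt.comp (g := Ψ) x₀ hΨ.contMDiffAt hpair
  refine hcomp.congr_of_eventuallyEq ?_
  have hev := hpair.continuousAt.eventually hΨp
  filter_upwards [hev, (chartAt E x₀).open_source.mem_nhds hx₀] with x hx hxs
  have h1 := hx (hγsymm x hxs) (hβalt x hxs)
  have h2 := (hJ x).pullback₂ (chartDeriv_chartDerivSymm hxs) (chartDerivSymm_chartDeriv hxs)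
  rw [← hγg x hxs, ← hβσ x hxs] at h2
  exact (inCoordinates_tangentSpace hxs (J x)).trans
    (h2.unique (hγsymm x hxs) (hγpos x hxs) (hβalt x hxs) h1)

end AlmostComplex

/-! ### Gluing the metrics of a family of charts -/

section Metric

variable {E : Type*} [NormedAddCommGroup E] [NormedSpace ℝ E]
  {X : Type*} [TopologicalSpace X] [ChartedSpace E X] [IsManifold 𝓘(ℝ, E) ∞ X]
  {F : Type*} [NormedAddCommGroup F] [NormedSpace ℝ F]

/-- The differential at `x` of the inverse of the parametrization `φ`. -/
def paramDerivSymm (E : Type*) [NormedAddCommGroup E] [NormedSpace ℝ E] [ChartedSpace E X]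
    (φ : OpenPartialHomeomorph F X) (x : X) : E →L[ℝ] F :=
  mfderiv 𝓘(ℝ, E) 𝓘(ℝ, F) φ.symm x

theorem paramDerivSymm_comp_chartDerivSymm {φ : OpenPartialHomeomorph F X}
    (hφ : ContMDiffOn 𝓘(ℝ, E) 𝓘(ℝ, F) ∞ φ.symm φ.target) {x₀ x : X}
    (hx : x ∈ (chartAt E x₀).source) (hxφ : x ∈ φ.target) :
    ContDiffAt ℝ ∞ (fun y ↦ φ.symm ((chartAt E x₀).symm y)) (chartAt E x₀ x) ∧
      fderiv ℝ (fun y ↦ φ.symm ((chartAt E x₀).symm y)) (chartAt E x₀ x) =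
        paramDerivSymm E φ x ∘L chartDerivSymm E x₀ x := by
  set κ := chartAt E x₀
  have hκx : κ.symm (κ x) = x := κ.left_inv hx
  have h1 : ContMDiffAt 𝓘(ℝ, E) 𝓘(ℝ, E) ∞ κ.symm (κ x) :=
    (contMDiffOn_chart_symm (I := 𝓘(ℝ, E)) (x := x₀)).contMDiffAt
      (κ.open_target.mem_nhds (κ.map_source hx))
  have h2 : ContMDiffAt 𝓘(ℝ, E) 𝓘(ℝ, F) ∞ φ.symm x :=
    hφ.contMDiffAt (φ.open_target.mem_nhds hxφ)
  have h3 : ContMDiffAt 𝓘(ℝ, E) 𝓘(ℝ, F) ∞ φ.symm (κ.symm (κ x)) := by rwa [hκx]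
  refine ⟨(h3.comp (κ x) h1).contDiffAt, ?_⟩
  have h4 : HasMFDerivAt 𝓘(ℝ, E) 𝓘(ℝ, F) φ.symm (κ.symm (κ x))
      (paramDerivSymm E φ x : E →L[ℝ] F) := by
    rw [hκx]
    exact (h2.mdifferentiableAt (by simp)).hasMFDerivAt
  have h5 := h4.comp (κ x) (h1.mdifferentiableAt (by simp)).hasMFDerivAt
  have h6 : HasFDerivAt (fun y ↦ φ.symm (κ.symm y))
      (paramDerivSymm E φ x ∘L chartDerivSymm E x₀ x) (κ x) := hasMFDerivAt_iff_hasFDerivAt.1 h5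
  exact h6.fderiv

/-- A convex combination of positive definite forms is positive definite, so a partition of unity
glues the chart metrics. The last clause records where the gluing changes nothing: around a point
covered by no other `U i`. -/
theorem exists_glued_metric [FiniteDimensional ℝ E] [T2Space X]
    [SigmaCompactSpace X] {b : F →L[ℝ] F →L[ℝ] ℝ}
    (hb : ∀ u v, b u v = b v u) (hbpos : ∀ u, u ≠ 0 → 0 < b u u)
    {φ : X → OpenPartialHomeomorph F X}
    (hφ : ∀ i, ContMDiffOn 𝓘(ℝ, F) 𝓘(ℝ, E) ∞ (φ i) (φ i).source)
    (hφ' : ∀ i, ContMDiffOn 𝓘(ℝ, E) 𝓘(ℝ, F) ∞ (φ i).symm (φ i).target)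
    {U : X → Set X} (hU : ∀ i, IsOpen (U i)) (hmem : ∀ i, i ∈ U i)
    (hUφ : ∀ i, U i ⊆ (φ i).target) :
    ∃ g : X → E →L[ℝ] E →L[ℝ] ℝ, (∀ x u v, g x u v = g x v u) ∧
      (∀ x u, u ≠ 0 → 0 < g x u u) ∧
      (∀ x₀, ∃ γ : X → E →L[ℝ] E →L[ℝ] ℝ,
        ContMDiffAt 𝓘(ℝ, E) 𝓘(ℝ, E →L[ℝ] E →L[ℝ] ℝ) ∞ γ x₀ ∧
        ∀ x ∈ (chartAt E x₀).source, γ x = (g x).pullback₂ (chartDerivSymm E x₀ x)) ∧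
      ∀ p, (∀ i, i ≠ p → p ∉ U i) → ∃ W, IsOpen W ∧ p ∈ W ∧ W ⊆ (φ p).target ∧
        ∀ x ∈ W, g x = b.pullback₂ (paramDerivSymm E (φ p) x) := by
  obtain ⟨ρ, hρ⟩ := SmoothPartitionOfUnity.exists_isSubordinate 𝓘(ℝ, E) (isClosed_univ (X := X))
    U hU fun x _ ↦ mem_iUnion.2 ⟨x, hmem x⟩
  have hρφ : ∀ i x, ρ i x ≠ 0 → x ∈ (φ i).target := fun i x h ↦
    hUφ i (hρ i (subset_tsupport _ h))
  set g : X → E →L[ℝ] E →L[ℝ] ℝ := fun x ↦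
    ∑ᶠ i, ρ i x • b.pullback₂ (paramDerivSymm E (φ i) x)
  have hsum : ∀ {G : Type _} [AddCommGroup G] [Module ℝ G] (x : X) (f : X → G),
      ∑ᶠ i, ρ i x • f i = ∑ i ∈ ρ.finsupport x, ρ i x • f i := by
    intro G _ _ x f
    refine finsum_eq_sum_of_support_subset _ fun i hi ↦ ?_
    rw [ρ.coe_finsupport]
    exact fun h0 ↦ hi (by simp only [h0, zero_smul])
  have hgs : ∀ x u v, g x u v = ∑ i ∈ ρ.finsupport x, ρ i x *
      b (paramDerivSymm E (φ i) x u) (paramDerivSymm E (φ i) x v) := fun x u v ↦ by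
    simp only [g]
    rw [hsum x fun i ↦ b.pullback₂ (paramDerivSymm E (φ i) x)]
    simp
  have hbnn : ∀ u, 0 ≤ b u u := fun u ↦ by
    by_cases hu : u = 0
    · simp [hu]
    · exact (hbpos u hu).le
  refine ⟨g, fun x u v ↦ ?_, fun x u hu ↦ ?_, fun x₀ ↦ ?_, fun p hp ↦ ?_⟩
  · rw [hgs, hgs]
    exact Finset.sum_congr rfl fun i _ ↦ by rw [hb]
  · rw [hgs]
    obtain ⟨i, hi⟩ := ρ.exists_pos_of_mem (mem_univ x)
    refine Finset.sum_pos' (fun j _ ↦ mul_nonneg (ρ.nonneg j x) (hbnn _)) ⟨i, ?_, ?_⟩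
    · rw [ρ.mem_finsupport]
      exact hi.ne'
    · refine mul_pos hi (hbpos _ fun h0 ↦ hu ?_)
      have hm : (φ i).MDifferentiable 𝓘(ℝ, F) 𝓘(ℝ, E) :=
        ⟨(hφ i).mdifferentiableOn (by simp), (hφ' i).mdifferentiableOn (by simp)⟩
      exact hm.symm.mfderiv_injective (hρφ i x hi.ne')
        (h0.trans (map_zero (paramDerivSymm E (φ i) x)).symm)
  -- In the chart at `x₀` each summand is the pullback of `b` by the derivative of a transition map,
  -- which is a smooth function with values in a fixed vector space.
  · refine ⟨fun x ↦ ∑ᶠ i, ρ i x • b.pullback₂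
      (fderiv ℝ (fun y ↦ (φ i).symm ((chartAt E x₀).symm y)) (chartAt E x₀ x)),
      ρ.contMDiffAt_finsum fun i hi ↦ ?_, fun x hx ↦ ?_⟩
    · have hx₀ := mem_chart_source E x₀
      have h1 := (paramDerivSymm_comp_chartDerivSymm (hφ' i) hx₀ (hUφ i (hρ i hi))).1
      have h2 : ContDiffAt ℝ ∞ (fun y ↦ b.pullback₂
          (fderiv ℝ (fun y ↦ (φ i).symm ((chartAt E x₀).symm y)) y)) (chartAt E x₀ x₀) :=
        (contDiff_pullback₂ b).contDiffAt.comp (chartAt E x₀ x₀) (h1.fderiv_right (by simp))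
      exact h2.contMDiffAt.comp x₀ ((contMDiffOn_chart (I := 𝓘(ℝ, E)) (x := x₀)).contMDiffAt
        ((chartAt E x₀).open_source.mem_nhds hx₀))
    · ext u v
      simp only
      rw [ContinuousLinearMap.pullback₂_apply, hgs, hsum x fun i ↦ b.pullback₂
        (fderiv ℝ (fun y ↦ (φ i).symm ((chartAt E x₀).symm y)) (chartAt E x₀ x))]
      simp only [_root_.sum_apply, _root_.smul_apply, smul_eq_mul]
      refine Finset.sum_congr rfl fun i hi ↦ ?_
      rw [ρ.mem_finsupport] at hi
      rw [(paramDerivSymm_comp_chartDerivSymm (hφ' i) hx (hρφ i x hi)).2]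
      rfl
  -- By local finiteness the other supports have closed union, which misses `p`; on its complement
  -- `ρ p` is identically one.
  · have hclosed : IsClosed (⋃ i : {i // i ≠ p}, tsupport (ρ i)) :=
      (ρ.locallyFinite.closure.comp_injective Subtype.val_injective).isClosed_iUnion
        fun _ ↦ isClosed_closure
    have hzero : ∀ x ∈ (⋃ i : {i // i ≠ p}, tsupport (ρ i))ᶜ, ∀ i, i ≠ p → ρ i x = 0 := by
      intro x hx i hi
      by_contra h
      exact hx (mem_iUnion.2 ⟨⟨i, hi⟩, subset_tsupport _ h⟩)
    have hone : ∀ x ∈ (⋃ i : {i // i ≠ p}, tsupport (ρ i))ᶜ, ρ p x = 1 := by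
      intro x hx
      rw [← ρ.sum_eq_one (mem_univ x), finsum_eq_single _ p (hzero x hx)]
    refine ⟨_, hclosed.isOpen_compl, fun h ↦ ?_, fun x hx ↦ ?_, fun x hx ↦ ?_⟩
    · obtain ⟨i, hi⟩ := mem_iUnion.1 h
      exact hp i i.2 (hρ i hi)
    · exact hρφ p x (by simp [hone x hx])
    · simp only [g]
      rw [finsum_eq_single _ p fun i hi ↦ by rw [hzero x hx i hi, zero_smul], hone x hx, one_smul]

end Metric

/-! ### The standard Kähler structure of `ℂⁿ` -/

section Standard

variable {n : ℕ}

/-- The real part of a coordinate of `ℂⁿ`. -/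
def reCoord (j : Fin n) : CSpace n →L[ℝ] ℝ :=
  Complex.reCLM ∘L (EuclideanSpace.proj j : CSpace n →L[ℂ] ℂ).restrictScalars ℝ

/-- The imaginary part of a coordinate of `ℂⁿ`. -/
def imCoord (j : Fin n) : CSpace n →L[ℝ] ℝ :=
  Complex.imCLM ∘L (EuclideanSpace.proj j : CSpace n →L[ℂ] ℂ).restrictScalars ℝ

@[simp]
theorem reCoord_apply (j : Fin n) (z : CSpace n) : reCoord j z = (z j).re := rfl

@[simp]
theorem imCoord_apply (j : Fin n) (z : CSpace n) : imCoord j z = (z j).im := rfl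

/-- The Euclidean metric of `ℂⁿ`. -/
def stdMetricForm (n : ℕ) : CSpace n →L[ℝ] CSpace n →L[ℝ] ℝ :=
  ∑ j, ((reCoord j).smulRight (reCoord j) + (imCoord j).smulRight (imCoord j))

/-- The standard symplectic form of `ℂⁿ`, as a continuous bilinear form. -/
def stdSymplecticForm (n : ℕ) : CSpace n →L[ℝ] CSpace n →L[ℝ] ℝ :=
  ∑ j, ((reCoord j).smulRight (imCoord j) - (imCoord j).smulRight (reCoord j))

/-- Multiplication by `√-1` on `ℂⁿ`. -/
def mulI (n : ℕ) : CSpace n →L[ℝ] CSpace n :=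
  (Complex.I • ContinuousLinearMap.id ℂ (CSpace n)).restrictScalars ℝ

theorem mulI_apply (u : CSpace n) : mulI n u = Complex.I • u := rfl

theorem stdMetricForm_apply (u v : CSpace n) :
    stdMetricForm n u v = ∑ j, ((u j).re * (v j).re + (u j).im * (v j).im) := by
  simp [stdMetricForm]

theorem stdSymplecticForm_apply (u v : CSpace n) :
    stdSymplecticForm n u v = stdSymplectic u v := by
  simp [stdSymplecticForm, stdSymplectic]

theorem stdMetricForm_pos (u : CSpace n) (hu : u ≠ 0) : 0 < stdMetricForm n u u := by
  rw [stdMetricForm_apply]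
  have hnn : ∀ j, 0 ≤ (u j).re * (u j).re + (u j).im * (u j).im := fun j ↦
    add_nonneg (mul_self_nonneg _) (mul_self_nonneg _)
  refine lt_of_le_of_ne (Finset.sum_nonneg fun j _ ↦ hnn j) fun h ↦ hu ?_
  ext j
  have := (Finset.sum_eq_zero_iff_of_nonneg fun j _ ↦ hnn j).1 h.symm j (Finset.mem_univ j)
  exact Complex.normSq_eq_zero.1 this

theorem isPolar_mulI : IsPolar (stdMetricForm n) (stdSymplecticForm n) (mulI n) where
  sq u := by simp [mulI_apply, smul_smul]
  metric u v := by
    simp only [stdMetricForm_apply, mulI_apply]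
    exact Finset.sum_congr rfl fun j _ ↦ by simp; ring
  symplectic u v := by
    simp only [stdSymplecticForm_apply, stdSymplectic, mulI_apply]
    exact Finset.sum_congr rfl fun j _ ↦ by simp; ring
  pos u hu := by
    refine (stdMetricForm_pos u hu).trans_eq ?_
    simp only [stdMetricForm_apply, stdSymplecticForm_apply, stdSymplectic, mulI_apply]
    exact Finset.sum_congr rfl fun j _ ↦ by simp

theorem mixedPlane_zero : mixedPlane n 0 = realPlane n := by
  ext z
  simp [mixedPlane, realPlane]

theorem eq_zero_of_mem_planes {z : CSpace n} (h : z ∈ imagPlane n) (h' : z ∈ realPlane n) :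
    z = 0 := by
  ext j
  exact Complex.ext (h j) (h' j)

end Standard

/-! ### Parametrizations, and recovering the standard complex structure in them. -/

section Kahler

variable {E : Type*} [NormedAddCommGroup E] [NormedSpace ℝ E] [FiniteDimensional ℝ E]
  {X : Type*} [TopologicalSpace X] [ChartedSpace E X]

theorem exists_parametrization [IsManifold 𝓘(ℝ, E) ∞ X] {F : Type*} [NormedAddCommGroup F]
    [NormedSpace ℝ F] [FiniteDimensional ℝ F] (h : Module.finrank ℝ F = Module.finrank ℝ E)
    (x : X) : ∃ φ : OpenPartialHomeomorph F X, x ∈ φ.target ∧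
      ContMDiffOn 𝓘(ℝ, F) 𝓘(ℝ, E) ∞ φ φ.source ∧
      ContMDiffOn 𝓘(ℝ, E) 𝓘(ℝ, F) ∞ φ.symm φ.target := by
  set Λ : F ≃L[ℝ] E := ContinuousLinearEquiv.ofFinrankEq h
  have hΛ : ContMDiff 𝓘(ℝ, F) 𝓘(ℝ, E) ∞ Λ := Λ.contDiff.contMDiff
  have hΛ' : ContMDiff 𝓘(ℝ, E) 𝓘(ℝ, F) ∞ Λ.symm := Λ.symm.contDiff.contMDiff
  refine ⟨Λ.toHomeomorph.toOpenPartialHomeomorph ≫ₕ (chartAt E x).symm,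
    ⟨mem_chart_source E x, mem_univ _⟩, ?_, ?_⟩
  · exact (contMDiffOn_chart_symm (I := 𝓘(ℝ, E)) (x := x)).comp hΛ.contMDiffOn fun z hz ↦ hz.2
  · exact hΛ'.comp_contMDiffOn
      ((contMDiffOn_chart (I := 𝓘(ℝ, E)) (x := x)).mono fun z hz ↦ hz.1)

/-- Metric and symplectic form are both the pullbacks of the standard ones, so the transported
multiplication by `√-1` is polar for them and equals `J` by uniqueness. -/
theorem complex_pullback_of_isPolar {n : ℕ} {σ : SymplecticForm E X}
    {φ : OpenPartialHomeomorph (CSpace n) X}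
    (hφ : ContMDiffOn 𝓘(ℝ, CSpace n) 𝓘(ℝ, E) ∞ φ φ.source)
    (hφ' : ContMDiffOn 𝓘(ℝ, E) 𝓘(ℝ, CSpace n) ∞ φ.symm φ.target) {z : CSpace n}
    (hz : z ∈ φ.source)
    (hσ : ∀ u v : CSpace n, σ.bilin (φ z) (mfderiv 𝓘(ℝ, CSpace n) 𝓘(ℝ, E) φ z u)
      (mfderiv 𝓘(ℝ, CSpace n) 𝓘(ℝ, E) φ z v) = stdSymplectic u v)
    {g : E →L[ℝ] E →L[ℝ] ℝ} (hg : ∀ u v, g u v = g v u) (hpos : ∀ u, u ≠ 0 → 0 < g u u)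
    (hgφ : g = (stdMetricForm n).pullback₂ (paramDerivSymm E φ (φ z))) {J : E →L[ℝ] E}
    (hJ : IsPolar g (σ.bilin (φ z)) J) (u : CSpace n) :
    (mfderiv 𝓘(ℝ, CSpace n) 𝓘(ℝ, E) φ z : CSpace n →L[ℝ] E) (Complex.I • u) =
      J ((mfderiv 𝓘(ℝ, CSpace n) 𝓘(ℝ, E) φ z : CSpace n →L[ℝ] E) u) := by
  set D : CSpace n →L[ℝ] E := mfderiv 𝓘(ℝ, CSpace n) 𝓘(ℝ, E) φ z
  set T : E →L[ℝ] CSpace n := paramDerivSymm E φ (φ z)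
  have hm : φ.MDifferentiable 𝓘(ℝ, CSpace n) 𝓘(ℝ, E) :=
    ⟨hφ.mdifferentiableOn (by simp), hφ'.mdifferentiableOn (by simp)⟩
  have hTD : ∀ u, T (D u) = u := fun u ↦
    congrArg (fun S : CSpace n →L[ℝ] CSpace n ↦ S u) (hm.symm_comp_deriv hz)
  have hDT : ∀ u, D (T u) = u := fun u ↦ by
    have h := hm.comp_symm_deriv (φ.map_source hz)
    rw [φ.left_inv hz] at h
    exact congrArg (fun S : E →L[ℝ] E ↦ S u) h
  have hσ' : σ.bilin (φ z) = (stdSymplecticForm n).pullback₂ T := by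
    ext a b
    rw [ContinuousLinearMap.pullback₂_apply, stdSymplecticForm_apply]
    refine Eq.trans ?_ (hσ (T a) (T b))
    change _ = σ.bilin (φ z) (D (T a)) (D (T b))
    rw [hDT, hDT]
  have h1 := (isPolar_mulI (n := n)).pullback₂ hDT hTD
  rw [← hgφ, ← hσ'] at h1
  rw [hJ.unique hg hpos (σ.bilin_alt _) h1]
  exact (congrArg (fun w ↦ D (mulI n w)) (hTD u)).symm

end Kahler

end

/-! ### Assembly: adapted charts, glued metric, polar structure. -/

theorem mainTheorem6 (n : ℕ)
    {X : Type*} [TopologicalSpace X] [T2Space X] [SecondCountableTopology X]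
    [ChartedSpace (EuclideanSpace ℝ (Fin (2 * n))) X]
    [IsManifold (𝓡 (2 * n)) ∞ X]
    (σ : SymplecticForm (EuclideanSpace ℝ (Fin (2 * n))) X)
    {L L' : Type*}
    [TopologicalSpace L] [ChartedSpace (EuclideanSpace ℝ (Fin n)) L] [IsManifold (𝓡 n) ∞ L]
    [TopologicalSpace L'] [ChartedSpace (EuclideanSpace ℝ (Fin n)) L'] [IsManifold (𝓡 n) ∞ L']
    (ι : L → X) (ι' : L' → X)
    (hι : IsLagrangianEmbedding n σ ι) (hι' : IsLagrangianEmbedding n σ ι')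
    (htrans : IntersectTransversely n (EuclideanSpace ℝ (Fin (2 * n))) ι ι')
    (hclosed : IsClosed (Set.range ι ∩ Set.range ι')) :
    ∃ J : AlmostComplexStructure (EuclideanSpace ℝ (Fin (2 * n))) X,
      J.IsCompatible σ ∧
      LocallyStandard n σ J (Set.range ι) (Set.range ι') ∧
      ∀ x ∈ Set.range ι ∩ Set.range ι', ∃ φ : OpenPartialHomeomorph (CSpace n) X,
        IsKahlerChartAt σ J x φ ∧
        φ.source ∩ φ ⁻¹' Set.range ι = φ.source ∩ imagPlane n ∧
        φ.source ∩ φ ⁻¹' Set.range ι' = φ.source ∩ realPlane n := by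
  have : LocallyCompactSpace X :=
    ChartedSpace.locallyCompactSpace (EuclideanSpace ℝ (Fin (2 * n))) X
  set S : Set X := Set.range ι ∩ Set.range ι'
  have hchart : ∀ x : X, ∃ φ : OpenPartialHomeomorph (CSpace n) X, x ∈ φ.target ∧
      ContMDiffOn 𝓘(ℝ, CSpace n) (𝓡 (2 * n)) ∞ φ φ.source ∧
      ContMDiffOn (𝓡 (2 * n)) 𝓘(ℝ, CSpace n) ∞ φ.symm φ.target ∧
      (x ∈ S → 0 ∈ φ.source ∧ φ 0 = x ∧
        (∀ z ∈ φ.source, ∀ u v : CSpace n,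
          σ.bilin (φ z) (mfderiv 𝓘(ℝ, CSpace n) (𝓡 (2 * n)) φ z u)
            (mfderiv 𝓘(ℝ, CSpace n) (𝓡 (2 * n)) φ z v) = stdSymplectic u v) ∧
        φ.source ∩ φ ⁻¹' Set.range ι = φ.source ∩ imagPlane n ∧
        φ.source ∩ φ ⁻¹' Set.range ι' = φ.source ∩ realPlane n) := by
    intro x
    by_cases hx : x ∈ S
    · obtain ⟨⟨p, rfl⟩, q, hq⟩ := hx
      obtain ⟨φ, h0, hφ0, h1, h2, h3⟩ := exists_symplectic_chart hι hι' hq.symm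
        (htrans p q hq.symm)
      exact ⟨φ, by rw [← hφ0]; exact φ.map_source h0, h1, h2, fun _ ↦ ⟨h0, hφ0, h3⟩⟩
    · obtain ⟨φ, h0, h1, h2⟩ := exists_parametrization
        (E := EuclideanSpace ℝ (Fin (2 * n))) (F := CSpace n) (by
          rw [finrank_real_of_complex]
          simp) x
      exact ⟨φ, h0, h1, h2, fun h ↦ absurd h hx⟩
  choose φ hφx hφ hφ' hφS using hchart
  -- The planes `√-1 ℝⁿ` and `ℝⁿ` meet only at the origin, so an adapted chart sees no intersection
  -- point but its centre.
  have hsingle : ∀ x ∈ S, ∀ y ∈ (φ x).target, y ∈ S → y = x := by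
    intro x hx y hy hyS
    obtain ⟨-, hφ0, -, hL, hL'⟩ := hφS x hx
    have hz := (φ x).map_target hy
    have hzy := (φ x).right_inv hy
    have h1 : (φ x).symm y ∈ (φ x).source ∩ imagPlane n := by
      rw [← hL]
      exact ⟨hz, by rw [Set.mem_preimage, hzy]; exact hyS.1⟩
    have h2 : (φ x).symm y ∈ (φ x).source ∩ realPlane n := by
      rw [← hL']
      exact ⟨hz, by rw [Set.mem_preimage, hzy]; exact hyS.2⟩
    rw [← hzy, eq_zero_of_mem_planes h1.2 h2.2, hφ0]
  set U : X → Set X := fun x ↦ (φ x).target \ (S \ {x})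
  have hU : ∀ x, IsOpen (U x) := by
    intro x
    by_cases hx : x ∈ S
    · have : U x = (φ x).target := by
        ext y
        exact ⟨fun h ↦ h.1, fun h ↦ ⟨h, fun hy ↦ hy.2 (hsingle x hx y h hy.1)⟩⟩
      rw [this]
      exact (φ x).open_target
    · have : U x = (φ x).target \ S := by
        simp only [U]
        rw [Set.sdiff_singleton_eq_self hx]
      rw [this]
      exact (φ x).open_target.sdiff hclosed
  obtain ⟨g, hg, hpos, hsmooth, hlocal⟩ := exists_glued_metric
    (E := EuclideanSpace ℝ (Fin (2 * n))) (b := stdMetricForm n)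
    (fun u v ↦ by
      simp only [stdMetricForm_apply]
      exact Finset.sum_congr rfl fun j _ ↦ by ring) stdMetricForm_pos hφ hφ' hU
    (fun x ↦ ⟨hφx x, fun h ↦ h.2 rfl⟩) fun x ↦ Set.sdiff_subset
  obtain ⟨J, hJ⟩ := exists_almostComplexStructure σ hg hpos hsmooth
  have hkahler : ∀ x ∈ S, ∃ φ : OpenPartialHomeomorph (CSpace n) X, IsKahlerChartAt σ J x φ ∧
      φ.source ∩ φ ⁻¹' Set.range ι = φ.source ∩ imagPlane n ∧
      φ.source ∩ φ ⁻¹' Set.range ι' = φ.source ∩ realPlane n := by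
    intro x hx
    obtain ⟨h0, hφ0, hσ, hL, hL'⟩ := hφS x hx
    obtain ⟨W, hW, hxW, -, hgW⟩ := hlocal x fun i hi h ↦ h.2 ⟨hx, fun h' ↦ hi h'.symm⟩
    -- The chart is restricted to the part where the glued metric is exactly its Euclidean metric.
    set T := (φ x).source ∩ φ x ⁻¹' W
    have hT : IsOpen T := (φ x).isOpen_inter_preimage hW
    set φ' := (φ x).restrOpen T hT
    have hsub : ∀ z ∈ φ'.source, z ∈ (φ x).source ∧ φ x z ∈ W := fun z hz ↦ hz.2
    have hrestr : ∀ {A : Set X} {P : Set (CSpace n)},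
        (φ x).source ∩ φ x ⁻¹' A = (φ x).source ∩ P →
          φ'.source ∩ φ' ⁻¹' A = φ'.source ∩ P := by
      intro A P h
      ext z
      refine and_congr_right fun hz ↦ ?_
      have := Set.ext_iff.1 h z
      exact ⟨fun hA ↦ (this.1 ⟨(hsub z hz).1, hA⟩).2, fun hP ↦ (this.2 ⟨(hsub z hz).1, hP⟩).2⟩
    refine ⟨φ', ⟨⟨h0, h0, ?_⟩, hφ0, (hφ x).mono fun z hz ↦ (hsub z hz).1,
      (hφ' x).mono fun y hy ↦ hy.1, fun z hz u ↦ ?_, fun z hz u v ↦ hσ z (hsub z hz).1 u v⟩,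
      hrestr hL, hrestr hL'⟩
    · rw [Set.mem_preimage, hφ0]
      exact hxW
    · exact complex_pullback_of_isPolar (hφ x) (hφ' x) (hsub z hz).1 (hσ z (hsub z hz).1)
        (hg _) (hpos _) (hgW _ (hsub z hz).2) (hJ _) u
  refine ⟨J, fun x ↦ ⟨fun u v ↦ (hJ x).symplectic u v, fun u hu ↦ (hJ x).pos u hu⟩,
    fun x hx ↦ ?_, hkahler⟩
  obtain ⟨φ, h1, h2, h3⟩ := hkahler x hx
  exact ⟨φ, 0, Nat.zero_le n, h1, h2, by rw [mixedPlane_zero]; exact h3⟩
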